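/- Let $(\Omega,\mathcal F,\mathbb P)$ be a probability space and let $\theta_1,\theta_2,\dots$ be independent random variables on it, each uniformly distributed on $[0,1]$; put $X_n=e^{2\pi i\theta_n}$. Let $\phi_n:\mathbb R\to\mathbb C$ $(n\ge 1)$ satisfy $\sup_n\sup_{x}|\phi_n(x)|<\infty$ and suppose there are constants $L\ge 1$, $\delta>0$ such that $$L^{-1}|x-y|\le|\phi_n(x)-\phi_n(y)|\le L|x-y|\qquad\text{for all } n\ge 1 \text{ and all } x,y\in\mathbb R \text{ with } |x-y|\le\delta .$$ Let $a_n\in\mathbb C\setminus\{0\}$ with $\sum_{n\ge1}|a_n|<\infty$, and let $(\lambda_n)_{n\ge1}$ be a nondecreasing real sequence with $\lambda_1=1$ and $q:=\sup_n\lambda_{n+1}/\lambda_n<\infty$, $q>1$ (the last condition is automatic if $(\lambda_n)$ is strictly increasing). Define $$s_k=\Bigl(\sum_{q^k\le\lambda_n<q^{k+1}}|a_n|^2\Bigr)^{1/2},\qquad \sigma=\liminf_{k\to\infty}\frac{-\log s_k}{k\log q},\qquad \tau=\limsup_{k\to\infty}\frac{-\log s_k}{k\log q}$$ (extended real numbers,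 with $-\log 0=+\infty$), the random series $$S(x)=\sum_{n=1}^\infty a_nX_n\phi_n(\lambda_nx)\qquad(x\in\mathbb R),$$ and, for $A\subset\mathbb R$, its graph $G_S(A)=\{(x,S(x)):x\in A\}\subset\mathbb R^3$, where $\mathbb C$ is identified with $\mathbb R^2$. Let $\dim_{\mathcal H}$ denote Hausdorff dimension. (i) If $0<\sigma\le\tau\le1$, then for every Borel set $A\subset\mathbb R$, almost surely $$\min\Bigl\{\frac{\dim_{\mathcal H}A}{\tau},\ \dim_{\mathcal H}A+2-2\tau\Bigr\}\le\dim_{\mathcal H}G_S(A)\le\min\Bigl\{\frac{\dim_{\mathcal H}A}{\sigma},\ \dim_{\mathcal H}A+2-2\sigma\Bigr\}.$$ (ii) If $\tau=0$, then for every Borel set $A\subset\mathbb R$ with $\dim_{\mathcal H}A>0$, almost surely $\dim_{\mathcal H}G_S(A)=2+\dim_{\mathcal H}A$. -/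

import Mathlib

open MeasureTheory ProbabilityTheory Filter

noncomputable section

namespace SteinhausSeries

/-- Local uniform bi-Lipschitz property, with constants `L` and `δ` common to all `n`:
`L⁻¹ |x - y| ≤ |φ n x - φ n y| ≤ L |x - y|` whenever `|x - y| ≤ δ`. -/
def LocallyUniformlyBiLipschitz (φ : ℕ → ℝ → ℂ) : Prop :=
  ∃ L δ : ℝ, 1 ≤ L ∧ 0 < δ ∧ ∀ (n : ℕ) (x y : ℝ), |x - y| ≤ δ →
    L⁻¹ * |x - y| ≤ ‖φ n x - φ n y‖ ∧ ‖φ n x - φ n y‖ ≤ L * |x - y|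

/-- Uniform boundedness of a sequence of functions. -/
def UniformlyBounded (φ : ℕ → ℝ → ℂ) : Prop :=
  ∃ C : ℝ, ∀ (n : ℕ) (x : ℝ), ‖φ n x‖ ≤ C

/-- The block norm `s k = (∑_{q ^ k ≤ lam n < q ^ (k + 1)} |a n| ^ 2) ^ (1 / 2)`. -/
def blockNorm (a : ℕ → ℂ) (lam : ℕ → ℝ) (q : ℝ) (k : ℕ) : ℝ :=
  Real.sqrt (∑' n : {n : ℕ // q ^ k ≤ lam n ∧ lam n < q ^ (k + 1)}, ‖a n‖ ^ 2)

/-- The quotient `-log (s k) / (k log q)`, as an extended real: it is `+∞` if `s k = 0`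
(for `k ≥ 1` and `q > 1`). -/
def blockRate (a : ℕ → ℂ) (lam : ℕ → ℝ) (q : ℝ) (k : ℕ) : EReal :=
  -ENNReal.log (ENNReal.ofReal (blockNorm a lam q k)) / ((k * Real.log q : ℝ) : EReal)

/-- `σ = liminf_k -log (s k) / (k log q)`. -/
def lowerRate (a : ℕ → ℂ) (lam : ℕ → ℝ) (q : ℝ) : EReal :=
  liminf (blockRate a lam q) atTop

/-- `τ = limsup_k -log (s k) / (k log q)`. -/
def upperRate (a : ℕ → ℂ) (lam : ℕ → ℝ) (q : ℝ) : EReal :=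
  limsup (blockRate a lam q) atTop

/-- `θ 0, θ 1, …` are independent random variables, each uniformly distributed on `[0, 1]`. -/
def IsIIDUniform {Ω : Type*} [MeasurableSpace Ω] (P : Measure Ω) (θ : ℕ → Ω → ℝ) : Prop :=
  (∀ n, Measurable (θ n)) ∧ iIndepFun θ P ∧
    ∀ n, P.map (θ n) = (volume : Measure ℝ).restrict (Set.Icc 0 1)

/-- The function `x ↦ ∑ a n * exp (2 π i t n) * φ n (lam n * x)` with phases `t`. -/
def phaseSeries (a : ℕ → ℂ) (lam : ℕ → ℝ) (φ : ℕ → ℝ → ℂ) (t : ℕ → ℝ) (x : ℝ) : ℂ :=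
  ∑' n, a n * Complex.exp (2 * Real.pi * Complex.I * t n) * φ n (lam n * x)

/-- The graph over `A` of a complex function of a real variable, as a subset of Euclidean
three-space. -/
def graphOver (f : ℝ → ℂ) (A : Set ℝ) : Set (EuclideanSpace ℝ (Fin 3)) :=
  (fun x => !₂[x, (f x).re, (f x).im]) '' A

end SteinhausSeries

end

/-!
*Upper bounds.* The increment `S x - S y` is a Steinhaus sum, hence sub-Gaussian with variance at
most a constant times `∑ ‖a n‖ ^ 2 * min 1 (lam n * |x - y|) ^ 2`. For `β < σ` the block norms
satisfy `s k = O(q ^ (-β k))`, so this variance is `O(|x - y| ^ (2 β))`, and Kolmogorov's criterion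
makes `S` locally `β`-Hölder almost surely; the bounds then hold for all sets simultaneously.

*Lower bounds.* For `τ' > τ` the block norms are eventually at least `q ^ (-τ' k)`. If `q ^ k` is
comparable to `1 / |x - y|`, the bi-Lipschitz condition gives the block a contribution of order
`|x - y| ^ τ'` to `S x - S y`, and so do any fixed number of preceding blocks. The characteristic
function of `S x - S y` is a product of values of `J₀`; the disjoint blocks make it decay fast
enough that `S x - S y` lies in any given disc of radius `ρ` with probability
`O((ρ / |x - y| ^ τ') ^ 2)`. By Fubini the graph, carrying the lift of a Frostman measure on a
compact part of `A`, has finite energy of the required order. Frostman measures of Borel sets come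
from Choquet's capacitability theorem applied to dyadic net content, which is strongly subadditive.
-/

namespace SteinhausSeries

open scoped ENNReal NNReal Topology InnerProductSpace

/-! ### Dyadic net content -/

section DyadicContent

/-- The index `(k, j)` of the dyadic interval `[j 2⁻ᵏ, (j + 1) 2⁻ᵏ)` that contains `x`. -/
noncomputable def dyadicIndex (k : ℕ) (x : ℝ) : ℕ × ℤ := (k, ⌊(2 : ℝ) ^ k * x⌋)

/-- The half-open dyadic interval `[j 2⁻ᵏ, (j + 1) 2⁻ᵏ)`, for `p = (k, j)`. -/
def dyadicCell (p : ℕ × ℤ) : Set ℝ := {x | dyadicIndex p.1 x = p}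

/-- The sum of the `s`-th powers of the lengths of a family of dyadic intervals. -/
noncomputable def dyadicCost (s : ℝ) (W : Set (ℕ × ℤ)) : ℝ≥0∞ :=
  ∑' p : W, ((2 : ℝ≥0∞)⁻¹ ^ p.1.1) ^ s

/-- A family of dyadic intervals covers a set. -/
def DyadicCovers (W : Set (ℕ × ℤ)) (E : Set ℝ) : Prop :=
  ∀ x ∈ E, ∃ k, dyadicIndex k x ∈ W

/-- The `s`-dimensional dyadic net content: the least cost of a cover by dyadic intervals of
length at most `1`. -/
noncomputable def dyadicContent (s : ℝ) (E : Set ℝ) : ℝ≥0∞ :=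
  ⨅ (W : Set (ℕ × ℤ)) (_ : DyadicCovers W E), dyadicCost s W

/-- The members of a family of dyadic intervals that lie in no longer member. -/
def maximalCells (W : Set (ℕ × ℤ)) : Set (ℕ × ℤ) :=
  {p | p ∈ W ∧ ∀ p' ∈ W, p'.1 < p.1 → ¬ dyadicCell p ⊆ dyadicCell p'}

variable {s : ℝ} {U V W : Set (ℕ × ℤ)} {E E' : Set ℝ}

theorem mem_dyadicCell {p : ℕ × ℤ} {x : ℝ} : x ∈ dyadicCell p ↔ ⌊(2 : ℝ) ^ p.1 * x⌋ = p.2 := by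
  simp [dyadicCell, dyadicIndex, Prod.ext_iff]

theorem mem_dyadicCell_dyadicIndex (k : ℕ) (x : ℝ) : x ∈ dyadicCell (dyadicIndex k x) := rfl

theorem dyadicCell_dyadicIndex_anti (x : ℝ) : Antitone fun k => dyadicCell (dyadicIndex k x) := by
  intro k k' h y hy
  have floor_eq_div (z : ℝ) : ⌊(2 : ℝ) ^ k * z⌋ = ⌊(2 : ℝ) ^ k' * z⌋ / (2 ^ (k' - k) : ℕ) := by
    rw [← Int.floor_div_natCast]
    congr 1
    obtain ⟨m, rfl⟩ := Nat.exists_eq_add_of_le h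
    simp only [Nat.add_sub_cancel_left, pow_add]
    push_cast
    field_simp
  rw [mem_dyadicCell] at hy ⊢
  simp only [dyadicIndex] at hy ⊢
  rw [floor_eq_div, floor_eq_div x, hy]

theorem exists_dyadicIndex_mem_maximalCells {x : ℝ} {k : ℕ} (h : dyadicIndex k x ∈ W) :
    ∃ l ≤ k, dyadicIndex l x ∈ maximalCells W := by
  classical
  have hex : ∃ k, dyadicIndex k x ∈ W := ⟨k, h⟩
  refine ⟨Nat.find hex, Nat.find_min' hex h, Nat.find_spec hex, fun p' hp' hlt hsub => ?_⟩
  have hx : dyadicIndex p'.1 x = p' := hsub (mem_dyadicCell_dyadicIndex _ x)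
  exact Nat.find_min hex hlt (hx ▸ hp')

theorem DyadicCovers.union (hU : DyadicCovers U E) (hV : DyadicCovers V E') :
    DyadicCovers (U ∪ V) (E ∪ E') := by
  rintro x (hx | hx)
  · exact (hU x hx).imp fun _ => Or.inl
  · exact (hV x hx).imp fun _ => Or.inr

theorem DyadicCovers.maximalCells (hW : DyadicCovers W E) : DyadicCovers (maximalCells W) E :=
  fun x hx => let ⟨_, hk⟩ := hW x hx
    (exists_dyadicIndex_mem_maximalCells hk).imp fun _ h => h.2

theorem dyadicContent_le (h : DyadicCovers W E) : dyadicContent s E ≤ dyadicCost s W :=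
  iInf₂_le W h

theorem exists_dyadicCost_lt {c : ℝ≥0∞} (h : dyadicContent s E < c) :
    ∃ W, DyadicCovers W E ∧ dyadicCost s W < c := by
  simpa [dyadicContent, iInf_lt_iff] using h

theorem dyadicContent_mono (s : ℝ) : Monotone (dyadicContent s) :=
  fun _ _ h => le_iInf₂ fun _ hW => dyadicContent_le fun x hx => hW x (h hx)

theorem dyadicCost_union_le (s : ℝ) (U V : Set (ℕ × ℤ)) :
    dyadicCost s (U ∪ V) ≤ dyadicCost s U + dyadicCost s V :=
  ENNReal.tsum_union_le (fun p : ℕ × ℤ => ((2 : ℝ≥0∞)⁻¹ ^ p.1) ^ s) U V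

theorem dyadicCost_eq_tsum_indicator (s : ℝ) (W : Set (ℕ × ℤ)) :
    dyadicCost s W = ∑' p, W.indicator (fun p => ((2 : ℝ≥0∞)⁻¹ ^ p.1) ^ s) p :=
  tsum_subtype W fun p : ℕ × ℤ => ((2 : ℝ≥0∞)⁻¹ ^ p.1) ^ s

theorem dyadicCost_finset (s : ℝ) (F : Finset (ℕ × ℤ)) :
    dyadicCost s F = ∑ p ∈ F, ((2 : ℝ≥0∞)⁻¹ ^ p.1) ^ s :=
  F.tsum_subtype' fun p : ℕ × ℤ => ((2 : ℝ≥0∞)⁻¹ ^ p.1) ^ s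

theorem dyadicContent_union_le (s : ℝ) (E E' : Set ℝ) :
    dyadicContent s (E ∪ E') ≤ dyadicContent s E + dyadicContent s E' := by
  refine ENNReal.le_of_forall_pos_le_add fun ε hε hfin => ?_
  obtain ⟨hE, hE'⟩ := ENNReal.add_lt_top.1 hfin
  have hε2 : (ε / 2 : ℝ≥0∞) ≠ 0 := by simpa using hε.ne'
  obtain ⟨U, hU, hUc⟩ := exists_dyadicCost_lt (ENNReal.lt_add_right hE.ne hε2)
  obtain ⟨V, hV, hVc⟩ := exists_dyadicCost_lt (ENNReal.lt_add_right hE'.ne hε2)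
  calc dyadicContent s (E ∪ E') ≤ dyadicCost s (U ∪ V) := dyadicContent_le (hU.union hV)
    _ ≤ _ := dyadicCost_union_le s U V
    _ ≤ (dyadicContent s E + ε / 2) + (dyadicContent s E' + ε / 2) := add_le_add hUc.le hVc.le
    _ = dyadicContent s E + dyadicContent s E' + ε := by
      rw [add_add_add_comm, ENNReal.add_halves]

/-- Strong subadditivity: the maximal members of `U ∪ V` still cover `E ∪ E'`, while the discarded
members, together with those common to `U` and `V`, cover `E ∩ E'`. -/
theorem dyadicCost_maximalCells_add_le (s : ℝ) (hU : DyadicCovers U E) (hV : DyadicCovers V E') :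
    dyadicCost s (maximalCells (U ∪ V)) + dyadicContent s (E ∩ E') ≤
      dyadicCost s U + dyadicCost s V := by
  set R : Set (ℕ × ℤ) := (U ∩ V) ∪ ((U ∪ V) \ maximalCells (U ∪ V)) with hR
  have mem_R_of_lt {x : ℝ} {k k' : ℕ} (hlt : k < k') (hk : dyadicIndex k x ∈ U ∪ V)
      (hk' : dyadicIndex k' x ∈ U ∪ V) : dyadicIndex k' x ∈ R :=
    Or.inr ⟨hk', fun hm => hm.2 _ hk hlt (dyadicCell_dyadicIndex_anti x hlt.le)⟩
  have hcov : DyadicCovers R (E ∩ E') := by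
    rintro x ⟨hx, hx'⟩
    obtain ⟨k, hk⟩ := hU x hx
    obtain ⟨k', hk'⟩ := hV x hx'
    rcases lt_trichotomy k k' with h | rfl | h
    · exact ⟨k', mem_R_of_lt h (Or.inl hk) (Or.inr hk')⟩
    · exact ⟨k, Or.inl ⟨hk, hk'⟩⟩
    · exact ⟨k, mem_R_of_lt h (Or.inr hk') (Or.inl hk)⟩
  refine (add_le_add_right (dyadicContent_le hcov) _).trans ?_
  simp only [dyadicCost_eq_tsum_indicator, ← ENNReal.tsum_add]
  refine ENNReal.tsum_le_tsum fun p => ?_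
  have hsub : p ∈ maximalCells (U ∪ V) → p ∈ U ∪ V := fun h => h.1
  by_cases h1 : p ∈ U <;> by_cases h2 : p ∈ V <;> by_cases h3 : p ∈ maximalCells (U ∪ V) <;>
    simp_all

theorem dyadicCost_setOf_eventually_le {W : ℕ → Set (ℕ × ℤ)} {c : ℝ≥0∞}
    (h : ∀ n, dyadicCost s (W n) ≤ c) : dyadicCost s {p | ∀ᶠ n in atTop, p ∈ W n} ≤ c := by
  simp only [dyadicCost_eq_tsum_indicator] at h ⊢
  rw [ENNReal.tsum_eq_iSup_sum]
  refine iSup_le fun F => ?_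
  have hev : ∀ᶠ n in atTop, ∀ p ∈ F, p ∈ {p | ∀ᶠ n in atTop, p ∈ W n} → p ∈ W n := by
    refine (Finset.eventually_all F).2 fun p _ => ?_
    by_cases hp : ∀ᶠ n in atTop, p ∈ W n
    · exact hp.mono fun n hn _ => hn
    · exact Eventually.of_forall fun n hn => absurd hn hp
  obtain ⟨n, hn⟩ := hev.exists
  calc _ ≤ ∑ p ∈ F, (W n).indicator (fun p => ((2 : ℝ≥0∞)⁻¹ ^ p.1) ^ s) p :=
        Finset.sum_le_sum fun p hp => Set.indicator_apply_le'
          (fun hpL => (Set.indicator_of_mem (hn p hp hpL) _).ge) fun _ => zero_le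
    _ ≤ _ := ENNReal.sum_le_tsum F
    _ ≤ c := h n

/-- Given covers `V n`, the covers obtained by adding `V (n + 1)` to the current cover and keeping
the maximal members. -/
def mergedCover (V : ℕ → Set (ℕ × ℤ)) : ℕ → Set (ℕ × ℤ)
  | 0 => V 0
  | n + 1 => maximalCells (mergedCover V n ∪ V (n + 1))

section MergedCover

variable {V : ℕ → Set (ℕ × ℤ)} {E : ℕ → Set ℝ}

theorem dyadicCovers_mergedCover (hV : ∀ n, DyadicCovers (V n) (E n)) :
    ∀ n, DyadicCovers (mergedCover V n) (E n)
  | 0 => hV 0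
  | n + 1 => DyadicCovers.maximalCells fun x hx => (hV (n + 1) x hx).imp fun _ => Or.inr

theorem dyadicCost_mergedCover_le (hE : Monotone E) (hfin : ∀ n, dyadicContent s (E n) ≠ ∞)
    (hV : ∀ n, DyadicCovers (V n) (E n)) {δ : ℕ → ℝ≥0∞}
    (hδ : ∀ n, dyadicCost s (V n) ≤ dyadicContent s (E n) + δ n) (n : ℕ) :
    dyadicCost s (mergedCover V n) ≤
      dyadicContent s (E n) + ∑ i ∈ Finset.range (n + 1), δ i := by
  induction n with
  | zero => simpa [mergedCover] using hδ 0
  | succ n ih =>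
    have hmax := dyadicCost_maximalCells_add_le s (dyadicCovers_mergedCover hV n) (hV (n + 1))
    rw [Set.inter_eq_left.2 (hE n.le_succ)] at hmax
    refine (ENNReal.add_le_add_iff_right (hfin n)).1 ?_
    calc dyadicCost s (mergedCover V (n + 1)) + dyadicContent s (E n)
        ≤ dyadicCost s (mergedCover V n) + dyadicCost s (V (n + 1)) := hmax
      _ ≤ _ := add_le_add ih (hδ (n + 1))
      _ = _ := by rw [Finset.sum_range_succ _ (n + 1)]; ring

/-- The shortest level at which the interval around `x` ever enters the merged covers is kept from
then on, since a member is only discarded in favour of a longer one. -/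
theorem dyadicCovers_eventually_mergedCover (hV : ∀ n, DyadicCovers (V n) (E n)) :
    DyadicCovers {p | ∀ᶠ n in atTop, p ∈ mergedCover V n} (⋃ n, E n) := by
  classical
  intro x hx
  obtain ⟨m, hm⟩ := Set.mem_iUnion.1 hx
  have hex : ∃ k, ∃ n ≥ m, dyadicIndex k x ∈ mergedCover V n :=
    (dyadicCovers_mergedCover hV m x hm).imp fun k hk => ⟨m, le_rfl, hk⟩
  obtain ⟨n, hn, hmem⟩ := Nat.find_spec hex
  refine ⟨Nat.find hex, eventually_atTop.2 ⟨n, Nat.le_induction hmem fun r hr ih => ?_⟩⟩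
  obtain ⟨l, hl, hlm⟩ := exists_dyadicIndex_mem_maximalCells (W := mergedCover V r ∪ V (r + 1))
    (Or.inl ih)
  rwa [← hl.antisymm (Nat.find_min' hex ⟨r + 1, (hn.trans hr).trans r.le_succ, hlm⟩)]

theorem dyadicContent_iUnion_le {c : ℝ≥0∞} (hE : Monotone E)
    (h : ∀ n, dyadicContent s (E n) ≤ c) : dyadicContent s (⋃ n, E n) ≤ c := by
  refine ENNReal.le_of_forall_pos_le_add fun ε hε hc => ?_
  have hfin n : dyadicContent s (E n) ≠ ∞ := ((h n).trans_lt hc).ne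
  obtain ⟨δ, hδ0, hδ⟩ := ENNReal.exists_pos_sum_of_countable (ENNReal.coe_ne_zero.2 hε.ne') ℕ
  choose V hV hVc using fun n => exists_dyadicCost_lt
    (ENNReal.lt_add_right (hfin n) (ENNReal.coe_ne_zero.2 (hδ0 n).ne'))
  have hcost n : dyadicCost s (mergedCover V n) ≤ c + ε :=
    (dyadicCost_mergedCover_le hE hfin hV (fun n => (hVc n).le) n).trans
      (add_le_add (h n) ((ENNReal.sum_le_tsum _).trans hδ.le))
  exact (dyadicContent_le (dyadicCovers_eventually_mergedCover hV)).trans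
    (dyadicCost_setOf_eventually_le hcost)

end MergedCover

end DyadicContent

section Capacitability

/-- The points of `ℕ → ℕ` whose first `k` coordinates are bounded by those of `n`. -/
def baireBox (n : ℕ → ℕ) (k : ℕ) : Set (ℕ → ℕ) := {x | ∀ i < k, x i ≤ n i}

theorem baireBox_succ (n : ℕ → ℕ) (k : ℕ) :
    baireBox n (k + 1) = baireBox n k ∩ {x | x k ≤ n k} := by
  ext x
  simp [baireBox, Nat.le_iff_lt_or_eq, or_imp, forall_and]

theorem exists_forall_lt_baireBox {c : Set (ℕ → ℕ) → ℝ≥0∞} {t : ℝ≥0∞}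
    (hc : ∀ (D : Set (ℕ → ℕ)) (k : ℕ), t < c D → ∃ N, t < c (D ∩ {x | x k ≤ N}))
    (ht : t < c Set.univ) : ∃ n : ℕ → ℕ, ∀ k, t < c (baireBox n k) := by
  choose! g hg using hc
  let D : ℕ → Set (ℕ → ℕ) := fun k => Nat.rec Set.univ (fun k D => D ∩ {x | x k ≤ g D k}) k
  have hDs k : D (k + 1) = D k ∩ {x | x k ≤ g (D k) k} := rfl
  have hD k : D k = baireBox (fun i => g (D i) i) k := by
    induction k with
    | zero => simp [D, baireBox]
    | succ k ih => rw [hDs, baireBox_succ, ← ih]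
  refine ⟨fun i => g (D i) i, fun k => hD k ▸ ?_⟩
  induction k with
  | zero => exact ht
  | succ k ih => exact hg _ _ ih

theorem isCompact_Iic_nat_fun (n : ℕ → ℕ) : IsCompact (Set.Iic n) := by
  rw [← Set.pi_univ_Iic]
  exact isCompact_univ_pi fun i => (Set.finite_Iic (n i)).isCompact

theorem exists_baireBox_subset {n : ℕ → ℕ} {V : Set (ℕ → ℕ)} (hV : IsOpen V)
    (hnV : Set.Iic n ⊆ V) : ∃ k, baireBox n k ⊆ V := by
  have hcyl (x) (hx : x ∈ Set.Iic n) : ∃ m, PiNat.cylinder x m ⊆ V := by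
    obtain ⟨_, ⟨y, m, rfl⟩, hxy, hyV⟩ :=
      (PiNat.isTopologicalBasis_cylinders fun _ => ℕ).exists_subset_of_mem_open (hnV hx) hV
    exact ⟨m, by rwa [PiNat.mem_cylinder_iff_eq.1 hxy]⟩
  choose! m hm using hcyl
  obtain ⟨T, hTn, hT⟩ := (isCompact_Iic_nat_fun n).elim_nhds_subcover
    (fun x => PiNat.cylinder x (m x)) fun x _ =>
      (PiNat.isOpen_cylinder _ x (m x)).mem_nhds (PiNat.self_mem_cylinder x _)
  refine ⟨T.sup m, fun y hy => ?_⟩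
  have hyn : y ⊓ n ∈ Set.Iic n := Set.mem_Iic.2 inf_le_right
  obtain ⟨x, hxT, hx⟩ := Set.mem_iUnion₂.1 (hT hyn)
  refine hm x (hTn x hxT) fun i hi => ?_
  rw [← hx i hi, Pi.inf_apply, inf_eq_left.2 (hy i (hi.trans_le (Finset.le_sup hxT)))]

/-- A form of Choquet's capacitability theorem. -/
theorem exists_isCompact_subset_forall_isOpen_lt {X : Type*} [TopologicalSpace X]
    {c : Set X → ℝ≥0∞} (hmono : Monotone c)
    (hcont : ∀ (E : ℕ → Set X) (t : ℝ≥0∞), Monotone E → (∀ n, c (E n) ≤ t) → c (⋃ n, E n) ≤ t)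
    {A : Set X} (hA : AnalyticSet A) {t : ℝ≥0∞} (ht : t < c A) :
    ∃ K ⊆ A, IsCompact K ∧ ∀ U, IsOpen U → K ⊆ U → t < c U := by
  rw [AnalyticSet] at hA
  obtain rfl | ⟨f, hf, rfl⟩ := hA
  · exact ⟨∅, le_rfl, isCompact_empty, fun U _ hU => ht.trans_le (hmono hU)⟩
  obtain ⟨n, hn⟩ : ∃ n : ℕ → ℕ, ∀ k, t < c (f '' baireBox n k) := by
    refine exists_forall_lt_baireBox (c := fun D => c (f '' D)) (fun D k hD => ?_)
      (by rwa [Set.image_univ])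
    contrapose! hD
    refine le_trans (hmono ?_) (hcont (fun N => f '' (D ∩ {x | x k ≤ N})) t ?_ hD)
    · rintro _ ⟨x, hx, rfl⟩
      exact Set.mem_iUnion.2 ⟨x k, x, ⟨hx, by simp⟩, rfl⟩
    · exact fun N N' hN => Set.image_mono
        (Set.inter_subset_inter_right _ fun x hx => le_trans hx hN)
  refine ⟨f '' Set.Iic n, Set.image_subset_range f _, (isCompact_Iic_nat_fun n).image hf,
    fun U hU hKU => ?_⟩
  obtain ⟨k, hk⟩ := exists_baireBox_subset (hU.preimage hf) (Set.image_subset_iff.1 hKU)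
  exact (hn k).trans_le (hmono (Set.image_subset_iff.2 hk))

end Capacitability

section DyadicContentEstimates

variable {s : ℝ} {W : Set (ℕ × ℤ)} {E : Set ℝ}

/-- The smallest open interval symmetric about the left end of a dyadic interval that contains it
is covered by the interval and its left neighbour. -/
theorem exists_isOpen_dyadicContent_le (s : ℝ) (hW : DyadicCovers W E) :
    ∃ U, IsOpen U ∧ E ⊆ U ∧ dyadicContent s U ≤ 2 * dyadicCost s W := by
  refine ⟨⋃ p ∈ W, {x : ℝ | |(2 : ℝ) ^ p.1 * x - p.2| < 1},
    isOpen_biUnion fun p _ => isOpen_lt (by fun_prop) continuous_const, fun x hx => ?_, ?_⟩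
  · obtain ⟨k, hk⟩ := hW x hx
    refine Set.mem_biUnion hk ?_
    simp only [dyadicIndex, Set.mem_ofPred_eq, Int.self_sub_floor, Int.abs_fract]
    exact Int.fract_lt_one _
  let e : ℕ × ℤ ≃ ℕ × ℤ := Equiv.prodCongr (Equiv.refl ℕ) (Equiv.addRight 1)
  have hcost : dyadicCost s (e ⁻¹' W) = dyadicCost s W :=
    (e.subtypeEquiv fun _ => Iff.rfl).tsum_eq fun p : W => ((2 : ℝ≥0∞)⁻¹ ^ p.1.1) ^ s
  have hcov : DyadicCovers (W ∪ e ⁻¹' W) (⋃ p ∈ W, {x : ℝ | |(2 : ℝ) ^ p.1 * x - p.2| < 1}) := by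
    intro x hx
    obtain ⟨⟨k, j⟩, hp, hx⟩ := Set.mem_iUnion₂.1 hx
    obtain ⟨hx1, hx2⟩ := abs_lt.1 (Set.mem_ofPred.1 hx)
    refine ⟨k, ?_⟩
    rcases lt_or_ge ((2 : ℝ) ^ k * x) j with h | h
    · have : ⌊(2 : ℝ) ^ k * x⌋ = j - 1 := by
        rw [Int.floor_eq_iff]; push_cast; constructor <;> linarith
      exact Or.inr (by simpa [e, dyadicIndex, this] using hp)
    · have : ⌊(2 : ℝ) ^ k * x⌋ = j := by
        rw [Int.floor_eq_iff]; constructor <;> linarith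
      exact Or.inl (by simpa [dyadicIndex, this] using hp)
  calc _ ≤ dyadicCost s (W ∪ e ⁻¹' W) := dyadicContent_le hcov
    _ ≤ dyadicCost s W + dyadicCost s (e ⁻¹' W) := dyadicCost_union_le s _ _
    _ = 2 * dyadicCost s W := by rw [hcost, two_mul]

theorem exists_isCompact_dyadicContent_ne_zero {A : Set ℝ} (hA : MeasurableSet A)
    (h : dyadicContent s A ≠ 0) : ∃ K ⊆ A, IsCompact K ∧ dyadicContent s K ≠ 0 := by
  obtain ⟨c, hc0, hc⟩ := exists_between (pos_iff_ne_zero.2 h)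
  obtain ⟨K, hKA, hK, hKU⟩ := exists_isCompact_subset_forall_isOpen_lt (dyadicContent_mono s)
    (fun _ _ => dyadicContent_iUnion_le) hA.analyticSet hc
  refine ⟨K, hKA, hK, fun hK0 => ?_⟩
  obtain ⟨W, hW, hWc⟩ := exists_dyadicCost_lt
    (hK0.trans_lt (ENNReal.half_pos hc0.ne'))
  obtain ⟨U, hUo, hKU', hUc⟩ := exists_isOpen_dyadicContent_le s hW
  refine (hKU U hUo hKU').not_ge (hUc.trans ?_)
  calc 2 * dyadicCost s W ≤ 2 * (c / 2) := by gcongr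
    _ = c := ENNReal.mul_div_cancel two_ne_zero ENNReal.ofNat_ne_top

theorem ofReal_two_inv_pow (k : ℕ) : ENNReal.ofReal (2⁻¹ ^ k) = 2⁻¹ ^ k := by
  rw [ENNReal.ofReal_pow (by norm_num), ENNReal.ofReal_inv_of_pos two_pos, ENNReal.ofReal_ofNat]

theorem dyadicContent_Ioc_le (hs : 0 ≤ s) {x y : ℝ} (hxy : x < y) (h1 : y - x ≤ 1) :
    dyadicContent s (Set.Ioc x y) ≤ 2 * ENNReal.ofReal (2 * (y - x)) ^ s := by
  classical
  obtain ⟨k, hk, hk'⟩ := exists_nat_pow_near_of_lt_one (sub_pos.2 hxy) h1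
    (by norm_num : (0 : ℝ) < 2⁻¹) (by norm_num)
  have hlen : (2 : ℝ) ^ k * (y - x) ≤ 1 := by
    calc (2 : ℝ) ^ k * (y - x) ≤ 2 ^ k * 2⁻¹ ^ k := by gcongr
      _ = 1 := by rw [← mul_pow]; norm_num
  let F : Finset (ℕ × ℤ) := {(k, ⌊(2 : ℝ) ^ k * x⌋), (k, ⌊(2 : ℝ) ^ k * x⌋ + 1)}
  have hcov : DyadicCovers F (Set.Ioc x y) := by
    rintro z ⟨hxz, hzy⟩
    have hz : (2 : ℝ) ^ k * z ≤ 2 ^ k * y := by gcongr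
    have hlow : ⌊(2 : ℝ) ^ k * x⌋ ≤ ⌊(2 : ℝ) ^ k * z⌋ := Int.floor_mono (by gcongr)
    have hupp : ⌊(2 : ℝ) ^ k * z⌋ ≤ ⌊(2 : ℝ) ^ k * x⌋ + 1 := by
      rw [← Int.floor_add_one]
      exact Int.floor_mono (by linarith)
    have : ⌊(2 : ℝ) ^ k * z⌋ = ⌊(2 : ℝ) ^ k * x⌋ ∨ ⌊(2 : ℝ) ^ k * z⌋ = ⌊(2 : ℝ) ^ k * x⌋ + 1 := by
      omega
    exact ⟨k, by simpa [F, dyadicIndex] using this⟩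
  have hside : (2 : ℝ≥0∞)⁻¹ ^ k ≤ ENNReal.ofReal (2 * (y - x)) := by
    rw [← ofReal_two_inv_pow]
    rw [pow_succ] at hk
    exact ENNReal.ofReal_le_ofReal (by linarith)
  calc dyadicContent s (Set.Ioc x y) ≤ dyadicCost s F := dyadicContent_le hcov
    _ = 2 * ((2 : ℝ≥0∞)⁻¹ ^ k) ^ s := by
      rw [dyadicCost_finset, Finset.sum_pair (by simp), two_mul]
    _ ≤ _ := by gcongr

theorem dyadicContent_lt_top (hs : 0 ≤ s) (hE : Bornology.IsBounded E) :
    dyadicContent s E < ∞ := by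
  classical
  obtain ⟨⟨a, ha⟩, b, hb⟩ := isBounded_iff_bddBelow_bddAbove.1 hE
  let F : Finset (ℕ × ℤ) := (Finset.Icc ⌊a⌋ ⌊b⌋).image fun j => (0, j)
  have hcov : DyadicCovers F E := fun x hx =>
    ⟨0, by simp [F, dyadicIndex, Int.floor_mono (ha hx), Int.floor_mono (hb hx)]⟩
  refine (dyadicContent_le hcov).trans_lt ?_
  rw [dyadicCost_finset]
  exact ENNReal.sum_lt_top.2 fun p _ => ENNReal.rpow_lt_top_of_nonneg hs
    (ENNReal.pow_ne_top (by simp))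

theorem ediam_dyadicCell_le (p : ℕ × ℤ) : Metric.ediam (dyadicCell p) ≤ 2⁻¹ ^ p.1 := by
  refine Metric.ediam_le fun x hx y hy => ?_
  rw [mem_dyadicCell, Int.floor_eq_iff] at hx hy
  have hpos : (0 : ℝ) < 2 ^ p.1 := by positivity
  rw [edist_dist, Real.dist_eq, ← ofReal_two_inv_pow]
  refine ENNReal.ofReal_le_ofReal ?_
  rw [inv_pow, ← one_div, le_div_iff₀ hpos, ← abs_of_pos hpos, ← abs_mul, sub_mul, abs_le]
  constructor <;> linarith

theorem hausdorffMeasure_eq_zero_of_dyadicContent_eq_zero (hs : 0 < s)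
    (h : dyadicContent s E = 0) : μH[s] E = 0 := by
  let r : ℕ → ℝ≥0∞ := fun n => (n : ℝ≥0∞)⁻¹
  have hr : Tendsto r atTop (𝓝 0) := ENNReal.tendsto_inv_nat_nhds_zero
  have hrs : Tendsto (fun n => r n ^ s) atTop (𝓝 0) := by
    simpa [hs, Function.comp_def] using ((ENNReal.continuous_rpow_const (y := s)).tendsto 0).comp hr
  choose W hW hWc using fun n => exists_dyadicCost_lt (s := s) (E := E) (c := r n ^ s)
    (h ▸ ENNReal.rpow_pos_of_nonneg (by simp [r]) hs.le)
  have hterm n (p : W n) : Metric.ediam (dyadicCell p) ^ s ≤ ((2 : ℝ≥0∞)⁻¹ ^ p.1.1) ^ s := by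
    gcongr
    exact ediam_dyadicCell_le p
  have hle := Measure.hausdorffMeasure_le_liminf_tsum s E (l := atTop) (ι := fun n => W n)
    r hr (fun n p => dyadicCell p) ?_ ?_
  · refine le_antisymm (hle.trans ?_) (zero_le)
    rw [← hrs.liminf_eq]
    exact liminf_le_liminf (Eventually.of_forall fun n =>
      (ENNReal.tsum_le_tsum (hterm n)).trans (hWc n).le)
  · exact Eventually.of_forall fun n p => (ENNReal.rpow_le_rpow_iff hs).1
      ((hterm n p).trans ((ENNReal.le_tsum p).trans (hWc n).le))
  · refine Eventually.of_forall fun n x hx => ?_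
    obtain ⟨k, hk⟩ := hW n x hx
    exact Set.mem_iUnion.2 ⟨⟨_, hk⟩, mem_dyadicCell_dyadicIndex k x⟩

end DyadicContentEstimates

section Frostman

variable {s : ℝ} {E K : Set ℝ}

theorem dyadicContent_empty (s : ℝ) : dyadicContent s ∅ = 0 :=
  le_antisymm ((dyadicContent_le (W := ∅) fun _ hx => hx.elim).trans (by simp [dyadicCost]))
    (zero_le)

/-- The distribution function of the Frostman measure of a bounded set `E`: the dyadic content
of the part of `E` to the left of a point. -/
noncomputable def contentCDF (s : ℝ) (E : Set ℝ) (x : ℝ) : ℝ :=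
  (dyadicContent s (E ∩ Set.Iic x)).toReal

theorem dyadicContent_inter_ne_top (hs : 0 ≤ s) (hE : Bornology.IsBounded E) (U : Set ℝ) :
    dyadicContent s (E ∩ U) ≠ ∞ :=
  (dyadicContent_lt_top hs (hE.subset Set.inter_subset_left)).ne

theorem monotone_contentCDF (hs : 0 ≤ s) (hE : Bornology.IsBounded E) :
    Monotone (contentCDF s E) := fun _ _ hxy =>
  ENNReal.toReal_mono (dyadicContent_inter_ne_top hs hE _)
    (dyadicContent_mono s (Set.inter_subset_inter_right _ (Set.Iic_subset_Iic.2 hxy)))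

theorem ofReal_contentCDF_sub_le (hs : 0 ≤ s) (hE : Bornology.IsBounded E) {x y : ℝ}
    (hxy : x ≤ y) :
    ENNReal.ofReal (contentCDF s E y - contentCDF s E x) ≤ dyadicContent s (E ∩ Set.Ioc x y) := by
  rw [contentCDF, contentCDF, ENNReal.ofReal_sub _ ENNReal.toReal_nonneg,
    ENNReal.ofReal_toReal (dyadicContent_inter_ne_top hs hE _),
    ENNReal.ofReal_toReal (dyadicContent_inter_ne_top hs hE _), tsub_le_iff_left,
    ← Set.Iic_union_Ioc_eq_Iic hxy, Set.inter_union_distrib_left]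
  exact dyadicContent_union_le s _ _

theorem contentCDF_sub_le (hs : 0 ≤ s) (hE : Bornology.IsBounded E) {x y : ℝ} (hxy : x < y)
    (h1 : y - x ≤ 1) : contentCDF s E y - contentCDF s E x ≤ 2 * (2 * (y - x)) ^ s := by
  have h0 : 0 ≤ 2 * (y - x) := by linarith
  rw [← ENNReal.ofReal_le_ofReal_iff (by positivity), ENNReal.ofReal_mul two_pos.le,
    ← ENNReal.ofReal_rpow_of_nonneg h0 hs, ENNReal.ofReal_ofNat]
  exact (ofReal_contentCDF_sub_le hs hE hxy.le).trans
    ((dyadicContent_mono s Set.inter_subset_right).trans (dyadicContent_Ioc_le hs hxy h1))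

theorem continuousWithinAt_contentCDF (hs : 0 < s) (hE : Bornology.IsBounded E) (x : ℝ) :
    ContinuousWithinAt (contentCDF s E) (Set.Ici x) x := by
  rw [← continuousWithinAt_Ioi_iff_Ici]
  have hupper : ContinuousAt (fun y => contentCDF s E x + 2 * (2 * (y - x)) ^ s) x :=
    continuousAt_const.add (continuousAt_const.mul
      (ContinuousAt.rpow_const (by fun_prop) (Or.inr hs.le)))
  have hlim := hupper.tendsto.mono_left (nhdsWithin_le_nhds (s := Set.Ioi x))
  simp only [sub_self, mul_zero, Real.zero_rpow hs.ne', add_zero] at hlim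
  refine tendsto_of_tendsto_of_tendsto_of_le_of_le' tendsto_const_nhds hlim ?_ ?_
  · filter_upwards [self_mem_nhdsWithin] with y hy
      using monotone_contentCDF hs.le hE (Set.mem_Ioi.1 hy).le
  · filter_upwards [Ioo_mem_nhdsGT (lt_add_one x)] with y hy
    linarith [contentCDF_sub_le hs.le hE hy.1 (by linarith [hy.2])]

/-- The Frostman measure of a bounded set `E`, which is carried by the closure of `E`. -/
noncomputable def contentMeasure (hs : 0 < s) (hE : Bornology.IsBounded E) : Measure ℝ :=
  StieltjesFunction.measure
    ⟨contentCDF s E, monotone_contentCDF hs.le hE, continuousWithinAt_contentCDF hs hE⟩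

theorem contentMeasure_Ioc (hs : 0 < s) (hE : Bornology.IsBounded E) (x y : ℝ) :
    contentMeasure hs hE (Set.Ioc x y) = ENNReal.ofReal (contentCDF s E y - contentCDF s E x) :=
  StieltjesFunction.measure_Ioc _ x y

theorem contentMeasure_compl (hs : 0 < s) (hE : Bornology.IsBounded E) (hEc : IsClosed E) :
    contentMeasure hs hE Eᶜ = 0 := by
  refine measure_null_of_locally_null _ fun x hx => ?_
  obtain ⟨l, u, hxlu, hlu⟩ := mem_nhds_iff_exists_Ioo_subset.1 (hEc.isOpen_compl.mem_nhds hx)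
  obtain ⟨v, hxv, hvu⟩ := exists_between hxlu.2
  refine ⟨Set.Ioc l v, mem_nhdsWithin_of_mem_nhds (Ioc_mem_nhds hxlu.1 hxv), ?_⟩
  have hempty : E ∩ Set.Ioc l v = ∅ := Set.disjoint_iff_inter_eq_empty.1
    (Set.subset_compl_iff_disjoint_left.1 ((Set.Ioc_subset_Ioo_right hvu).trans hlu))
  rw [contentMeasure_Ioc, ← nonpos_iff_eq_zero, ← dyadicContent_empty s, ← hempty]
  exact ofReal_contentCDF_sub_le hs.le hE (hxlu.1.trans hxv).le

theorem contentMeasure_univ (hs : 0 < s) (hE : Bornology.IsBounded E) (hEc : IsClosed E) :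
    contentMeasure hs hE Set.univ = dyadicContent s E := by
  obtain ⟨R, hR⟩ := hE.subset_ball 0
  rw [Real.ball_eq_Ioo] at hR
  have hIoc : E ⊆ Set.Ioc (0 - R) (0 + R) := hR.trans Set.Ioo_subset_Ioc_self
  have hleft : E ∩ Set.Iic (0 - R) = ∅ :=
    Set.eq_empty_iff_forall_notMem.2 fun y hy => (hIoc hy.1).1.not_ge hy.2
  have hright : E ∩ Set.Iic (0 + R) = E := Set.inter_eq_left.2 fun x hx => (hIoc hx).2
  rw [← measure_congr (s := Set.Ioc (0 - R) (0 + R)) (ae_eq_univ.2 (measure_mono_null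
    (Set.compl_subset_compl.2 hIoc) (contentMeasure_compl hs hE hEc))), contentMeasure_Ioc,
    contentCDF, contentCDF, hleft, hright, dyadicContent_empty, ENNReal.toReal_zero, sub_zero,
    ENNReal.ofReal_toReal (dyadicContent_lt_top hs.le hE).ne]

theorem contentMeasure_closedBall_le (hs : 0 < s) (hE : Bornology.IsBounded E) {r : ℝ}
    (hr : 0 < r) (h1 : 3 * r ≤ 1) (x : ℝ) :
    contentMeasure hs hE (Metric.closedBall x r) ≤ 2 * 6 ^ s * ENNReal.ofReal r ^ s := by
  have hball : Metric.closedBall x r ⊆ Set.Ioc (x - 2 * r) (x + r) := by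
    rw [Real.closedBall_eq_Icc]
    exact fun y hy => ⟨by linarith [hy.1], hy.2⟩
  calc contentMeasure hs hE (Metric.closedBall x r)
      ≤ ENNReal.ofReal (contentCDF s E (x + r) - contentCDF s E (x - 2 * r)) :=
        (measure_mono hball).trans_eq (contentMeasure_Ioc hs hE _ _)
    _ ≤ ENNReal.ofReal (2 * 6 ^ s * r ^ s) := by
        refine ENNReal.ofReal_le_ofReal ((contentCDF_sub_le hs.le hE (by linarith)
          (by linarith)).trans_eq ?_)
        rw [mul_assoc, ← Real.mul_rpow (by norm_num) hr.le]
        ring_nf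
    _ = 2 * 6 ^ s * ENNReal.ofReal r ^ s := by
        rw [ENNReal.ofReal_mul (by positivity), ENNReal.ofReal_mul two_pos.le,
          ← ENNReal.ofReal_rpow_of_pos hr, ← ENNReal.ofReal_rpow_of_pos (by norm_num),
          ENNReal.ofReal_ofNat, ENNReal.ofReal_ofNat]

theorem exists_forall_measure_closedBall_le {X : Type*} [PseudoMetricSpace X] [MeasurableSpace X]
    {μ : Measure X} [IsFiniteMeasure μ] {c : ℝ≥0} {r₀ : ℝ} (hs : 0 ≤ s) (hr₀ : 0 < r₀)
    (h : ∀ x r, 0 < r → r ≤ r₀ → μ (Metric.closedBall x r) ≤ c * ENNReal.ofReal r ^ s) :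
    ∃ C : ℝ≥0, ∀ x r, 0 < r → μ (Metric.closedBall x r) ≤ C * ENNReal.ofReal r ^ s := by
  have hpos : ENNReal.ofReal r₀ ^ s ≠ 0 :=
    (ENNReal.rpow_pos (ENNReal.ofReal_pos.2 hr₀) ENNReal.ofReal_ne_top).ne'
  have hfin : ENNReal.ofReal r₀ ^ s ≠ ∞ := ENNReal.rpow_ne_top_of_nonneg hs ENNReal.ofReal_ne_top
  lift μ Set.univ / ENNReal.ofReal r₀ ^ s to ℝ≥0
    using ENNReal.div_ne_top (measure_ne_top μ _) hpos with d hd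
  refine ⟨c + d, fun x r hr => ?_⟩
  rw [ENNReal.coe_add, add_mul]
  rcases le_total r r₀ with hrr | hrr
  · exact (h x r hr hrr).trans le_self_add
  · calc μ (Metric.closedBall x r) ≤ d * ENNReal.ofReal r₀ ^ s := by
          rw [hd, ENNReal.div_mul_cancel hpos hfin]
          exact measure_mono (Set.subset_univ _)
      _ ≤ d * ENNReal.ofReal r ^ s := by gcongr
      _ ≤ _ := le_add_self

theorem exists_frostman_measure_of_isCompact (hs : 0 < s) (hK : IsCompact K)
    (h : dyadicContent s K ≠ 0) :
    ∃ μ : Measure ℝ, IsFiniteMeasure μ ∧ μ ≠ 0 ∧ μ Kᶜ = 0 ∧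
      ∃ C : ℝ≥0, ∀ x r : ℝ, 0 < r → μ (Metric.closedBall x r) ≤ C * ENNReal.ofReal r ^ s := by
  have huniv := contentMeasure_univ hs hK.isBounded hK.isClosed
  have hfin : IsFiniteMeasure (contentMeasure hs hK.isBounded) :=
    ⟨huniv ▸ dyadicContent_lt_top hs.le hK.isBounded⟩
  refine ⟨_, hfin, fun h0 => h ?_, contentMeasure_compl hs hK.isBounded hK.isClosed,
    exists_forall_measure_closedBall_le (c := 2 * 6 ^ s) (r₀ := 3⁻¹) hs.le (by norm_num)
      fun x r hr hr1 => ?_⟩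
  · rw [← huniv, h0, Measure.coe_zero, Pi.zero_apply]
  · simpa [ENNReal.coe_rpow_of_nonneg _ hs.le] using
      contentMeasure_closedBall_le hs hK.isBounded hr (by linarith) x

theorem exists_frostman_measure {s : ℝ≥0} {A : Set ℝ} (hs : 0 < s) (hA : MeasurableSet A)
    (h : s < dimH A) :
    ∃ μ : Measure ℝ, IsFiniteMeasure μ ∧ μ ≠ 0 ∧ μ Aᶜ = 0 ∧
      ∃ C : ℝ≥0, ∀ x r : ℝ, 0 < r →
        μ (Metric.closedBall x r) ≤ C * ENNReal.ofReal r ^ (s : ℝ) := by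
  have hs' : (0 : ℝ) < s := hs
  have hcontent : dyadicContent s A ≠ 0 := fun h0 => ENNReal.top_ne_zero
    ((hausdorffMeasure_of_lt_dimH h).symm.trans
      (hausdorffMeasure_eq_zero_of_dyadicContent_eq_zero hs' h0))
  obtain ⟨K, hKA, hK, hK0⟩ := exists_isCompact_dyadicContent_ne_zero hA hcontent
  obtain ⟨μ, hfin, h0, hKc, C, hC⟩ := exists_frostman_measure_of_isCompact hs' hK hK0
  exact ⟨μ, hfin, h0, measure_mono_null (Set.compl_subset_compl.2 hKA) hKc, C, hC⟩

end Frostman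

/-! ### Dimension of graphs of Hölder functions -/

section HolderGraph

/-- Hölder continuity of exponent `β` on bounded sets. -/
def LocallyHolder {E : Type*} [SeminormedAddCommGroup E] (β : ℝ) (f : ℝ → E) : Prop :=
  ∀ N : ℕ, ∃ C : ℝ, 0 ≤ C ∧ ∀ x ∈ Set.Icc (-N : ℝ) N, ∀ y ∈ Set.Icc (-N : ℝ) N,
    ‖f x - f y‖ ≤ C * |x - y| ^ β

variable {f : ℝ → ℂ} {A B : Set ℝ} {β C d : ℝ}

theorem dist_graph_le (f : ℝ → ℂ) (x y : ℝ) :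
    dist (!₂[x, (f x).re, (f x).im] : EuclideanSpace ℝ (Fin 3)) !₂[y, (f y).re, (f y).im] ≤
      |x - y| + |(f x - f y).re| + |(f x - f y).im| := by
  rw [EuclideanSpace.dist_eq, Fin.sum_univ_three]
  refine Real.sqrt_le_iff.2 ⟨by positivity, ?_⟩
  simp only [Real.dist_eq, sq_abs, Matrix.cons_val_zero, Matrix.cons_val_one, Matrix.cons_val,
    ← Complex.sub_re, ← Complex.sub_im]
  rw [← sq_abs (x - y), ← sq_abs (f x - f y).re, ← sq_abs (f x - f y).im]
  have (a b c : ℝ) (ha : 0 ≤ a) (hb : 0 ≤ b) (hc : 0 ≤ c) :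
      a ^ 2 + b ^ 2 + c ^ 2 ≤ (a + b + c) ^ 2 := by
    nlinarith [mul_nonneg ha hb, mul_nonneg ha hc, mul_nonneg hb hc]
  exact this _ _ _ (abs_nonneg _) (abs_nonneg _) (abs_nonneg _)

theorem dimH_graphOver_le_div {β : ℝ≥0} (hβ : 0 < β) (hβ1 : β ≤ 1)
    (hf : LocallyHolder β f) (A : Set ℝ) : dimH (graphOver f A) ≤ dimH A / β := by
  refine dimH_image_le_of_locally_holder_on hβ fun x _ => ?_
  obtain ⟨N, hN⟩ := exists_nat_ge (|x| + 1)
  obtain ⟨C, hC0, hC⟩ := hf N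
  have hx := abs_le.1 (le_refl |x|)
  refine ⟨(1 + 2 * C).toNNReal, Set.Icc (x - 1 / 2) (x + 1 / 2),
    mem_nhdsWithin_of_mem_nhds (Icc_mem_nhds (by linarith) (by linarith)), fun y hy z hz => ?_⟩
  have hnorm : ‖f y - f z‖ ≤ C * |y - z| ^ (β : ℝ) :=
    hC y ⟨by linarith [hy.1], by linarith [hy.2]⟩ z ⟨by linarith [hz.1], by linarith [hz.2]⟩
  have hyz : |y - z| ≤ 1 :=
    abs_le.2 ⟨by linarith [hy.1, hz.2], by linarith [hy.2, hz.1]⟩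
  have habs : |y - z| ≤ |y - z| ^ (β : ℝ) :=
    Real.self_le_rpow_of_le_one (abs_nonneg _) hyz (by exact_mod_cast hβ1)
  rw [edist_dist, edist_dist, Real.dist_eq,
    ENNReal.ofReal_rpow_of_nonneg (abs_nonneg _) β.coe_nonneg, ← ENNReal.ofReal,
    ← ENNReal.ofReal_mul (by positivity)]
  refine ENNReal.ofReal_le_ofReal ((dist_graph_le f y z).trans ?_)
  linarith [Complex.abs_re_le_norm (f y - f z), Complex.abs_im_le_norm (f y - f z)]

/-- The part of the graph of `f` over `B` whose values lie in the square with index `p` of the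
grid of mesh `diam B`. -/
def graphPiece (f : ℝ → ℂ) (B : Set ℝ) (p : ℤ × ℤ) : Set (EuclideanSpace ℝ (Fin 3)) :=
  graphOver f
    {x | x ∈ B ∧ ⌊(f x).re / Metric.diam B⌋ = p.1 ∧ ⌊(f x).im / Metric.diam B⌋ = p.2}

theorem abs_sub_le_of_floor_div_eq {u v r : ℝ} (hr : 0 < r) (h : ⌊u / r⌋ = ⌊v / r⌋) :
    |u - v| ≤ r := by
  have := Int.abs_sub_lt_one_of_floor_eq_floor h
  rw [← sub_div, abs_div, abs_of_pos hr, div_lt_one hr] at this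
  exact this.le

theorem ediam_graphPiece_le (hB : Bornology.IsBounded B) (p : ℤ × ℤ) :
    Metric.ediam (graphPiece f B p) ≤ 3 * Metric.ediam B := by
  refine Metric.ediam_le ?_
  rintro _ ⟨x, ⟨hx, hxre, hxim⟩, rfl⟩ _ ⟨y, ⟨hy, hyre, hyim⟩, rfl⟩
  rcases eq_or_ne x y with rfl | hne
  · simp
  have hxy : |x - y| ≤ Metric.diam B := Metric.dist_le_diam_of_mem hB hx hy
  have hpos : 0 < Metric.diam B := (abs_pos.2 (sub_ne_zero.2 hne)).trans_le hxy
  have hre := abs_sub_le_of_floor_div_eq hpos (hxre.trans hyre.symm)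
  have him := abs_sub_le_of_floor_div_eq hpos (hxim.trans hyim.symm)
  rw [← Complex.sub_re] at hre
  rw [← Complex.sub_im] at him
  rw [edist_dist, ← ENNReal.ofReal_toReal hB.ediam_ne_top, ← Metric.diam, ← ENNReal.ofReal_ofNat 3,
    ← ENNReal.ofReal_mul (by norm_num)]
  exact ENNReal.ofReal_le_ofReal (by linarith [dist_graph_le f x y])

theorem card_Icc_floor_le {a b : ℝ} (h : a ≤ b) :
    ((Finset.Icc ⌊a⌋ ⌊b⌋).card : ℝ) ≤ b - a + 2 := by
  have hcard : ((Finset.Icc ⌊a⌋ ⌊b⌋).card : ℤ) = ⌊b⌋ + 1 - ⌊a⌋ :=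
    Int.card_Icc_of_le _ _ (by linarith [Int.floor_mono h])
  rw [← Int.cast_natCast, hcard]
  push_cast
  linarith [Int.floor_le b, Int.lt_floor_add_one a]

theorem exists_finset_graphPiece_eq_empty {M : ℝ} (hM : 0 ≤ M) (hdiam : 0 < Metric.diam B)
    (hf : ∀ x ∈ B, ∀ y ∈ B, ‖f x - f y‖ ≤ M * Metric.diam B) :
    ∃ S : Finset (ℤ × ℤ), (S.card : ℝ) ≤ (2 * M + 2) ^ 2 ∧ ∀ p ∉ S, graphPiece f B p = ∅ := by
  obtain ⟨x₀, hx₀⟩ : B.Nonempty := by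
    by_contra! h
    simp [h] at hdiam
  let I : ℝ → Finset ℤ := fun u =>
    Finset.Icc ⌊u / Metric.diam B - M⌋ ⌊u / Metric.diam B + M⌋
  have hcard u : ((I u).card : ℝ) ≤ 2 * M + 2 :=
    (card_Icc_floor_le (by linarith)).trans (by linarith)
  have hmem {u v : ℝ} (h : |v - u| ≤ M * Metric.diam B) : ⌊v / Metric.diam B⌋ ∈ I u := by
    have hdiv : |v / Metric.diam B - u / Metric.diam B| ≤ M := by
      rwa [← sub_div, abs_div, abs_of_pos hdiam, div_le_iff₀ hdiam]
    rw [abs_le] at hdiv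
    exact Finset.mem_Icc.2 ⟨Int.floor_mono (by linarith), Int.floor_mono (by linarith)⟩
  refine ⟨I (f x₀).re ×ˢ I (f x₀).im, ?_, fun p hp => ?_⟩
  · rw [Finset.card_product, Nat.cast_mul, sq]
    gcongr <;> exact hcard _
  · rw [graphPiece, graphOver, Set.image_eq_empty, Set.eq_empty_iff_forall_notMem]
    rintro x ⟨hx, hre, him⟩
    have hosc := hf x hx x₀ hx₀
    refine hp (Finset.mem_product.2 ⟨hre ▸ hmem ?_, him ▸ hmem ?_⟩)
    · exact (Complex.abs_re_le_norm (f x - f x₀)).trans hosc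
    · exact (Complex.abs_im_le_norm (f x - f x₀)).trans hosc

theorem sq_mul_rpow_mesh_le {ρ : ℝ} (hβ : β ≤ 1) (hC : 0 ≤ C) (hρ : 0 < ρ) (hρ1 : ρ ≤ 1) :
    (2 * (C * ρ ^ (β - 1)) + 2) ^ 2 * (3 * ρ) ^ (d + (2 - 2 * β)) ≤
      (2 * C + 2) ^ 2 * 3 ^ (d + (2 - 2 * β)) * ρ ^ d := by
  have hone : 1 ≤ ρ ^ (β - 1) :=
    Real.one_le_rpow_of_pos_of_le_one_of_nonpos hρ hρ1 (by linarith)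
  calc _ ≤ ((2 * C + 2) * ρ ^ (β - 1)) ^ 2 * (3 * ρ) ^ (d + (2 - 2 * β)) := by
        gcongr
        linarith
    _ = (2 * C + 2) ^ 2 * 3 ^ (d + (2 - 2 * β)) *
          ((ρ ^ (β - 1)) ^ (2 : ℝ) * ρ ^ (d + (2 - 2 * β))) := by
        rw [Real.mul_rpow (by norm_num) hρ.le, Real.rpow_two]
        ring
    _ = (2 * C + 2) ^ 2 * 3 ^ (d + (2 - 2 * β)) * ρ ^ d := by
        rw [← Real.rpow_mul hρ.le, ← Real.rpow_add hρ]
        ring_nf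

theorem tsum_ediam_graphPiece_le (hβ0 : 0 ≤ β) (hβ1 : β ≤ 1) (hC : 0 ≤ C) (hd : 0 < d)
    (hB : Metric.ediam B ≤ 1) (hf : ∀ x ∈ B, ∀ y ∈ B, ‖f x - f y‖ ≤ C * |x - y| ^ β) :
    ∑' p, Metric.ediam (graphPiece f B p) ^ (d + (2 - 2 * β)) ≤
      ENNReal.ofReal ((2 * C + 2) ^ 2 * 3 ^ (d + (2 - 2 * β))) * Metric.ediam B ^ d := by
  have hbdd : Bornology.IsBounded B :=
    Metric.isBounded_iff_ediam_ne_top.2 (ne_top_of_le_ne_top ENNReal.one_ne_top hB)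
  have he : 0 < d + (2 - 2 * β) := by linarith
  set ρ := Metric.diam B
  have hρ : Metric.ediam B = ENNReal.ofReal ρ := (ENNReal.ofReal_toReal hbdd.ediam_ne_top).symm
  have hρ1 : ρ ≤ 1 := by rwa [hρ, ENNReal.ofReal_le_one] at hB
  have hpiece p : Metric.ediam (graphPiece f B p) ≤ ENNReal.ofReal (3 * ρ) := by
    rw [ENNReal.ofReal_mul (by norm_num), ENNReal.ofReal_ofNat, ← hρ]
    exact ediam_graphPiece_le hbdd p
  rcases (Metric.diam_nonneg : 0 ≤ ρ).eq_or_lt with h0 | hpos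
  · have hzero p : Metric.ediam (graphPiece f B p) = 0 :=
      le_antisymm ((hpiece p).trans (by simp [ρ, ← h0])) (zero_le)
    simp [hzero, he]
  have hosc : ∀ x ∈ B, ∀ y ∈ B, ‖f x - f y‖ ≤ C * ρ ^ (β - 1) * ρ := fun x hx y hy => by
    rw [mul_assoc, ← Real.rpow_add_one hpos.ne', sub_add_cancel]
    refine (hf x hx y hy).trans ?_
    gcongr
    exact Metric.dist_le_diam_of_mem hbdd hx hy
  obtain ⟨S, hcard, hS⟩ := exists_finset_graphPiece_eq_empty (by positivity) hpos hosc
  rw [tsum_eq_sum (s := S) fun p hp => by rw [hS p hp, Metric.ediam_empty,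
    ENNReal.zero_rpow_of_pos he]]
  calc ∑ p ∈ S, Metric.ediam (graphPiece f B p) ^ (d + (2 - 2 * β))
      ≤ ∑ _ ∈ S, ENNReal.ofReal (3 * ρ) ^ (d + (2 - 2 * β)) := by
        gcongr
        exact hpiece _
    _ = ENNReal.ofReal (S.card * (3 * ρ) ^ (d + (2 - 2 * β))) := by
        rw [Finset.sum_const, nsmul_eq_mul, ENNReal.ofReal_rpow_of_nonneg (by positivity) he.le,
          ENNReal.ofReal_mul (by positivity), ENNReal.ofReal_natCast]
    _ ≤ ENNReal.ofReal ((2 * C + 2) ^ 2 * 3 ^ (d + (2 - 2 * β)) * ρ ^ d) :=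
        ENNReal.ofReal_le_ofReal ((mul_le_mul_of_nonneg_right hcard (by positivity)).trans
          (sq_mul_rpow_mesh_le hβ1 hC hpos hρ1))
    _ = _ := by
        rw [ENNReal.ofReal_mul (by positivity), hρ, ENNReal.ofReal_rpow_of_nonneg hpos.le hd.le]

theorem exists_cover_of_hausdorffMeasure_eq_zero {X : Type*} [EMetricSpace X]
    [MeasurableSpace X] [BorelSpace X] {E : Set X} (hd : 0 < d) (hE : μH[d] E = 0)
    {r c : ℝ≥0∞} (hr : 0 < r) (hc : 0 < c) :
    ∃ t : ℕ → Set X, E ⊆ ⋃ n, t n ∧ (∀ n, Metric.ediam (t n) ≤ r) ∧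
      ∑' n, Metric.ediam (t n) ^ d < c := by
  rw [Measure.hausdorffMeasure_apply] at hE
  have h0 := ENNReal.iSup_eq_zero.1 (ENNReal.iSup_eq_zero.1 hE r) hr
  obtain ⟨t, ht⟩ := iInf_lt_iff.1 (h0.trans_lt hc)
  simp only [iInf_lt_iff] at ht
  obtain ⟨hcov, hdiam, hsum⟩ := ht
  refine ⟨t, hcov, hdiam, (ENNReal.tsum_le_tsum fun n => ?_).trans_lt hsum⟩
  rcases (t n).eq_empty_or_nonempty with h | h
  · simp [h, hd]
  · exact le_iSup_of_le h le_rfl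

theorem hausdorffMeasure_graphOver_ne_top (hβ0 : 0 ≤ β) (hβ1 : β ≤ 1) (hC : 0 ≤ C) (hd : 0 < d)
    (hf : ∀ x ∈ A, ∀ y ∈ A, ‖f x - f y‖ ≤ C * |x - y| ^ β) (hA : μH[d] A = 0) :
    μH[d + (2 - 2 * β)] (graphOver f A) ≠ ∞ := by
  let r : ℕ → ℝ≥0∞ := fun m => ((m + 1 : ℕ) : ℝ≥0∞)⁻¹
  have hr1 m : r m ≤ 1 := by simp [r]
  have hr : Tendsto (fun m => 3 * r m) atTop (𝓝 0) := by
    simpa [r] using ENNReal.Tendsto.const_mul (a := 3) (ENNReal.tendsto_inv_nat_nhds_zero.comp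
      (tendsto_add_atTop_nat 1)) (Or.inr (by simp))
  choose t hcov hdiam hsum using fun m : ℕ =>
    exists_cover_of_hausdorffMeasure_eq_zero hd hA (r := r m) (by simp [r]) one_pos
  have hinter m i : Metric.ediam (A ∩ t m i) ≤ Metric.ediam (t m i) :=
    Metric.ediam_mono Set.inter_subset_right
  have hle1 m i : Metric.ediam (A ∩ t m i) ≤ 1 := (hinter m i).trans ((hdiam m i).trans (hr1 m))
  have hbdd m i : Bornology.IsBounded (A ∩ t m i) :=
    Metric.isBounded_iff_ediam_ne_top.2 (ne_top_of_le_ne_top ENNReal.one_ne_top (hle1 m i))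
  set K := ENNReal.ofReal ((2 * C + 2) ^ 2 * 3 ^ (d + (2 - 2 * β)))
  have htsum m : ∑' q : ℕ × ℤ × ℤ,
      Metric.ediam (graphPiece f (A ∩ t m q.1) q.2) ^ (d + (2 - 2 * β)) ≤ K := by
    rw [ENNReal.tsum_prod']
    calc _ ≤ ∑' i, K * Metric.ediam (t m i) ^ d := by
          refine ENNReal.tsum_le_tsum fun i => (tsum_ediam_graphPiece_le hβ0 hβ1 hC hd
            (hle1 m i) fun x hx y hy => hf x hx.1 y hy.1).trans ?_
          gcongr
          exact Set.inter_subset_right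
      _ ≤ K * 1 := by
          rw [ENNReal.tsum_mul_left]
          gcongr
          exact (hsum m).le
      _ = K := mul_one K
  have hgraph m : graphOver f A ⊆ ⋃ q : ℕ × ℤ × ℤ, graphPiece f (A ∩ t m q.1) q.2 := by
    rintro _ ⟨x, hx, rfl⟩
    obtain ⟨i, hi⟩ := Set.mem_iUnion.1 (hcov m hx)
    exact Set.mem_iUnion.2 ⟨(i, ⌊(f x).re / Metric.diam (A ∩ t m i)⌋,
      ⌊(f x).im / Metric.diam (A ∩ t m i)⌋), x, ⟨⟨hx, hi⟩, rfl, rfl⟩, rfl⟩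
  refine ne_top_of_le_ne_top ENNReal.ofReal_ne_top
    ((Measure.hausdorffMeasure_le_liminf_tsum _ (graphOver f A) (l := atTop)
      (ι := fun _ => ℕ × ℤ × ℤ) _ hr (fun m q => graphPiece f (A ∩ t m q.1) q.2) ?_
      (Eventually.of_forall hgraph)).trans
    (liminf_le_of_frequently_le' (Frequently.of_forall htsum)))
  refine Eventually.of_forall fun m q => (ediam_graphPiece_le (hbdd m q.1) q.2).trans ?_
  gcongr
  exact (hinter m q.1).trans (hdiam m q.1)

theorem dimH_graphOver_le_add_of_holder (hβ0 : 0 ≤ β) (hβ1 : β ≤ 1) (hC : 0 ≤ C)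
    (hf : ∀ x ∈ A, ∀ y ∈ A, ‖f x - f y‖ ≤ C * |x - y| ^ β) :
    dimH (graphOver f A) ≤ dimH A + ENNReal.ofReal (2 - 2 * β) := by
  refine ENNReal.le_of_forall_pos_le_add fun ε hε _ => ?_
  lift dimH A to ℝ≥0 using Real.dimH_ne_top A with δ hδ
  have hnull : μH[(δ + ε : ℝ≥0)] A = 0 :=
    hausdorffMeasure_of_dimH_lt (by rw [← hδ]; exact_mod_cast lt_add_of_pos_right δ hε)
  have hfin := hausdorffMeasure_graphOver_ne_top hβ0 hβ1 hC (by positivity) hf hnull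
  rw [← Real.coe_toNNReal (2 - 2 * β) (by linarith), ← NNReal.coe_add] at hfin
  refine (dimH_le_of_hausdorffMeasure_ne_top hfin).trans_eq ?_
  rw [ENNReal.coe_add, ENNReal.coe_add, ENNReal.ofReal]
  ring

theorem dimH_graphOver_le_add (hβ0 : 0 ≤ β) (hβ1 : β ≤ 1) (hf : LocallyHolder β f)
    (A : Set ℝ) : dimH (graphOver f A) ≤ dimH A + ENNReal.ofReal (2 - 2 * β) := by
  have hA : A = ⋃ N : ℕ, A ∩ Set.Icc (-N : ℝ) N := by
    rw [← Set.inter_iUnion, Set.left_eq_inter]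
    intro x _
    obtain ⟨N, hN⟩ := exists_nat_ge |x|
    exact Set.mem_iUnion.2 ⟨N, abs_le.1 hN⟩
  have hgraph : graphOver f A = ⋃ N : ℕ, graphOver f (A ∩ Set.Icc (-N : ℝ) N) := by
    conv_lhs => rw [hA, graphOver, Set.image_iUnion]
    rfl
  rw [hgraph, dimH_iUnion]
  refine iSup_le fun N => ?_
  obtain ⟨C, hC0, hC⟩ := hf N
  calc dimH (graphOver f (A ∩ Set.Icc (-N : ℝ) N))
      ≤ dimH (A ∩ Set.Icc (-N : ℝ) N) + ENNReal.ofReal (2 - 2 * β) :=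
        dimH_graphOver_le_add_of_holder hβ0 hβ1 hC0 fun x hx y hy => hC x hx.2 y hy.2
    _ ≤ _ := by
        gcongr
        exact Set.inter_subset_left

end HolderGraph

/-! ### Kolmogorov's continuity criterion -/

section HolderPaths

/-- The left end point of the dyadic interval of generation `n` that contains `x`. -/
noncomputable def dyadicFloor (n : ℕ) (x : ℝ) : ℝ := ⌊(2 : ℝ) ^ n * x⌋ / 2 ^ n

theorem tendsto_dyadicFloor (x : ℝ) : Tendsto (fun n => dyadicFloor n x) atTop (𝓝 x) := by
  have hlower : Tendsto (fun n : ℕ => x - (2⁻¹ : ℝ) ^ n) atTop (𝓝 x) := by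
    simpa using tendsto_const_nhds.sub
      (tendsto_pow_atTop_nhds_zero_of_lt_one (r := (2⁻¹ : ℝ)) (by norm_num) (by norm_num))
  refine tendsto_of_tendsto_of_tendsto_of_le_of_le hlower tendsto_const_nhds (fun n => ?_)
    fun n => ?_
  · simp only [dyadicFloor]
    rw [le_div_iff₀ (by positivity), sub_mul, ← mul_pow, inv_mul_cancel₀ two_ne_zero, one_pow]
    linarith [Int.lt_floor_add_one ((2 : ℝ) ^ n * x)]
  · simp only [dyadicFloor]
    rw [div_le_iff₀ (by positivity)]
    linarith [Int.floor_le ((2 : ℝ) ^ n * x)]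

theorem floor_two_pow_succ_mul (n : ℕ) (x : ℝ) :
    ⌊(2 : ℝ) ^ (n + 1) * x⌋ = 2 * ⌊(2 : ℝ) ^ n * x⌋ ∨
      ⌊(2 : ℝ) ^ (n + 1) * x⌋ = 2 * ⌊(2 : ℝ) ^ n * x⌋ + 1 := by
  have hpow : (2 : ℝ) ^ (n + 1) * x = 2 * ((2 : ℝ) ^ n * x) := by ring
  have hle : 2 * ⌊(2 : ℝ) ^ n * x⌋ ≤ ⌊(2 : ℝ) ^ (n + 1) * x⌋ := by
    rw [Int.le_floor, hpow]
    push_cast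
    linarith [Int.floor_le ((2 : ℝ) ^ n * x)]
  have hlt : ⌊(2 : ℝ) ^ (n + 1) * x⌋ < 2 * ⌊(2 : ℝ) ^ n * x⌋ + 2 := by
    rw [Int.floor_lt, hpow]
    push_cast
    linarith [Int.lt_floor_add_one ((2 : ℝ) ^ n * x)]
  omega

theorem abs_floor_two_pow_mul_le {N : ℕ} {x : ℝ} (hx : x ∈ Set.Icc (-N : ℝ) N) (n : ℕ) :
    |⌊(2 : ℝ) ^ n * x⌋| ≤ N * 2 ^ n := by
  have hpos : (0 : ℝ) < 2 ^ n := by positivity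
  refine abs_le.2 ⟨Int.le_floor.2 ?_, ?_⟩
  · push_cast
    nlinarith [hx.1]
  · have : (⌊(2 : ℝ) ^ n * x⌋ : ℝ) ≤ N * 2 ^ n := by
      nlinarith [hx.2, Int.floor_le ((2 : ℝ) ^ n * x)]
    exact_mod_cast this

variable {E : Type*} [NormedAddCommGroup E]

/-- The increments of `f` over the dyadic intervals of generation `n ≥ n₀` which meet `[-N, N]`
are at most `r ^ n`. -/
def DyadicIncrementsLE (f : ℝ → E) (N n₀ : ℕ) (r : ℝ) : Prop :=
  ∀ n ≥ n₀, ∀ j : ℤ, |j| ≤ N * 2 ^ n → ‖f ((j + 1) / 2 ^ n) - f (j / 2 ^ n)‖ ≤ r ^ n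

namespace DyadicIncrementsLE

variable {f : ℝ → E} {N n₀ n : ℕ} {r x y : ℝ}

theorem norm_sub_le_of_eq_or_eq (h : DyadicIncrementsLE f N n₀ r) (hr : 0 ≤ r) (hn : n₀ ≤ n)
    {j k : ℤ} (hj : |j| ≤ N * 2 ^ n) (hk : k = j ∨ k = j + 1) :
    ‖f (k / 2 ^ n) - f (j / 2 ^ n)‖ ≤ r ^ n := by
  rcases hk with rfl | rfl
  · rw [sub_self, norm_zero]
    positivity
  · exact_mod_cast h n hn j hj

theorem norm_dyadicFloor_succ_sub_le (h : DyadicIncrementsLE f N n₀ r) (hr : 0 ≤ r)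
    (hn : n₀ ≤ n) (hx : x ∈ Set.Icc (-N : ℝ) N) :
    ‖f (dyadicFloor (n + 1) x) - f (dyadicFloor n x)‖ ≤ r ^ (n + 1) := by
  have hfloor : dyadicFloor n x = ((2 * ⌊(2 : ℝ) ^ n * x⌋ : ℤ) : ℝ) / 2 ^ (n + 1) := by
    rw [dyadicFloor]
    push_cast
    field_simp
    ring
  rw [hfloor, dyadicFloor]
  refine h.norm_sub_le_of_eq_or_eq hr (hn.trans n.le_succ) ?_ (floor_two_pow_succ_mul n x)
  rw [abs_mul, abs_two, pow_succ, mul_comm, ← mul_assoc]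
  gcongr
  exact abs_floor_two_pow_mul_le hx n

theorem norm_dyadicFloor_sub_le (h : DyadicIncrementsLE f N n₀ r) (hf : Continuous f)
    (hr : 0 ≤ r) (hr1 : r < 1) (hn : n₀ ≤ n) (hx : x ∈ Set.Icc (-N : ℝ) N) :
    ‖f (dyadicFloor n x) - f x‖ ≤ r ^ n * (r / (1 - r)) := by
  have hstep (m : ℕ) : dist (f (dyadicFloor (n + m) x)) (f (dyadicFloor (n + (m + 1)) x)) ≤
      r ^ (n + 1) * r ^ m := by
    rw [dist_comm, dist_eq_norm, ← pow_add, add_right_comm]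
    exact h.norm_dyadicFloor_succ_sub_le hr (hn.trans (Nat.le_add_right n m)) hx
  have hlim : Tendsto (fun m => f (dyadicFloor (n + m) x)) atTop (𝓝 (f x)) := by
    simpa only [add_comm n, Function.comp_def] using
      (hf.tendsto x).comp ((tendsto_add_atTop_iff_nat n).2 (tendsto_dyadicFloor x))
  have := dist_le_of_le_geometric_of_tendsto₀ r (r ^ (n + 1)) hr1 hstep hlim
  rwa [add_zero, dist_eq_norm, pow_succ, mul_div_assoc] at this

theorem norm_dyadicFloor_sub_dyadicFloor_le (h : DyadicIncrementsLE f N n₀ r) (hr : 0 ≤ r)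
    (hn : n₀ ≤ n) (hx : x ∈ Set.Icc (-N : ℝ) N) (hxy : x ≤ y) (hyx : y - x ≤ 2⁻¹ ^ n) :
    ‖f (dyadicFloor n y) - f (dyadicFloor n x)‖ ≤ r ^ n := by
  have hle : (2 : ℝ) ^ n * y ≤ 2 ^ n * x + 1 := by
    have : (2 : ℝ) ^ n * (y - x) ≤ 2 ^ n * 2⁻¹ ^ n := by gcongr
    rw [← mul_pow, mul_inv_cancel₀ two_ne_zero, one_pow] at this
    linarith
  have hlower : ⌊(2 : ℝ) ^ n * x⌋ ≤ ⌊(2 : ℝ) ^ n * y⌋ := Int.floor_mono (by gcongr)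
  have hupper : ⌊(2 : ℝ) ^ n * y⌋ ≤ ⌊(2 : ℝ) ^ n * x⌋ + 1 :=
    (Int.floor_mono hle).trans_eq (Int.floor_add_one _)
  exact h.norm_sub_le_of_eq_or_eq hr hn (abs_floor_two_pow_mul_le hx n) (by omega)

theorem norm_sub_le_of_sub_le (h : DyadicIncrementsLE f N n₀ r) (hf : Continuous f)
    (hr : 0 ≤ r) (hr1 : r < 1) (hn : n₀ ≤ n) (hx : x ∈ Set.Icc (-N : ℝ) N)
    (hy : y ∈ Set.Icc (-N : ℝ) N) (hxy : |x - y| ≤ 2⁻¹ ^ n) :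
    ‖f x - f y‖ ≤ (1 + 2 * (r / (1 - r))) * r ^ n := by
  wlog hle : x ≤ y generalizing x y
  · rw [norm_sub_rev]
    exact this hy hx (by rwa [abs_sub_comm]) (le_of_not_ge hle)
  rw [abs_sub_comm, abs_of_nonneg (sub_nonneg.2 hle)] at hxy
  calc ‖f x - f y‖
      = ‖(f (dyadicFloor n y) - f y) + -(f (dyadicFloor n x) - f x) +
          -(f (dyadicFloor n y) - f (dyadicFloor n x))‖ := by congr 1; abel
    _ ≤ ‖f (dyadicFloor n y) - f y‖ + ‖f (dyadicFloor n x) - f x‖ +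
          ‖f (dyadicFloor n y) - f (dyadicFloor n x)‖ := by
        simpa only [norm_neg] using norm_add₃_le (a := f (dyadicFloor n y) - f y)
          (b := -(f (dyadicFloor n x) - f x)) (c := -(f (dyadicFloor n y) - f (dyadicFloor n x)))
    _ ≤ r ^ n * (r / (1 - r)) + r ^ n * (r / (1 - r)) + r ^ n := by
        gcongr
        · exact h.norm_dyadicFloor_sub_le hf hr hr1 hn hy
        · exact h.norm_dyadicFloor_sub_le hf hr hr1 hn hx
        · exact h.norm_dyadicFloor_sub_dyadicFloor_le hr hn hx hle hxy
    _ = (1 + 2 * (r / (1 - r))) * r ^ n := by ring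

end DyadicIncrementsLE

theorem holder_of_holder_of_dist_le {X : Type*} [PseudoMetricSpace X] {K : Set X} {f : X → E}
    {C M η β : ℝ} (hη : 0 < η) (hβ : 0 ≤ β) (hM : ∀ x ∈ K, ‖f x‖ ≤ M)
    (h : ∀ x ∈ K, ∀ y ∈ K, dist x y ≤ η → ‖f x - f y‖ ≤ C * dist x y ^ β) :
    ∀ x ∈ K, ∀ y ∈ K, ‖f x - f y‖ ≤ max C (2 * M / η ^ β) * dist x y ^ β := by
  intro x hx y hy
  rcases le_or_gt (dist x y) η with hle | hgt
  · exact (h x hx y hy hle).trans (by gcongr; exact le_max_left _ _)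
  · have hM0 : 0 ≤ M := (norm_nonneg _).trans (hM x hx)
    calc ‖f x - f y‖ ≤ 2 * M := by linarith [norm_sub_le (f x) (f y), hM x hx, hM y hy]
      _ = 2 * M / η ^ β * η ^ β := (div_mul_cancel₀ _ (by positivity)).symm
      _ ≤ max C (2 * M / η ^ β) * dist x y ^ β := by
          gcongr
          exact le_max_right _ _

theorem DyadicIncrementsLE.exists_holder {f : ℝ → E} {N n₀ : ℕ} {β : ℝ}
    (h : DyadicIncrementsLE f N n₀ (2 ^ (-β))) (hf : Continuous f) (hβ : 0 < β) :
    ∃ C : ℝ, 0 ≤ C ∧ ∀ x ∈ Set.Icc (-N : ℝ) N, ∀ y ∈ Set.Icc (-N : ℝ) N,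
      ‖f x - f y‖ ≤ C * |x - y| ^ β := by
  set r : ℝ := 2 ^ (-β) with hr
  have hr0 : 0 < r := by positivity
  have hr1 : r < 1 := Real.rpow_lt_one_of_one_lt_of_neg (by norm_num) (by linarith)
  have : 0 ≤ 1 + 2 * (r / (1 - r)) := by
    have : 0 < 1 - r := by linarith
    positivity
  obtain ⟨M, hM⟩ := (isCompact_Icc (a := (-N : ℝ)) (b := N)).exists_bound_of_continuousOn
    hf.continuousOn
  have hclose : ∀ x ∈ Set.Icc (-N : ℝ) N, ∀ y ∈ Set.Icc (-N : ℝ) N, dist x y ≤ 2⁻¹ ^ n₀ →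
      ‖f x - f y‖ ≤ ((1 + 2 * (r / (1 - r))) * 2 ^ β) * dist x y ^ β := by
    intro x hx y hy hxy
    rcases eq_or_ne x y with rfl | hne
    · rw [sub_self, norm_zero]
      positivity
    obtain ⟨n, hn, hn'⟩ := exists_nat_pow_near_of_lt_one (dist_pos.2 hne)
      (hxy.trans (pow_le_one₀ (by norm_num) (by norm_num)))
      (by norm_num : (0 : ℝ) < 2⁻¹) (by norm_num)
    have hnn : n₀ ≤ n := Nat.lt_succ_iff.1
      ((pow_lt_pow_iff_right_of_lt_one₀ (by norm_num) (by norm_num)).1 (hn.trans_le hxy))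
    have hpow : r ^ n = 2 ^ β * ((2 : ℝ)⁻¹ ^ (n + 1)) ^ β := by
      rw [← Real.mul_rpow (by norm_num) (by positivity), pow_succ', ← mul_assoc,
        mul_inv_cancel₀ two_ne_zero, one_mul, ← Real.rpow_pow_comm (by norm_num), hr,
        Real.inv_rpow (by norm_num), Real.rpow_neg (by norm_num)]
    calc ‖f x - f y‖ ≤ (1 + 2 * (r / (1 - r))) * r ^ n :=
          h.norm_sub_le_of_sub_le hf hr0.le hr1 hnn hx hy hn'
      _ ≤ (1 + 2 * (r / (1 - r))) * (2 ^ β * dist x y ^ β) := by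
          rw [hpow]
          gcongr
      _ = _ := by ring
  exact ⟨_, le_max_of_le_left (by positivity),
    holder_of_holder_of_dist_le (by positivity) hβ.le hM hclose⟩

variable {Ω : Type*} [MeasurableSpace Ω] {P : Measure Ω} {S : ℝ → Ω → E} {C : ℝ≥0} {β β' : ℝ}
  {p : ℕ}

theorem measure_exists_le_norm_dyadic_increment_le
    (h : ∀ x y ε : ℝ, x ≠ y → 0 < ε →
      P {ω | ε ≤ ‖S x ω - S y ω‖} ≤ C * ENNReal.ofReal (|x - y| ^ β / ε) ^ p)
    (M n : ℕ) {ε : ℝ} (hε : 0 < ε) :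
    P {ω | ∃ j : ℤ, |j| ≤ M ∧ ε ≤ ‖S ((j + 1) / 2 ^ n) ω - S (j / 2 ^ n) ω‖} ≤
      (2 * M + 1) * (C * ENNReal.ofReal ((2⁻¹ ^ n) ^ β / ε) ^ p) := by
  have hcard : (Finset.Icc (-M : ℤ) M).card = 2 * M + 1 := by
    rw [Int.card_Icc]
    omega
  have hterm (j : ℤ) : P {ω | ε ≤ ‖S ((j + 1) / 2 ^ n) ω - S (j / 2 ^ n) ω‖} ≤
      C * ENNReal.ofReal ((2⁻¹ ^ n) ^ β / ε) ^ p := by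
    have hsub : ((j : ℝ) + 1) / 2 ^ n - j / 2 ^ n = 2⁻¹ ^ n := by
      rw [← sub_div, add_sub_cancel_left, one_div, inv_pow]
    have hpos : (0 : ℝ) < 2⁻¹ ^ n := by positivity
    simpa only [hsub, abs_of_pos hpos] using
      h ((j + 1) / 2 ^ n) (j / 2 ^ n) ε (sub_ne_zero.1 (hsub ▸ hpos.ne')) hε
  calc _ ≤ P (⋃ j ∈ Finset.Icc (-M : ℤ) M,
          {ω | ε ≤ ‖S ((j + 1) / 2 ^ n) ω - S (j / 2 ^ n) ω‖}) := by
        refine measure_mono ?_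
        rintro ω ⟨j, hj, hω⟩
        exact Set.mem_biUnion (x := j) (Finset.mem_coe.2 (Finset.mem_Icc.2 (abs_le.1 hj))) hω
    _ ≤ ∑ _ ∈ Finset.Icc (-M : ℤ) M, C * ENNReal.ofReal ((2⁻¹ ^ n) ^ β / ε) ^ p :=
        (measure_biUnion_finset_le _ _).trans (Finset.sum_le_sum fun j _ => hterm j)
    _ = _ := by
        rw [Finset.sum_const, hcard, nsmul_eq_mul]
        push_cast
        rfl

theorem ae_locallyHolder_of_measure_le (hS : ∀ ω, Continuous fun x => S x ω) (hβ' : 0 < β')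
    (hp : 1 < p * (β - β'))
    (h : ∀ x y ε : ℝ, x ≠ y → 0 < ε →
      P {ω | ε ≤ ‖S x ω - S y ω‖} ≤ C * ENNReal.ofReal (|x - y| ^ β / ε) ^ p) :
    ∀ᵐ ω ∂P, LocallyHolder β' fun x => S x ω := by
  refine ae_all_iff.2 fun N => ?_
  set r : ℝ := 2 ^ (-β')
  set δ : ℝ := 2 ^ (β' - β)
  have hδ : 2 * δ ^ p < 1 := by
    rw [← Real.rpow_natCast, ← Real.rpow_mul (by norm_num), ← Real.rpow_one_add' (by norm_num)
      (by nlinarith)]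
    exact Real.rpow_lt_one_of_one_lt_of_neg one_lt_two (by nlinarith)
  have hratio (n : ℕ) : ((2 : ℝ)⁻¹ ^ n) ^ β / r ^ n = δ ^ n := by
    rw [← Real.rpow_pow_comm (by norm_num), ← div_pow, Real.inv_rpow (by norm_num),
      ← Real.rpow_neg (by norm_num), ← Real.rpow_sub (by norm_num), neg_sub_neg]
  set B : ℕ → Set Ω := fun n =>
    {ω | ∃ j : ℤ, |j| ≤ (N * 2 ^ n : ℕ) ∧ r ^ n ≤ ‖S ((j + 1) / 2 ^ n) ω - S (j / 2 ^ n) ω‖}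
  have hB (n : ℕ) : P (B n) ≤ ENNReal.ofReal ((2 * N + 1) * C * (2 * δ ^ p) ^ n) := by
    refine (measure_exists_le_norm_dyadic_increment_le h (N * 2 ^ n) n (by positivity)).trans ?_
    rw [hratio, ← ENNReal.ofReal_pow (by positivity), ← ENNReal.ofReal_coe_nnreal,
      ← ENNReal.ofReal_mul C.coe_nonneg, ← ENNReal.ofReal_natCast, ← ENNReal.ofReal_ofNat,
      ← ENNReal.ofReal_one, ← ENNReal.ofReal_mul (by norm_num),
      ← ENNReal.ofReal_add (by positivity) zero_le_one, ← ENNReal.ofReal_mul (by positivity)]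
    refine ENNReal.ofReal_le_ofReal ?_
    have hone : (1 : ℝ) ≤ 2 ^ n := one_le_pow₀ one_le_two
    calc _ ≤ ((2 * N + 1) * 2 ^ n) * (C * (δ ^ n) ^ p) := by
          gcongr
          push_cast
          linarith
      _ = (2 * N + 1) * C * (2 * δ ^ p) ^ n := by ring
  have hsum : ∑' n, P (B n) ≠ ∞ := ne_top_of_le_ne_top
    ((summable_geometric_of_lt_one (by positivity) hδ).mul_left _).tsum_ofReal_ne_top
    (ENNReal.tsum_le_tsum hB)
  filter_upwards [ae_eventually_notMem hsum] with ω hω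
  obtain ⟨n₀, hn₀⟩ := eventually_atTop.1 hω
  have hincr : DyadicIncrementsLE (fun x => S x ω) N n₀ r := fun n hn j hj => by
    by_contra! hcon
    exact hn₀ n hn ⟨j, by exact_mod_cast hj, hcon.le⟩
  exact hincr.exists_holder (hS ω) hβ'

end HolderPaths

/-! ### Sub-Gaussian tails of Steinhaus sums -/

section SubGaussian

variable {Ω : Type*} [MeasurableSpace Ω] {P : Measure Ω} {V : ℝ≥0}

theorem hasSubgaussianMGF_of_tendsto [IsFiniteMeasure P] {X : ℕ → Ω → ℝ} {Y : Ω → ℝ} {M : ℝ}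
    (hX : ∀ n, HasSubgaussianMGF (X n) V P) (hM : ∀ n, ∀ᵐ ω ∂P, |X n ω| ≤ M)
    (hlim : ∀ᵐ ω ∂P, Tendsto (fun n => X n ω) atTop (𝓝 (Y ω))) : HasSubgaussianMGF Y V P := by
  have hY : AEMeasurable Y P := aemeasurable_of_tendsto_metrizable_ae _
    (fun n => (hX n).aemeasurable) hlim
  have hYM : ∀ᵐ ω ∂P, Y ω ∈ Set.Icc (-M) M := by
    filter_upwards [hlim, ae_all_iff.2 hM] with ω h hb
    exact isClosed_Icc.mem_of_tendsto h (.of_forall fun n => abs_le.1 (hb n))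
  refine ⟨fun t => integrable_exp_mul_of_mem_Icc hY hYM, fun t => ?_⟩
  have hmgf : Tendsto (fun n => mgf (X n) P t) atTop (𝓝 (mgf Y P t)) := by
    refine tendsto_integral_of_dominated_convergence (fun _ => Real.exp (|t| * M))
      (fun n => ((hX n).integrable_exp_mul t).aestronglyMeasurable) (integrable_const _)
      (fun n => ?_) ?_
    · filter_upwards [hM n] with ω h
      rw [Real.norm_eq_abs, Real.abs_exp, Real.exp_le_exp]
      exact (le_abs_self _).trans (by rw [abs_mul]; gcongr)
    · filter_upwards [hlim] with ω h
      exact (Real.continuous_exp.tendsto _).comp (h.const_mul t)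
  exact le_of_tendsto' hmgf fun n => (hX n).mgf_le t

theorem hasSubgaussianMGF_mono {X : Ω → ℝ} {c : ℝ≥0} (h : HasSubgaussianMGF X c P) (hc : c ≤ V) :
    HasSubgaussianMGF X V P :=
  ⟨h.integrable_exp_mul, fun t => (h.mgf_le t).trans (by gcongr)⟩

theorem measureReal_le_abs_le_of_hasSubgaussianMGF {X : Ω → ℝ}
    (h : HasSubgaussianMGF X V P) {ε : ℝ} (hε : 0 ≤ ε) :
    P.real {ω | ε ≤ |X ω|} ≤ 2 * Real.exp (-ε ^ 2 / (2 * V)) := by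
  have hsplit : {ω | ε ≤ |X ω|} = {ω | ε ≤ X ω} ∪ {ω | ε ≤ (-X) ω} := by
    ext ω
    exact le_abs (a := ε) (b := X ω)
  rw [hsplit]
  linarith [measureReal_union_le (μ := P) {ω | ε ≤ X ω} {ω | ε ≤ (-X) ω}, h.measure_ge_le hε,
    h.neg.measure_ge_le hε]

theorem measureReal_le_norm_le_of_hasSubgaussianMGF [IsFiniteMeasure P] {Z : Ω → ℂ}
    (hre : HasSubgaussianMGF (fun ω => (Z ω).re) V P)
    (him : HasSubgaussianMGF (fun ω => (Z ω).im) V P) {ε : ℝ} (hε : 0 ≤ ε) :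
    P.real {ω | ε ≤ ‖Z ω‖} ≤ 4 * Real.exp (-ε ^ 2 / (8 * V)) := by
  have hsplit : {ω | ε ≤ ‖Z ω‖} ⊆ {ω | ε / 2 ≤ |(Z ω).re|} ∪ {ω | ε / 2 ≤ |(Z ω).im|} := by
    intro ω hω
    have : ε ≤ |(Z ω).re| + |(Z ω).im| := le_trans hω (Complex.norm_le_abs_re_add_abs_im _)
    by_contra! hcon
    simp only [Set.mem_union, Set.mem_ofPred_eq, not_or, not_le] at hcon
    linarith
  have hexp : -(ε / 2) ^ 2 / (2 * V) = -ε ^ 2 / (8 * V) := by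
    rw [div_pow, ← neg_div, div_div]
    ring
  have hre' := measureReal_le_abs_le_of_hasSubgaussianMGF hre (div_nonneg hε zero_le_two)
  have him' := measureReal_le_abs_le_of_hasSubgaussianMGF him (div_nonneg hε zero_le_two)
  rw [hexp] at hre' him'
  linarith [measureReal_mono (μ := P) hsplit, measureReal_union_le (μ := P)
    {ω | ε / 2 ≤ |(Z ω).re|} {ω | ε / 2 ≤ |(Z ω).im|}]

end SubGaussian

section SteinhausSums

/-- The Steinhaus phase `exp (2 π i t)`. -/
noncomputable def phase (t : ℝ) : ℂ := Complex.exp (2 * Real.pi * Complex.I * t)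

theorem norm_phase (t : ℝ) : ‖phase t‖ = 1 := by
  rw [phase, show 2 * (Real.pi : ℂ) * Complex.I * t = ((2 * Real.pi * t : ℝ) : ℂ) * Complex.I by
    push_cast; ring, Complex.norm_exp_ofReal_mul_I]

theorem norm_mul_phase (c : ℂ) (t : ℝ) : ‖c * phase t‖ = ‖c‖ := by
  rw [norm_mul, norm_phase, mul_one]

theorem continuous_phase : Continuous phase := by
  unfold phase
  fun_prop

theorem integral_phase : ∫ t in Set.Icc (0 : ℝ) 1, phase t = 0 := by
  rw [integral_Icc_eq_integral_Ioc, ← intervalIntegral.integral_of_le zero_le_one]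
  simp only [phase]
  rw [integral_exp_mul_complex Complex.two_pi_I_ne_zero]
  simp [Complex.exp_two_pi_mul_I]

variable {Ω : Type*} {c : ℕ → ℂ} {θ : ℕ → Ω → ℝ}

/-- The random variable `∑ c n * exp (2 π i θ n)`. -/
noncomputable def steinhausSum (c : ℕ → ℂ) (θ : ℕ → Ω → ℝ) (ω : Ω) : ℂ :=
  ∑' n, c n * phase (θ n ω)

theorem summable_mul_phase (hc : Summable fun n => ‖c n‖) (t : ℕ → ℝ) :
    Summable fun n => c n * phase (t n) :=
  .of_norm (by simpa only [norm_mul_phase] using hc)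

theorem tendsto_sum_mul_phase (hc : Summable fun n => ‖c n‖) (θ : ℕ → Ω → ℝ) (ω : Ω) :
    Tendsto (fun N => ∑ n ∈ Finset.range N, c n * phase (θ n ω)) atTop
      (𝓝 (steinhausSum c θ ω)) :=
  (summable_mul_phase hc fun n => θ n ω).hasSum.tendsto_sum_nat

theorem mul_steinhausSum (u : ℂ) (c : ℕ → ℂ) (θ : ℕ → Ω → ℝ) (ω : Ω) :
    steinhausSum (fun n => u * c n) θ ω = u * steinhausSum c θ ω := by
  simp only [steinhausSum, mul_assoc, tsum_mul_left]

variable [MeasurableSpace Ω] {P : Measure Ω}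

theorem measurable_steinhausSum (hc : Summable fun n => ‖c n‖) (hθ : ∀ n, Measurable (θ n)) :
    Measurable (steinhausSum c θ) :=
  measurable_of_tendsto_metrizable
    (fun _ => Finset.measurable_sum _ fun n _ =>
      (continuous_phase.measurable.comp (hθ n)).const_mul (c n))
    (tendsto_pi_nhds.2 (tendsto_sum_mul_phase hc θ))

theorem integral_mul_phase {θ : Ω → ℝ} (hθ : Measurable θ)
    (hlaw : P.map θ = (volume : Measure ℝ).restrict (Set.Icc 0 1)) (c : ℂ) :
    ∫ ω, c * phase (θ ω) ∂P = 0 := by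
  rw [integral_const_mul, ← integral_map (f := phase) hθ.aemeasurable
    continuous_phase.aestronglyMeasurable, hlaw, integral_phase, mul_zero]

variable [IsProbabilityMeasure P]

theorem hasSubgaussianMGF_re_mul_phase {θ : Ω → ℝ} (hθ : Measurable θ)
    (hlaw : P.map θ = (volume : Measure ℝ).restrict (Set.Icc 0 1)) (c : ℂ) :
    HasSubgaussianMGF (fun ω => (c * phase (θ ω)).re) (‖c‖₊ ^ 2) P := by
  have hmeas : Measurable fun ω => c * phase (θ ω) :=
    (continuous_phase.measurable.comp hθ).const_mul c
  have hmean : ∫ ω, (c * phase (θ ω)).re ∂P = 0 := by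
    have hint : Integrable (fun ω => c * phase (θ ω)) P :=
      .of_bound hmeas.aestronglyMeasurable ‖c‖ (ae_of_all _ fun ω => (norm_mul_phase c _).le)
    have h := integral_re hint
    rw [integral_mul_phase hθ hlaw, map_zero] at h
    exact h
  convert hasSubgaussianMGF_of_mem_Icc_of_integral_eq_zero (μ := P) (a := -‖c‖) (b := ‖c‖)
    (X := fun ω => (c * phase (θ ω)).re)
    (Complex.measurable_re.comp hmeas).aemeasurable
    (ae_of_all _ fun ω => abs_le.1 ((Complex.abs_re_le_norm _).trans_eq (norm_mul_phase c (θ ω))))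
    hmean using 1
  apply NNReal.eq
  simp only [NNReal.coe_pow, coe_nnnorm, NNReal.coe_div, Real.norm_eq_abs, NNReal.coe_ofNat]
  rw [sub_neg_eq_add, ← two_mul, abs_of_nonneg (by positivity), mul_div_cancel_left₀ _ two_ne_zero]

theorem hasSubgaussianMGF_re_steinhausSum (hθ : IsIIDUniform P θ) (hc : Summable fun n => ‖c n‖)
    {V : ℝ≥0} (hV : ∀ N, ∑ n ∈ Finset.range N, ‖c n‖₊ ^ 2 ≤ V) :
    HasSubgaussianMGF (fun ω => (steinhausSum c θ ω).re) V P := by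
  obtain ⟨hm, hind, hlaw⟩ := hθ
  have hpartial (N : ℕ) :
      HasSubgaussianMGF (fun ω => ∑ n ∈ Finset.range N, (c n * phase (θ n ω)).re) V P :=
    hasSubgaussianMGF_mono (HasSubgaussianMGF.sum_of_iIndepFun
      (hind.comp (fun n t => (c n * phase t).re) fun n => Complex.measurable_re.comp
        (continuous_phase.measurable.const_mul (c n)))
      fun n _ => hasSubgaussianMGF_re_mul_phase (hm n) (hlaw n) (c n)) (hV N)
  simp only [← Complex.re_sum] at hpartial
  refine hasSubgaussianMGF_of_tendsto (M := ∑' n, ‖c n‖) hpartial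
    (fun N => ae_of_all _ fun ω => ?_) (ae_of_all _ fun ω =>
      (Complex.continuous_re.tendsto _).comp (tendsto_sum_mul_phase hc θ ω))
  calc |(∑ n ∈ Finset.range N, c n * phase (θ n ω)).re|
      ≤ ∑ n ∈ Finset.range N, ‖c n * phase (θ n ω)‖ :=
        (Complex.abs_re_le_norm _).trans (norm_sum_le _ _)
    _ ≤ ∑' n, ‖c n‖ := by
        simp only [norm_mul_phase]
        exact hc.sum_le_tsum _ fun _ _ => norm_nonneg _

theorem measureReal_le_norm_steinhausSum_le (hθ : IsIIDUniform P θ)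
    (hc : Summable fun n => ‖c n‖) {V : ℝ≥0}
    (hV : ∀ N, ∑ n ∈ Finset.range N, ‖c n‖₊ ^ 2 ≤ V) {ε : ℝ} (hε : 0 ≤ ε) :
    P.real {ω | ε ≤ ‖steinhausSum c θ ω‖} ≤ 4 * Real.exp (-ε ^ 2 / (8 * V)) := by
  have him : HasSubgaussianMGF (fun ω => (steinhausSum c θ ω).im) V P := by
    have h := hasSubgaussianMGF_re_steinhausSum hθ (c := fun n => -Complex.I * c n) (V := V)
      (by simpa using hc) (by simpa using hV)
    simp only [mul_steinhausSum (-Complex.I)] at h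
    simpa using h
  exact measureReal_le_norm_le_of_hasSubgaussianMGF (hasSubgaussianMGF_re_steinhausSum hθ hc hV)
    him hε

theorem measure_le_norm_steinhausSum_le (hθ : IsIIDUniform P θ) (hc : Summable fun n => ‖c n‖)
    {v : ℝ} (hv : 0 < v) (hV : ∀ N, ∑ n ∈ Finset.range N, ‖c n‖ ^ 2 ≤ v ^ 2) (p : ℕ) {ε : ℝ}
    (hε : 0 < ε) :
    P {ω | ε ≤ ‖steinhausSum c θ ω‖} ≤
      ENNReal.ofReal (4 * p.factorial * 8 ^ p) * ENNReal.ofReal (v / ε) ^ (2 * p) := by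
  have htail := measureReal_le_norm_steinhausSum_le hθ hc (V := (v ^ 2).toNNReal) (fun N => by
    rw [← NNReal.coe_le_coe, Real.coe_toNNReal _ (by positivity)]
    push_cast
    exact hV N) hε.le
  rw [Real.coe_toNNReal _ (by positivity)] at htail
  rw [← ENNReal.ofReal_pow (by positivity), ← ENNReal.ofReal_mul (by positivity),
    ← ofReal_measureReal]
  refine ENNReal.ofReal_le_ofReal (htail.trans ?_)
  set u := ε ^ 2 / (8 * v ^ 2) with hu
  have hexp : Real.exp (-ε ^ 2 / (8 * v ^ 2)) ≤ p.factorial / u ^ p := by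
    rw [neg_div, ← hu, Real.exp_neg, inv_le_comm₀ (Real.exp_pos _) (by positivity), inv_div]
    exact Real.pow_div_factorial_le_exp u (by positivity) p
  have hinv : u⁻¹ = 8 * (v / ε) ^ 2 := by
    rw [hu]
    field_simp
  calc 4 * Real.exp (-ε ^ 2 / (8 * v ^ 2)) ≤ 4 * (p.factorial / u ^ p) := by gcongr
    _ = 4 * p.factorial * 8 ^ p * (v / ε) ^ (2 * p) := by
      rw [div_eq_mul_inv, ← inv_pow, hinv, mul_pow, ← pow_mul]
      ring

end SteinhausSums

/-! ### Block norms and Hölder continuity of the series -/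

section Rates

variable {a : ℕ → ℂ} {lam : ℕ → ℝ} {q : ℝ}

theorem blockNorm_nonneg (a : ℕ → ℂ) (lam : ℕ → ℝ) (q : ℝ) (k : ℕ) : 0 ≤ blockNorm a lam q k :=
  Real.sqrt_nonneg _

theorem blockNorm_sq (a : ℕ → ℂ) (lam : ℕ → ℝ) (q : ℝ) (k : ℕ) :
    blockNorm a lam q k ^ 2 =
      ∑' n : {n : ℕ // q ^ k ≤ lam n ∧ lam n < q ^ (k + 1)}, ‖a n‖ ^ 2 :=
  Real.sq_sqrt (tsum_nonneg fun _ => by positivity)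

theorem blockRate_eq_coe {k : ℕ} (h : 0 < blockNorm a lam q k) :
    blockRate a lam q k = ((-Real.log (blockNorm a lam q k) / (k * Real.log q) : ℝ) : EReal) := by
  rw [blockRate, ENNReal.log_ofReal_of_pos h, ← EReal.coe_neg, ← EReal.coe_div]

theorem blockRate_eq_top (hq : 1 < q) {k : ℕ} (hk : 0 < k) (h : blockNorm a lam q k = 0) :
    blockRate a lam q k = ⊤ := by
  rw [blockRate, h, ENNReal.ofReal_zero, ENNReal.log_zero, EReal.neg_bot]
  have : (0 : ℝ) < k * Real.log q := mul_pos (by exact_mod_cast hk) (Real.log_pos hq)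
  exact EReal.top_div_of_pos_ne_top (by exact_mod_cast this) (EReal.coe_ne_top _)

theorem blockNorm_le_of_lt_blockRate (hq : 1 < q) {k : ℕ} (hk : 0 < k) {c : ℝ}
    (h : (c : EReal) < blockRate a lam q k) : blockNorm a lam q k ≤ q ^ (-(c * k)) := by
  rcases (blockNorm_nonneg a lam q k).eq_or_lt with h0 | h0
  · rw [← h0]
    positivity
  rw [blockRate_eq_coe h0, EReal.coe_lt_coe_iff, lt_div_iff₀
    (mul_pos (by exact_mod_cast hk) (Real.log_pos hq))] at h
  rw [← Real.log_le_log_iff h0 (by positivity), Real.log_rpow (by positivity)]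
  linarith

theorem le_blockNorm_of_blockRate_lt (hq : 1 < q) {k : ℕ} (hk : 0 < k) {c : ℝ}
    (h : blockRate a lam q k < c) : q ^ (-(c * k)) ≤ blockNorm a lam q k := by
  rcases (blockNorm_nonneg a lam q k).eq_or_lt with h0 | h0
  · rw [blockRate_eq_top hq hk h0.symm] at h
    exact absurd h (by simp)
  rw [blockRate_eq_coe h0, EReal.coe_lt_coe_iff, div_lt_iff₀
    (mul_pos (by exact_mod_cast hk) (Real.log_pos hq))] at h
  rw [← Real.log_le_log_iff (by positivity) h0, Real.log_rpow (by positivity)]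
  linarith

theorem eventually_blockNorm_le (hq : 1 < q) {c : ℝ} (h : (c : EReal) < lowerRate a lam q) :
    ∀ᶠ k in atTop, blockNorm a lam q k ≤ q ^ (-(c * k)) := by
  filter_upwards [eventually_lt_of_lt_liminf h, eventually_gt_atTop 0] with k hk hk0
  exact blockNorm_le_of_lt_blockRate hq hk0 hk

theorem eventually_le_blockNorm (hq : 1 < q) {c : ℝ} (h : upperRate a lam q < c) :
    ∀ᶠ k : ℕ in atTop, q ^ (-(c * k)) ≤ blockNorm a lam q k := by
  filter_upwards [eventually_lt_of_limsup_lt h, eventually_gt_atTop 0] with k hk hk0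
  exact le_blockNorm_of_blockRate_lt hq hk0 hk

theorem summable_norm_sq (ha : Summable fun n => ‖a n‖) : Summable fun n => ‖a n‖ ^ 2 := by
  refine Summable.of_norm_bounded_eventually_nat ha ?_
  filter_upwards [ha.tendsto_atTop_zero.eventually (eventually_le_nhds one_pos)] with n hn
  rw [norm_pow, norm_norm]
  exact pow_le_of_le_one (norm_nonneg _) hn two_ne_zero

theorem summable_rpow_mul_blockNorm_sq (hq : 1 < q) {β : ℝ}
    (h : (β : EReal) < lowerRate a lam q) :
    Summable fun k => (q ^ (k + 1)) ^ (2 * β) * blockNorm a lam q k ^ 2 := by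
  obtain ⟨c, hβc, hc⟩ := EReal.lt_iff_exists_real_btwn.1 h
  rw [EReal.coe_lt_coe_iff] at hβc
  have hq0 : 0 < q := by linarith
  refine Summable.of_norm_bounded_eventually_nat
    (g := fun k => q ^ (2 * β) * (q ^ (-(2 * (c - β)))) ^ k)
    ((summable_geometric_of_lt_one (by positivity)
      (Real.rpow_lt_one_of_one_lt_of_neg hq (by linarith))).mul_left _) ?_
  filter_upwards [eventually_blockNorm_le hq hc] with k hk
  rw [Real.norm_of_nonneg (by positivity)]
  have := blockNorm_nonneg a lam q k
  calc (q ^ (k + 1)) ^ (2 * β) * blockNorm a lam q k ^ 2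
      ≤ (q ^ (k + 1)) ^ (2 * β) * (q ^ (-(c * k))) ^ 2 := by gcongr
    _ = q ^ (2 * β) * (q ^ (-(2 * (c - β)))) ^ k := by
        rw [← Real.rpow_natCast q (k + 1), ← Real.rpow_mul hq0.le, ← Real.rpow_mul_natCast hq0.le,
          ← Real.rpow_mul_natCast hq0.le, ← Real.rpow_add hq0, ← Real.rpow_add hq0]
        congr 1
        push_cast
        ring

theorem tsum_block_norm_sq_mul_rpow_le (ha : Summable fun n => ‖a n‖) (hlam : ∀ n, 1 ≤ lam n)
    {β : ℝ} (hβ : 0 ≤ β) (k : ℕ) :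
    ∑' n : {n : ℕ // q ^ k ≤ lam n ∧ lam n < q ^ (k + 1)},
        ENNReal.ofReal (‖a n‖ ^ 2 * lam n ^ (2 * β)) ≤
      ENNReal.ofReal ((q ^ (k + 1)) ^ (2 * β) * blockNorm a lam q k ^ 2) := by
  rw [blockNorm_sq, ← tsum_mul_left]
  by_cases hne : Nonempty {n : ℕ // q ^ k ≤ lam n ∧ lam n < q ^ (k + 1)}
  · obtain ⟨m, hm⟩ := hne
    have hq : 0 ≤ q ^ (k + 1) := (zero_le_one.trans (hlam m)).trans hm.2.le
    have hsum : Summable fun n : {n : ℕ // q ^ k ≤ lam n ∧ lam n < q ^ (k + 1)} =>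
        (q ^ (k + 1)) ^ (2 * β) * ‖a n‖ ^ 2 := ((summable_norm_sq ha).subtype _).mul_left _
    rw [ENNReal.ofReal_tsum_of_nonneg (fun _ => by positivity) hsum]
    refine ENNReal.tsum_le_tsum fun n => ENNReal.ofReal_le_ofReal ?_
    rw [mul_comm]
    have := zero_le_one.trans (hlam n)
    gcongr
    exact n.2.2.le
  · rw [not_nonempty_iff] at hne
    simp

theorem summable_norm_sq_mul_rpow (ha : Summable fun n => ‖a n‖) (hlam : ∀ n, 1 ≤ lam n)
    (hq : 1 < q) {β : ℝ} (hβ : 0 ≤ β) (h : (β : EReal) < lowerRate a lam q) :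
    Summable fun n => ‖a n‖ ^ 2 * lam n ^ (2 * β) := by
  let B (k : ℕ) : Set ℕ := {n | q ^ k ≤ lam n ∧ lam n < q ^ (k + 1)}
  have hB : ⋃ k, B k = Set.univ := Set.eq_univ_of_forall fun n =>
    Set.mem_iUnion.2 (exists_nat_pow_near (hlam n) hq)
  have hfinite : ∑' n, ENNReal.ofReal (‖a n‖ ^ 2 * lam n ^ (2 * β)) ≠ ∞ := by
    rw [← tsum_univ, ← hB]
    refine ne_top_of_le_ne_top (summable_rpow_mul_blockNorm_sq hq h).tsum_ofReal_ne_top ?_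
    exact (ENNReal.tsum_iUnion_le_tsum (fun n => ENNReal.ofReal (‖a n‖ ^ 2 * lam n ^ (2 * β)))
      B).trans (ENNReal.tsum_le_tsum (tsum_block_norm_sq_mul_rpow_le ha hlam hβ))
  refine (ENNReal.summable_toReal hfinite).congr fun n => ENNReal.toReal_ofReal ?_
  have := zero_le_one.trans (hlam n)
  positivity

end Rates

section Increments

variable {a : ℕ → ℂ} {lam : ℕ → ℝ} {φ : ℕ → ℝ → ℂ}

theorem exists_norm_sub_le_rpow (hφb : UniformlyBounded φ) (hφ : LocallyUniformlyBiLipschitz φ) :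
    ∃ K : ℝ, 0 < K ∧ ∀ β : ℝ, 0 ≤ β → β ≤ 1 → ∀ n u v, ‖φ n u - φ n v‖ ≤ K * |u - v| ^ β := by
  obtain ⟨C, hC⟩ := hφb
  obtain ⟨L, δ, hL, hδ, h⟩ := hφ
  have hC0 : 0 ≤ C := (norm_nonneg _).trans (hC 0 0)
  set m := min δ 1
  have hm0 : 0 < m := lt_min hδ one_pos
  refine ⟨max L (2 * C / m), lt_max_of_lt_left (by linarith), fun β hβ0 hβ1 n u v => ?_⟩
  rcases le_or_gt |u - v| m with hle | hgt
  · calc ‖φ n u - φ n v‖ ≤ L * |u - v| := (h n u v (hle.trans (min_le_left _ _))).2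
      _ ≤ L * |u - v| ^ β := by
        gcongr
        exact Real.self_le_rpow_of_le_one (abs_nonneg _) (hle.trans (min_le_right _ _)) hβ1
      _ ≤ _ := by gcongr; exact le_max_left _ _
  · calc ‖φ n u - φ n v‖ ≤ ‖φ n u‖ + ‖φ n v‖ := norm_sub_le _ _
      _ ≤ 2 * C := by linarith [hC n u, hC n v]
      _ = 2 * C / m * m := by field_simp
      _ ≤ 2 * C / m * |u - v| ^ β := by
        gcongr
        exact (Real.self_le_rpow_of_le_one hm0.le (min_le_right _ _) hβ1).trans (by gcongr)
      _ ≤ _ := by gcongr; exact le_max_right _ _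

theorem continuous_of_locallyUniformlyBiLipschitz (hφ : LocallyUniformlyBiLipschitz φ) (n : ℕ) :
    Continuous (φ n) := by
  obtain ⟨L, δ, _, hδ, h⟩ := hφ
  refine continuous_iff_continuousAt.2 fun x =>
    continuousAt_of_locally_lipschitz hδ L fun y hy => ?_
  rw [Real.dist_eq] at hy ⊢
  rw [dist_eq_norm]
  exact (h n y x hy.le).2

theorem phaseSeries_eq_steinhausSum {Ω : Type*} (θ : ℕ → Ω → ℝ) (ω : Ω) (x : ℝ) :
    phaseSeries a lam φ (fun n => θ n ω) x =
      steinhausSum (fun n => a n * φ n (lam n * x)) θ ω := by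
  rw [phaseSeries, steinhausSum]
  exact tsum_congr fun n => mul_right_comm _ _ _

theorem summable_norm_coeff (hφb : UniformlyBounded φ) (ha : Summable fun n => ‖a n‖) (x : ℝ) :
    Summable fun n => ‖a n * φ n (lam n * x)‖ := by
  obtain ⟨C, hC⟩ := hφb
  refine Summable.of_nonneg_of_le (fun _ => norm_nonneg _) (fun n => ?_) (ha.mul_right C)
  rw [norm_mul]
  gcongr
  exact hC n _

theorem summable_norm_increment (hφb : UniformlyBounded φ) (ha : Summable fun n => ‖a n‖)
    (x y : ℝ) : Summable fun n => ‖a n * (φ n (lam n * x) - φ n (lam n * y))‖ := by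
  refine Summable.of_nonneg_of_le (fun _ => norm_nonneg _) (fun n => ?_)
    ((summable_norm_coeff (lam := lam) hφb ha x).add (summable_norm_coeff (lam := lam) hφb ha y))
  rw [mul_sub]
  exact norm_sub_le _ _

theorem phaseSeries_sub {Ω : Type*} (hφb : UniformlyBounded φ) (ha : Summable fun n => ‖a n‖)
    (θ : ℕ → Ω → ℝ) (ω : Ω) (x y : ℝ) :
    phaseSeries a lam φ (fun n => θ n ω) x - phaseSeries a lam φ (fun n => θ n ω) y =
      steinhausSum (fun n => a n * (φ n (lam n * x) - φ n (lam n * y))) θ ω := by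
  simp only [phaseSeries_eq_steinhausSum, steinhausSum]
  rw [← (summable_mul_phase (summable_norm_coeff hφb ha x) _).tsum_sub
    (summable_mul_phase (summable_norm_coeff hφb ha y) _)]
  exact tsum_congr fun n => by ring

theorem continuous_phaseSeries (hφb : UniformlyBounded φ) (hφ : LocallyUniformlyBiLipschitz φ)
    (ha : Summable fun n => ‖a n‖) (t : ℕ → ℝ) : Continuous (phaseSeries a lam φ t) := by
  obtain ⟨C, hC⟩ := hφb
  refine continuous_tsum (u := fun n => ‖a n‖ * C) (fun n => ?_) (ha.mul_right C) fun n x => ?_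
  · have := continuous_of_locallyUniformlyBiLipschitz hφ n
    fun_prop
  · rw [norm_mul]
    change ‖a n * phase (t n)‖ * _ ≤ _
    rw [norm_mul_phase]
    gcongr
    exact hC n _

theorem locallyHolder_zero_of_continuous {E : Type*} [SeminormedAddCommGroup E] {f : ℝ → E}
    (hf : Continuous f) : LocallyHolder 0 f := by
  intro N
  obtain ⟨C, hC⟩ := (isCompact_Icc (a := (-N : ℝ)) (b := N)).exists_bound_of_continuousOn
    hf.continuousOn
  have hC0 : 0 ≤ C := (norm_nonneg _).trans (hC 0 (by simp))
  refine ⟨C + C, by positivity, fun x hx y hy => ?_⟩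
  rw [Real.rpow_zero, mul_one]
  exact norm_sub_le_of_le (hC x hx) (hC y hy)

theorem exists_sum_norm_increment_sq_le (hφb : UniformlyBounded φ)
    (hφ : LocallyUniformlyBiLipschitz φ) (hlam : ∀ n, 0 ≤ lam n) {γ : ℝ} (hγ0 : 0 ≤ γ)
    (hγ1 : γ ≤ 1) (hsum : Summable fun n => ‖a n‖ ^ 2 * lam n ^ (2 * γ)) :
    ∃ D : ℝ, 0 < D ∧ ∀ (x y : ℝ) (N : ℕ),
      ∑ n ∈ Finset.range N, ‖a n * (φ n (lam n * x) - φ n (lam n * y))‖ ^ 2 ≤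
        (D * |x - y| ^ γ) ^ 2 := by
  obtain ⟨K, hK, hbound⟩ := exists_norm_sub_le_rpow hφb hφ
  have hterm0 (n : ℕ) : 0 ≤ ‖a n‖ ^ 2 * lam n ^ (2 * γ) := by
    have := hlam n
    positivity
  set B := ∑' n, ‖a n‖ ^ 2 * lam n ^ (2 * γ)
  have hB0 : 0 ≤ B := tsum_nonneg hterm0
  refine ⟨K * Real.sqrt (B + 1), by positivity, fun x y N => ?_⟩
  have hterm (n : ℕ) : ‖a n * (φ n (lam n * x) - φ n (lam n * y))‖ ^ 2 ≤
      (K * |x - y| ^ γ) ^ 2 * (‖a n‖ ^ 2 * lam n ^ (2 * γ)) := by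
    have h := hbound γ hγ0 hγ1 n (lam n * x) (lam n * y)
    rw [← mul_sub, abs_mul, abs_of_nonneg (hlam n), Real.mul_rpow (hlam n) (abs_nonneg _)] at h
    rw [norm_mul, mul_pow]
    calc ‖a n‖ ^ 2 * ‖φ n (lam n * x) - φ n (lam n * y)‖ ^ 2
        ≤ ‖a n‖ ^ 2 * (K * (lam n ^ γ * |x - y| ^ γ)) ^ 2 := by gcongr
      _ = _ := by
        rw [mul_comm 2 γ, Real.rpow_mul (hlam n), Real.rpow_two]
        ring
  calc _ ≤ ∑ n ∈ Finset.range N, (K * |x - y| ^ γ) ^ 2 * (‖a n‖ ^ 2 * lam n ^ (2 * γ)) :=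
        Finset.sum_le_sum fun n _ => hterm n
    _ ≤ (K * |x - y| ^ γ) ^ 2 * (B + 1) := by
        rw [← Finset.mul_sum]
        gcongr
        linarith [hsum.sum_le_tsum (Finset.range N) fun n _ => hterm0 n]
    _ = _ := by
        rw [mul_right_comm, mul_pow _ (Real.sqrt _), Real.sq_sqrt (by positivity)]

theorem ae_locallyHolder_phaseSeries {Ω : Type*} [MeasurableSpace Ω] {P : Measure Ω}
    [IsProbabilityMeasure P] {θ : ℕ → Ω → ℝ} (hθ : IsIIDUniform P θ)
    (hφb : UniformlyBounded φ) (hφ : LocallyUniformlyBiLipschitz φ)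
    (ha : Summable fun n => ‖a n‖) (hlam : ∀ n, 1 ≤ lam n) {q : ℝ} (hq : 1 < q) {β : ℝ}
    (hβ0 : 0 < β) (hβ1 : β < 1) (h : (β : EReal) < lowerRate a lam q) :
    ∀ᵐ ω ∂P, LocallyHolder β (phaseSeries a lam φ fun n => θ n ω) := by
  obtain ⟨γ, hβγ, hγ1, hγ⟩ : ∃ γ : ℝ, β < γ ∧ γ ≤ 1 ∧ (γ : EReal) < lowerRate a lam q := by
    obtain ⟨γ, h1, h2⟩ := EReal.lt_iff_exists_real_btwn.1 h
    refine ⟨min γ 1, lt_min (by exact_mod_cast h1) hβ1, min_le_right _ _, lt_of_le_of_lt ?_ h2⟩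
    exact_mod_cast min_le_left _ _
  have hγ0 : 0 ≤ γ := by linarith
  obtain ⟨D, hD0, hD⟩ := exists_sum_norm_increment_sq_le hφb hφ
    (fun n => zero_le_one.trans (hlam n)) hγ0 hγ1 (summable_norm_sq_mul_rpow ha hlam hq hγ0 hγ)
  obtain ⟨p, hp⟩ := exists_nat_gt (1 / (γ - β))
  rw [div_lt_iff₀ (by linarith)] at hp
  refine ae_locallyHolder_of_measure_le (β := γ) (p := 2 * p)
    (C := (4 * p.factorial * 8 ^ p * D ^ (2 * p)).toNNReal)
    (fun ω => continuous_phaseSeries hφb hφ ha fun n => θ n ω) hβ0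
    (by push_cast; linarith) fun x y ε hxy hε => ?_
  have : 0 < |x - y| := abs_pos.2 (sub_ne_zero.2 hxy)
  simp only [phaseSeries_sub hφb ha]
  refine (measure_le_norm_steinhausSum_le hθ (summable_norm_increment hφb ha x y)
    (by positivity) (hD x y) p hε).trans_eq ?_
  rw [mul_div_assoc, ENNReal.ofReal_mul hD0.le, mul_pow, ← mul_assoc,
    ← ENNReal.ofReal_pow hD0.le, ← ENNReal.ofReal_mul (by positivity), ENNReal.ofReal]

end Increments

/-! ### The Bessel function `J₀` -/

section BesselDecay

/-- The Bessel function `J₀`, written as the characteristic function of `cos (2 π θ)` for `θ`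
uniform on `[0, 1]`. -/
noncomputable def besselJ (u : ℝ) : ℝ :=
  ∫ t in (0 : ℝ)..1, Real.cos (u * Real.cos (2 * Real.pi * t))

theorem intervalIntegrable_cos_mul_cos (u a b : ℝ) :
    IntervalIntegrable (fun t : ℝ => Real.cos (u * Real.cos (2 * Real.pi * t))) volume a b :=
  Continuous.intervalIntegrable (by fun_prop) a b

theorem abs_integral_cos_mul_cos_le_abs_sub (u a b : ℝ) :
    |∫ t in a..b, Real.cos (u * Real.cos (2 * Real.pi * t))| ≤ |b - a| := by
  rw [← Real.norm_eq_abs, ← one_mul |b - a|]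
  exact intervalIntegral.norm_integral_le_of_norm_le_const fun t _ => Real.abs_cos_le_one _

theorem abs_besselJ_le_one (u : ℝ) : |besselJ u| ≤ 1 := by
  simpa [besselJ] using abs_integral_cos_mul_cos_le_abs_sub u 0 1

theorem four_mul_le_sin {t : ℝ} (h0 : 0 ≤ t) (h1 : t ≤ 1 / 4) :
    4 * t ≤ Real.sin (2 * Real.pi * t) := by
  have h := Real.mul_le_sin (x := 2 * Real.pi * t) (by positivity) (by nlinarith [Real.pi_pos])
  have e : 2 / Real.pi * (2 * Real.pi * t) = 4 * t := by
    field_simp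
    ring
  linarith

theorem four_mul_le_sin_of_mem_Icc {t ε : ℝ} (hε : 0 ≤ ε) (ht : t ∈ Set.Icc ε (1 / 2 - ε)) :
    4 * ε ≤ Real.sin (2 * Real.pi * t) := by
  obtain ⟨h0, h1⟩ := ht
  rcases le_total t (1 / 4) with h | h
  · linarith [four_mul_le_sin (hε.trans h0) h]
  · have hsymm := four_mul_le_sin (t := 1 / 2 - t) (by linarith) (by linarith)
    rw [show 2 * Real.pi * (1 / 2 - t) = Real.pi - 2 * Real.pi * t by ring,
      Real.sin_pi_sub] at hsymm
    linarith

theorem abs_integral_mul_deriv_le {F F' G G' : ℝ → ℝ} {a b A B M : ℝ} (hab : a ≤ b)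
    (hF : ∀ t ∈ Set.Icc a b, HasDerivAt F (F' t) t) (hG : ∀ t ∈ Set.Icc a b, HasDerivAt G (G' t) t)
    (hF' : ContinuousOn F' (Set.Icc a b)) (hG' : ContinuousOn G' (Set.Icc a b))
    (hA : ∀ t ∈ Set.Icc a b, |F t| ≤ A) (hB : ∀ t ∈ Set.Icc a b, |F' t| ≤ B)
    (hM : ∀ t ∈ Set.Icc a b, |G t| ≤ M) :
    |∫ t in a..b, F t * G' t| ≤ (2 * A + B * (b - a)) * M := by
  have ha : a ∈ Set.Icc a b := ⟨le_rfl, hab⟩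
  have hb : b ∈ Set.Icc a b := ⟨hab, le_rfl⟩
  have hA0 : 0 ≤ A := (abs_nonneg _).trans (hA a ha)
  have hB0 : 0 ≤ B := (abs_nonneg _).trans (hB a ha)
  have hboundary : ∀ t ∈ Set.Icc a b, |F t * G t| ≤ A * M := fun t ht => by
    rw [abs_mul]
    exact mul_le_mul (hA t ht) (hM t ht) (abs_nonneg _) hA0
  have hintegral : |∫ t in a..b, F' t * G t| ≤ B * M * (b - a) := by
    rw [← Real.norm_eq_abs, ← abs_of_nonneg (sub_nonneg.2 hab)]
    refine intervalIntegral.norm_integral_le_of_norm_le_const fun t ht => ?_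
    have ht' : t ∈ Set.Icc a b := Set.Ioc_subset_Icc_self (Set.uIoc_of_le hab ▸ ht)
    rw [Real.norm_eq_abs, abs_mul]
    exact mul_le_mul (hB t ht') (hM t ht') (abs_nonneg _) hB0
  rw [← Set.uIcc_of_le hab] at hF hG hF' hG'
  rw [intervalIntegral.integral_mul_deriv_eq_deriv_mul hF hG hF'.intervalIntegrable
    hG'.intervalIntegrable]
  calc |F b * G b - F a * G a - ∫ t in a..b, F' t * G t|
      ≤ |F b * G b| + |F a * G a| + |∫ t in a..b, F' t * G t| :=
        (abs_sub _ _).trans (by gcongr; exact abs_sub _ _)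
    _ ≤ A * M + A * M + B * M * (b - a) :=
        add_le_add (add_le_add (hboundary b hb) (hboundary a ha)) hintegral
    _ = (2 * A + B * (b - a)) * M := by ring

theorem hasDerivAt_sin_two_pi_mul (t : ℝ) :
    HasDerivAt (fun t : ℝ => Real.sin (2 * Real.pi * t))
      (Real.cos (2 * Real.pi * t) * (2 * Real.pi)) t := by
  simpa using ((hasDerivAt_id t).const_mul (2 * Real.pi)).sin

theorem hasDerivAt_sin_mul_cos_div {u : ℝ} (hu : u ≠ 0) (t : ℝ) :
    HasDerivAt (fun t => -Real.sin (u * Real.cos (2 * Real.pi * t)) / (2 * Real.pi * u))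
      (Real.cos (u * Real.cos (2 * Real.pi * t)) * Real.sin (2 * Real.pi * t)) t := by
  have h := ((((hasDerivAt_id t).const_mul (2 * Real.pi)).cos.const_mul u).sin.neg).div_const
    (2 * Real.pi * u)
  convert! h using 1
  simp only [id]
  field_simp

theorem abs_integral_cos_mul_cos_le {u ε : ℝ} (hu : 0 < u) (hε : 0 < ε) (hε1 : ε ≤ 1 / 4) :
    |∫ t in ε..(1 / 2 - ε), Real.cos (u * Real.cos (2 * Real.pi * t))| ≤ 1 / (u * ε ^ 2) := by
  have hpi := Real.pi_pos
  have hle : ε ≤ 1 / 2 - ε := by linarith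
  have hsin : ∀ t ∈ Set.Icc ε (1 / 2 - ε), 4 * ε ≤ Real.sin (2 * Real.pi * t) :=
    fun t => four_mul_le_sin_of_mem_Icc hε.le
  have hsin0 : ∀ t ∈ Set.Icc ε (1 / 2 - ε), 0 < Real.sin (2 * Real.pi * t) := fun t ht =>
    (by positivity : 0 < 4 * ε).trans_le (hsin t ht)
  have hparts := abs_integral_mul_deriv_le hle
    (fun t ht => (hasDerivAt_sin_two_pi_mul t).fun_inv (hsin0 t ht).ne')
    (fun t _ => hasDerivAt_sin_mul_cos_div hu.ne' t)
    (ContinuousOn.div (by fun_prop) (by fun_prop) fun t ht => pow_ne_zero 2 (hsin0 t ht).ne')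
    (by fun_prop) (A := (4 * ε)⁻¹) (B := 2 * Real.pi / (4 * ε) ^ 2) (M := 1 / (2 * Real.pi * u))
    (fun t ht => ?_) (fun t ht => ?_) (fun t _ => ?_)
  · calc |∫ t in ε..(1 / 2 - ε), Real.cos (u * Real.cos (2 * Real.pi * t))|
        = |∫ t in ε..(1 / 2 - ε), (Real.sin (2 * Real.pi * t))⁻¹ *
            (Real.cos (u * Real.cos (2 * Real.pi * t)) * Real.sin (2 * Real.pi * t))| := by
          refine congrArg _ (intervalIntegral.integral_congr fun t ht => ?_)
          have := (hsin0 t (Set.uIcc_of_le hle ▸ ht)).ne'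
          field_simp
      _ ≤ (2 * (4 * ε)⁻¹ + 2 * Real.pi / (4 * ε) ^ 2 * (1 / 2 - ε - ε)) *
            (1 / (2 * Real.pi * u)) := hparts
      _ ≤ (2 * Real.pi * ((16 * (4 * ε)⁻¹) * (4 * ε)⁻¹)) * (1 / (2 * Real.pi * u)) := by
          have hinv : 1 ≤ (4 * ε)⁻¹ := (one_le_inv₀ (by positivity)).2 (by linarith)
          have hlen : 2 * Real.pi / (4 * ε) ^ 2 * (1 / 2 - ε - ε) ≤ 2 * Real.pi / (4 * ε) ^ 2 :=
            mul_le_of_le_one_right (by positivity) (by linarith)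
          have hsq : 2 * Real.pi / (4 * ε) ^ 2 = 2 * Real.pi * ((4 * ε)⁻¹ * (4 * ε)⁻¹) := by
            field_simp
          gcongr
          nlinarith [Real.pi_gt_three, mul_le_mul hinv hinv zero_le_one (by positivity)]
      _ = 1 / (u * ε ^ 2) := by
          field_simp
          norm_num
  · rw [abs_inv, abs_of_pos (hsin0 t ht)]
    exact inv_anti₀ (by positivity) (hsin t ht)
  · rw [abs_div, abs_neg, abs_mul, abs_of_pos Real.two_pi_pos,
      abs_of_pos (pow_pos (hsin0 t ht) 2)]
    exact div_le_div₀ (by positivity)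
      (mul_le_of_le_one_left (by positivity) (Real.abs_cos_le_one _)) (by positivity)
      (pow_le_pow_left₀ (by positivity) (hsin t ht) 2)
  · rw [abs_div, abs_neg, abs_of_pos (by positivity : 0 < 2 * Real.pi * u)]
    gcongr
    exact Real.abs_sin_le_one _

theorem besselJ_eq_two_mul (u : ℝ) :
    besselJ u = 2 * ∫ t in (0 : ℝ)..(1 / 2), Real.cos (u * Real.cos (2 * Real.pi * t)) := by
  have hreflect : ∀ t : ℝ, Real.cos (2 * Real.pi * (1 - t)) = Real.cos (2 * Real.pi * t) := by
    intro t
    rw [mul_sub, mul_one, Real.cos_two_pi_sub]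
  have hhalf : ∫ t in (1 / 2 : ℝ)..1, Real.cos (u * Real.cos (2 * Real.pi * t)) =
      ∫ t in (0 : ℝ)..(1 / 2), Real.cos (u * Real.cos (2 * Real.pi * t)) := by
    have h := intervalIntegral.integral_comp_sub_left
      (fun t : ℝ => Real.cos (u * Real.cos (2 * Real.pi * t))) (a := 0) (b := 1 / 2) 1
    simp only [hreflect] at h
    rw [h]
    norm_num
  rw [besselJ, ← intervalIntegral.integral_add_adjacent_intervals
    (intervalIntegrable_cos_mul_cos u 0 (1 / 2)) (intervalIntegrable_cos_mul_cos u (1 / 2) 1),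
    hhalf, ← two_mul]

theorem abs_besselJ_le {u ε : ℝ} (hu : 0 < u) (hε : 0 < ε) (hε1 : ε ≤ 1 / 4) :
    |besselJ u| ≤ 4 * ε + 2 / (u * ε ^ 2) := by
  have hleft := abs_integral_cos_mul_cos_le_abs_sub u 0 ε
  have hmid := abs_integral_cos_mul_cos_le hu hε hε1
  have hright := abs_integral_cos_mul_cos_le_abs_sub u (1 / 2 - ε) (1 / 2)
  rw [sub_zero, abs_of_pos hε] at hleft
  rw [sub_sub_cancel, abs_of_pos hε] at hright
  rw [besselJ_eq_two_mul, abs_mul, abs_two,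
    ← intervalIntegral.integral_add_adjacent_intervals
      (intervalIntegrable_cos_mul_cos u 0 (1 / 2 - ε)) (intervalIntegrable_cos_mul_cos u _ _),
    ← intervalIntegral.integral_add_adjacent_intervals
      (intervalIntegrable_cos_mul_cos u 0 ε) (intervalIntegrable_cos_mul_cos u _ _)]
  calc _ ≤ 2 * (ε + 1 / (u * ε ^ 2) + ε) := by
        gcongr
        exact (abs_add_three _ _ _).trans (add_le_add (add_le_add hleft hmid) hright)
    _ = 4 * ε + 2 / (u * ε ^ 2) := by ring

theorem abs_besselJ_pow_three_mul_le {u : ℝ} (hu : 64 ≤ u) : |besselJ u| ^ 3 * u ≤ 216 := by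
  have hu0 : 0 < u := by linarith
  obtain ⟨v, hv0, rfl⟩ : ∃ v : ℝ, 0 < v ∧ v ^ 3 = u :=
    ⟨u ^ (1 / 3 : ℝ), by positivity, by rw [← Real.rpow_mul_natCast hu0.le]; norm_num⟩
  have hv4 : 4 ≤ v := le_of_pow_le_pow_left₀ three_ne_zero hv0.le (by linarith)
  have h := abs_besselJ_le hu0 (ε := 1 / v) (by positivity)
    (one_div_le_one_div_of_le (by norm_num) hv4)
  have hdecay : |besselJ (v ^ 3)| * v ≤ 6 := by
    rw [← le_div_iff₀ hv0]
    refine h.trans (le_of_eq ?_)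
    field_simp
    norm_num
  calc |besselJ (v ^ 3)| ^ 3 * v ^ 3 = (|besselJ (v ^ 3)| * v) ^ 3 := (mul_pow _ _ _).symm
    _ ≤ 6 ^ 3 := pow_le_pow_left₀ (by positivity) hdecay 3
    _ = 216 := by norm_num

theorem abs_besselJ_le_half {u : ℝ} (hu : 1728 ≤ u) : |besselJ u| ≤ 1 / 2 := by
  by_contra! h
  have h3 : (1 / 2) ^ 3 < |besselJ u| ^ 3 := pow_lt_pow_left₀ h (by norm_num) three_ne_zero
  nlinarith [abs_besselJ_pow_three_mul_le (show 64 ≤ u by linarith)]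

theorem two_mul_besselJ_sq_sub_one_le (u : ℝ) : 2 * besselJ u ^ 2 - 1 ≤ besselJ (2 * u) := by
  set f : ℝ → ℝ := fun t => Real.cos (u * Real.cos (2 * Real.pi * t))
  have hf : Continuous f := by fun_prop
  have hJ : ∫ t in (0 : ℝ)..1, f t = besselJ u := rfl
  have hsq : besselJ u ^ 2 ≤ ∫ t in (0 : ℝ)..1, f t ^ 2 := by
    have hvar : 0 ≤ ∫ t in (0 : ℝ)..1, (f t ^ 2 - 2 * besselJ u * f t + besselJ u ^ 2) :=
      intervalIntegral.integral_nonneg zero_le_one fun t _ => by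
        nlinarith [sq_nonneg (f t - besselJ u)]
    rw [intervalIntegral.integral_add (Continuous.intervalIntegrable (by fun_prop) _ _) (by simp),
      intervalIntegral.integral_sub (Continuous.intervalIntegrable (by fun_prop) _ _)
        (Continuous.intervalIntegrable (by fun_prop) _ _),
      intervalIntegral.integral_const_mul, hJ, intervalIntegral.integral_const] at hvar
    simp only [sub_zero, one_smul] at hvar
    linarith
  have hdouble : besselJ (2 * u) = 2 * (∫ t in (0 : ℝ)..1, f t ^ 2) - 1 := by
    have hcos : ∀ t, Real.cos (2 * u * Real.cos (2 * Real.pi * t)) = 2 * f t ^ 2 - 1 := fun t => by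
      rw [mul_assoc, Real.cos_two_mul]
    simp only [besselJ, hcos]
    rw [intervalIntegral.integral_sub (Continuous.intervalIntegrable (by fun_prop) _ _) (by simp),
      intervalIntegral.integral_const_mul]
    simp
  linarith

theorem one_sub_besselJ_two_pow_mul_le (u : ℝ) (k : ℕ) :
    1 - besselJ (2 ^ k * u) ≤ 4 ^ k * (1 - besselJ u) := by
  induction k with
  | zero => simp
  | succ k ih =>
    have hdouble := two_mul_besselJ_sq_sub_one_le (2 ^ k * u)
    rw [← mul_assoc, ← pow_succ'] at hdouble
    have h1 := (abs_le.1 (abs_besselJ_le_one (2 ^ k * u))).2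
    rw [pow_succ 4]
    nlinarith

/-- Doubling carries the bound `J₀ ≤ 1 / 2` far from the origin down to a quadratic one near it. -/
theorem sq_le_one_sub_besselJ {u U : ℝ} (hu : 0 ≤ u) (hU : 1728 ≤ U) (huU : u ≤ U) :
    u ^ 2 / (8 * U ^ 2) ≤ 1 - besselJ u := by
  rcases hu.eq_or_lt with rfl | hu
  · simpa using (abs_le.1 (abs_besselJ_le_one 0)).2
  have : 0 < U := by linarith
  obtain ⟨k, hk, hk'⟩ := exists_nat_pow_near ((one_le_div hu).2 huU) one_lt_two
  rw [le_div_iff₀ hu] at hk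
  rw [div_lt_iff₀ hu] at hk'
  have hfar : 1 / 2 ≤ 1 - besselJ (2 ^ (k + 1) * u) := by
    linarith [(abs_le.1 (abs_besselJ_le_half (hU.trans hk'.le))).2]
  have hiter := hfar.trans (one_sub_besselJ_two_pow_mul_le u (k + 1))
  have hpow : (4 : ℝ) ^ (k + 1) * u ^ 2 ≤ 4 * U ^ 2 := by
    calc (4 : ℝ) ^ (k + 1) * u ^ 2 = 4 * (2 ^ k * u) ^ 2 := by
          rw [mul_pow, ← pow_mul, mul_comm k 2, pow_mul]
          ring
      _ ≤ 4 * U ^ 2 := by gcongr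
  rw [div_le_iff₀ (by positivity)]
  have hnonneg : 0 ≤ 1 - besselJ u := sub_nonneg.2 (abs_le.1 (abs_besselJ_le_one u)).2
  linarith [mul_le_mul_of_nonneg_right hpow hnonneg,
    mul_le_mul_of_nonneg_right hiter (sq_nonneg u)]

theorem exists_besselJ_pow_six_mul_le :
    ∃ c : ℝ, 0 < c ∧ ∀ u, 0 ≤ u → besselJ u ^ 6 * (1 + c * u ^ 2) ≤ 1 := by
  refine ⟨1 / (4 * 3456 ^ 2), by norm_num, fun u hu => ?_⟩
  have hsq1 : besselJ u ^ 2 ≤ 1 := (sq_le_one_iff_abs_le_one _).2 (abs_besselJ_le_one u)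
  rcases le_total u 1728 with hle | hge
  · have hsq : besselJ u ^ 2 ≤ 1 - 1 / (4 * 3456 ^ 2) * u ^ 2 := by
      have hquad := sq_le_one_sub_besselJ (u := 2 * u) (U := 3456) (by positivity) (by norm_num)
        (by linarith)
      linarith [two_mul_besselJ_sq_sub_one_le u]
    calc besselJ u ^ 6 * (1 + 1 / (4 * 3456 ^ 2) * u ^ 2)
        ≤ besselJ u ^ 2 * (1 + 1 / (4 * 3456 ^ 2) * u ^ 2) := by
          gcongr ?_ * _
          nlinarith [sq_nonneg (besselJ u), sq_nonneg (besselJ u ^ 2)]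
      _ ≤ (1 - 1 / (4 * 3456 ^ 2) * u ^ 2) * (1 + 1 / (4 * 3456 ^ 2) * u ^ 2) := by gcongr
      _ ≤ 1 := by nlinarith [sq_nonneg (1 / (4 * 3456 ^ 2) * u ^ 2)]
  · have hcube := abs_besselJ_pow_three_mul_le (show 64 ≤ u by linarith)
    have hhalf : |besselJ u| ^ 6 ≤ (1 / 2) ^ 6 :=
      pow_le_pow_left₀ (abs_nonneg _) (abs_besselJ_le_half hge) 6
    calc besselJ u ^ 6 * (1 + 1 / (4 * 3456 ^ 2) * u ^ 2)
        = |besselJ u| ^ 6 + 1 / (4 * 3456 ^ 2) * (|besselJ u| ^ 3 * u) ^ 2 := by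
          rw [← Even.pow_abs (by decide : Even 6)]
          ring
      _ ≤ (1 / 2) ^ 6 + 1 / (4 * 3456 ^ 2) * 216 ^ 2 := by gcongr
      _ ≤ 1 := by norm_num

end BesselDecay

/-! ### Characteristic functions of Steinhaus sums -/

section SteinhausCharFun

theorem phase_re (t : ℝ) : (phase t).re = Real.cos (2 * Real.pi * t) := by
  rw [phase, show 2 * (Real.pi : ℂ) * Complex.I * t = ((2 * Real.pi * t : ℝ) : ℂ) * Complex.I by
    push_cast; ring, Complex.exp_ofReal_mul_I_re]

theorem exists_eq_norm_mul_phase (w : ℂ) : ∃ α : ℝ, ∀ t, w * phase t = ‖w‖ * phase (t + α) := by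
  refine ⟨w.arg / (2 * Real.pi), fun t => ?_⟩
  conv_lhs => rw [← Complex.norm_mul_exp_arg_mul_I w]
  rw [phase, phase, mul_assoc, ← Complex.exp_add]
  congr 2
  have : (Real.pi : ℂ) ≠ 0 := by exact_mod_cast Real.pi_ne_zero
  push_cast
  field_simp
  ring

theorem integral_sin_mul_cos (u : ℝ) :
    ∫ t in (0 : ℝ)..1, Real.sin (u * Real.cos (2 * Real.pi * t)) = 0 := by
  set f : ℝ → ℝ := fun t => Real.sin (u * Real.cos (2 * Real.pi * t))
  have hper : Function.Periodic f 1 := fun t => by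
    simp only [f, mul_add, mul_one, Real.cos_add_two_pi]
  have hanti : ∀ t, f (t + 1 / 2) = -f t := fun t => by
    simp only [f]
    rw [show 2 * Real.pi * (t + 1 / 2) = 2 * Real.pi * t + Real.pi by ring, Real.cos_add_pi,
      mul_neg, Real.sin_neg]
  have hneg : -∫ t in (0 : ℝ)..1, f t = ∫ t in (0 : ℝ)..1, f t := by
    calc -∫ t in (0 : ℝ)..1, f t = ∫ t in (0 : ℝ)..1, f (t + 1 / 2) := by
          simp only [hanti, intervalIntegral.integral_neg]
      _ = ∫ t in (1 / 2 : ℝ)..(1 / 2 + 1), f t := by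
          rw [intervalIntegral.integral_comp_add_right, zero_add, add_comm 1]
      _ = ∫ t in (0 : ℝ)..1, f t := by
          rw [hper.intervalIntegral_add_eq (1 / 2) 0, zero_add]
  linarith

theorem integral_exp_mul_cos (u : ℝ) :
    ∫ t in (0 : ℝ)..1, Complex.exp (((u * Real.cos (2 * Real.pi * t) : ℝ) : ℂ) * Complex.I) =
      besselJ u := by
  have hsplit : ∀ t : ℝ,
      Complex.exp (((u * Real.cos (2 * Real.pi * t) : ℝ) : ℂ) * Complex.I) =
      ((Real.cos (u * Real.cos (2 * Real.pi * t)) : ℝ) : ℂ) +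
        ((Real.sin (u * Real.cos (2 * Real.pi * t)) : ℝ) : ℂ) * Complex.I := by
    intro t
    rw [Complex.exp_mul_I, Complex.ofReal_cos, Complex.ofReal_sin]
  simp only [hsplit]
  rw [intervalIntegral.integral_add (Continuous.intervalIntegrable (by fun_prop) _ _)
      (Continuous.intervalIntegrable (by fun_prop) _ _),
    intervalIntegral.integral_mul_const, intervalIntegral.integral_ofReal,
    intervalIntegral.integral_ofReal, integral_sin_mul_cos, besselJ]
  simp

theorem integral_exp_re_mul_phase (w : ℂ) :
    ∫ t in Set.Icc (0 : ℝ) 1, Complex.exp (((w * phase t).re : ℂ) * Complex.I) = besselJ ‖w‖ := by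
  obtain ⟨α, hα⟩ := exists_eq_norm_mul_phase w
  set f : ℝ → ℂ := fun t =>
    Complex.exp (((‖w‖ * Real.cos (2 * Real.pi * t) : ℝ) : ℂ) * Complex.I)
  have hper : Function.Periodic f 1 := fun t => by
    simp only [f, mul_add, mul_one, Real.cos_add_two_pi]
  have hshift : ∀ t, Complex.exp (((w * phase t).re : ℂ) * Complex.I) = f (t + α) := fun t => by
    rw [hα, Complex.re_ofReal_mul, phase_re]
  simp only [hshift]
  rw [integral_Icc_eq_integral_Ioc, ← intervalIntegral.integral_of_le zero_le_one,
    intervalIntegral.integral_comp_add_right, zero_add, add_comm 1 α,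
    hper.intervalIntegral_add_eq α 0, zero_add]
  exact integral_exp_mul_cos ‖w‖

variable {Ω : Type*} [MeasurableSpace Ω] {P : Measure Ω}

theorem charFun_map_mul_phase {θ : Ω → ℝ} (hθ : Measurable θ)
    (hlaw : P.map θ = (volume : Measure ℝ).restrict (Set.Icc 0 1)) (c ξ : ℂ) :
    charFun (P.map fun ω => c * phase (θ ω)) ξ = besselJ (‖c‖ * ‖ξ‖) := by
  have hc : Measurable fun t => c * phase t := continuous_phase.measurable.const_mul c
  have hmap : (P.map fun ω => c * phase (θ ω)) =
      ((volume : Measure ℝ).restrict (Set.Icc 0 1)).map fun t => c * phase t := by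
    rw [← hlaw, Measure.map_map hc hθ]
    rfl
  have hinner : ∀ t, ⟪c * phase t, ξ⟫_ℝ = (starRingEnd ℂ ξ * c * phase t).re := by
    intro t
    rw [real_inner_comm, Complex.inner]
    congr 1
    ring
  rw [hmap, charFun_apply, integral_map hc.aemeasurable (by fun_prop)]
  simp only [hinner]
  rw [integral_exp_re_mul_phase, norm_mul, RCLike.norm_conj, mul_comm]

variable {θ : ℕ → Ω → ℝ}

theorem charFun_map_sum_mul_phase (hθ : IsIIDUniform P θ) (c : ℕ → ℂ) (s : Finset ℕ) (ξ : ℂ) :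
    charFun (P.map fun ω => ∑ n ∈ s, c n * phase (θ n ω)) ξ =
      ∏ n ∈ s, (besselJ (‖c n‖ * ‖ξ‖) : ℂ) := by
  obtain ⟨hm, hind, hlaw⟩ := hθ
  have hmeas : ∀ n, Measurable fun t => c n * phase t :=
    fun n => continuous_phase.measurable.const_mul (c n)
  rw [iIndepFun.charFun_map_fun_finsetSum_eq_prod (X := fun n ω => c n * phase (θ n ω))
    (fun n _ => ((hmeas n).comp (hm n)).aemeasurable)
    ((hind.comp (fun n t => c n * phase t) hmeas).restrict _), Finset.prod_apply]
  exact Finset.prod_congr rfl fun n _ => charFun_map_mul_phase (hm n) (hlaw n) (c n) ξ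

theorem tendsto_prod_besselJ [IsProbabilityMeasure P] (hθ : IsIIDUniform P θ) {c : ℕ → ℂ}
    (hc : Summable fun n => ‖c n‖) (ξ : ℂ) :
    Tendsto (fun N => ∏ n ∈ Finset.range N, (besselJ (‖c n‖ * ‖ξ‖) : ℂ)) atTop
      (𝓝 (charFun (P.map (steinhausSum c θ)) ξ)) := by
  have hmeas : ∀ N, Measurable fun ω => ∑ n ∈ Finset.range N, c n * phase (θ n ω) := fun N =>
    Finset.measurable_sum _ fun n _ =>
      (continuous_phase.measurable.comp (hθ.1 n)).const_mul (c n)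
  simp only [← charFun_map_sum_mul_phase hθ]
  simp only [charFun_apply]
  rw [integral_map (measurable_steinhausSum hc hθ.1).aemeasurable (by fun_prop)]
  simp_rw [integral_map (hmeas _).aemeasurable
    (Continuous.aestronglyMeasurable (by fun_prop :
      Continuous fun z : ℂ => Complex.exp ((⟪z, ξ⟫_ℝ : ℂ) * Complex.I)))]
  refine tendsto_integral_of_dominated_convergence (fun _ => 1)
    (fun N => ?_) (integrable_const _)
    (fun N => ae_of_all _ fun ω => (Complex.norm_exp_ofReal_mul_I _).le)
    (ae_of_all _ fun ω => ?_)
  · have := hmeas N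
    exact Measurable.aestronglyMeasurable (by fun_prop)
  · exact (Continuous.tendsto (by fun_prop :
      Continuous fun z : ℂ => Complex.exp ((⟪z, ξ⟫_ℝ : ℂ) * Complex.I)) _).comp
        (tendsto_sum_mul_phase hc θ ω)

theorem one_add_sum_le_prod {ι : Type*} (s : Finset ι) {f : ι → ℝ} (hf : ∀ i, 0 ≤ f i) :
    1 + ∑ i ∈ s, f i ≤ ∏ i ∈ s, (1 + f i) := by
  classical
  induction s using Finset.induction_on with
  | empty => simp
  | insert a s ha ih =>
    rw [Finset.sum_insert ha, Finset.prod_insert ha]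
    nlinarith [hf a, Finset.sum_nonneg fun i (_ : i ∈ s) => hf i]

theorem prod_le_prod_prod_of_pairwise_disjoint {ι κ : Type*} [Fintype κ] {x : ι → ℝ}
    (hx0 : ∀ n, 0 ≤ x n) (hx1 : ∀ n, x n ≤ 1) {F : κ → Finset ι} {s : Finset ι}
    (hF : Pairwise (Function.onFun Disjoint F)) (hFs : ∀ i, F i ⊆ s) :
    ∏ n ∈ s, x n ≤ ∏ i, ∏ n ∈ F i, x n := by
  classical
  rw [← Finset.prod_biUnion fun i _ j _ hij => hF hij,
    ← Finset.prod_sdiff (Finset.biUnion_subset.2 fun i _ => hFs i)]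
  exact mul_le_of_le_one_left (Finset.prod_nonneg fun n _ => hx0 n)
    (Finset.prod_le_one (fun n _ => hx0 n) fun n _ => hx1 n)

theorem prod_besselJ_pow_six_le {ι : Type*} {b : ℝ} (hb : 0 < b)
    (hJ : ∀ u, 0 ≤ u → besselJ u ^ 6 * (1 + b * u ^ 2) ≤ 1) (c : ι → ℂ) {F : Finset ι} {R ρ : ℝ}
    (hρ : 0 ≤ ρ) (hR : R ^ 2 ≤ ∑ n ∈ F, ‖c n‖ ^ 2) :
    ∏ n ∈ F, besselJ (‖c n‖ * ρ) ^ 6 ≤ (1 + b * R ^ 2 * ρ ^ 2)⁻¹ := by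
  have hsum : 1 + b * R ^ 2 * ρ ^ 2 ≤ ∏ n ∈ F, (1 + b * (‖c n‖ * ρ) ^ 2) := by
    refine le_trans ?_ (one_add_sum_le_prod _ fun n => by positivity)
    simp only [mul_pow, ← Finset.sum_mul, ← Finset.mul_sum]
    rw [← mul_assoc]
    gcongr
  rw [← one_div, le_div_iff₀ (by positivity)]
  calc (∏ n ∈ F, besselJ (‖c n‖ * ρ) ^ 6) * (1 + b * R ^ 2 * ρ ^ 2)
      ≤ (∏ n ∈ F, besselJ (‖c n‖ * ρ) ^ 6) * ∏ n ∈ F, (1 + b * (‖c n‖ * ρ) ^ 2) := by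
        gcongr
    _ = ∏ n ∈ F, besselJ (‖c n‖ * ρ) ^ 6 * (1 + b * (‖c n‖ * ρ) ^ 2) :=
        Finset.prod_mul_distrib.symm
    _ ≤ 1 := Finset.prod_le_one (fun n _ => by positivity) fun n _ => hJ _ (by positivity)

theorem prod_abs_besselJ_le {ι : Type*} {b : ℝ} (hb : 0 < b)
    (hJ : ∀ u, 0 ≤ u → besselJ u ^ 6 * (1 + b * u ^ 2) ≤ 1) (c : ι → ℂ) {F : Fin 12 → Finset ι}
    {s : Finset ι} {R ρ : ℝ} (hρ : 0 ≤ ρ) (hF : Pairwise (Function.onFun Disjoint F))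
    (hFs : ∀ i, F i ⊆ s) (hR : ∀ i, R ^ 2 ≤ ∑ n ∈ F i, ‖c n‖ ^ 2) :
    ∏ n ∈ s, |besselJ (‖c n‖ * ρ)| ≤ ((1 + b * R ^ 2 * ρ ^ 2) ^ 2)⁻¹ := by
  refine le_of_pow_le_pow_left₀ (n := 6) (by norm_num) (by positivity) ?_
  calc (∏ n ∈ s, |besselJ (‖c n‖ * ρ)|) ^ 6 = ∏ n ∈ s, besselJ (‖c n‖ * ρ) ^ 6 := by
        simp only [← Finset.prod_pow, Even.pow_abs (by decide : Even 6)]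
    _ ≤ ∏ i, ∏ n ∈ F i, besselJ (‖c n‖ * ρ) ^ 6 :=
        prod_le_prod_prod_of_pairwise_disjoint (fun n => by positivity) (fun n => by
          rw [← Even.pow_abs (by decide : Even 6)]
          exact pow_le_one₀ (abs_nonneg _) (abs_besselJ_le_one _)) hF hFs
    _ ≤ ∏ _i : Fin 12, (1 + b * R ^ 2 * ρ ^ 2)⁻¹ :=
        Finset.prod_le_prod (fun i _ => Finset.prod_nonneg fun n _ => by positivity) fun i _ =>
          prod_besselJ_pow_six_le hb hJ c hρ (hR i)
    _ = ((1 + b * R ^ 2 * ρ ^ 2) ^ 2)⁻¹ ^ 6 := by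
        simp [← pow_mul]

theorem norm_charFun_map_steinhausSum_le [IsProbabilityMeasure P] (hθ : IsIIDUniform P θ)
    {b : ℝ} (hb : 0 < b) (hJ : ∀ u, 0 ≤ u → besselJ u ^ 6 * (1 + b * u ^ 2) ≤ 1) {c : ℕ → ℂ}
    (hc : Summable fun n => ‖c n‖) {F : Fin 12 → Finset ℕ}
    (hF : Pairwise (Function.onFun Disjoint F)) {R : ℝ}
    (hR : ∀ i, R ^ 2 ≤ ∑ n ∈ F i, ‖c n‖ ^ 2) (ξ : ℂ) :
    ‖charFun (P.map (steinhausSum c θ)) ξ‖ ≤ ((1 + b * R ^ 2 * ‖ξ‖ ^ 2) ^ 2)⁻¹ := by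
  obtain ⟨N₀, hN₀⟩ := (Finset.univ.biUnion F).exists_nat_subset_range
  refine le_of_tendsto (tendsto_prod_besselJ hθ hc ξ).norm
    ((eventually_ge_atTop N₀).mono fun N hN => ?_)
  simp only [norm_prod, Complex.norm_real, Real.norm_eq_abs]
  exact prod_abs_besselJ_le hb hJ c (norm_nonneg ξ) hF (fun i =>
    (Finset.subset_biUnion_of_mem F (Finset.mem_univ i)).trans
      (hN₀.trans (Finset.range_mono hN))) hR

end SteinhausCharFun

/-! ### Small balls from decay of the characteristic function -/

section CharFunSmallBall

theorem integral_inv_one_add_mul_sq {b : ℝ} (hb : 0 < b) :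
    ∫ x : ℝ, (1 + b * x ^ 2)⁻¹ = Real.pi / Real.sqrt b := by
  have h := Measure.integral_comp_mul_left (fun x : ℝ => (1 + x ^ 2)⁻¹) (Real.sqrt b)
  simp only [mul_pow, Real.sq_sqrt hb.le, integral_univ_inv_one_add_sq, smul_eq_mul] at h
  rw [h, abs_of_pos (by positivity), inv_mul_eq_div]

theorem integrable_inv_one_add_mul_sq {b : ℝ} (hb : 0 < b) :
    Integrable fun x : ℝ => (1 + b * x ^ 2)⁻¹ := by
  have h := integrable_inv_one_add_sq.comp_mul_left' (R := Real.sqrt b) (by positivity)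
  simpa only [mul_pow, Real.sq_sqrt hb.le] using h

theorem gaussianPDFReal_le (v : ℝ≥0) (x : ℝ) :
    gaussianPDFReal 0 v x ≤ (Real.sqrt (2 * Real.pi * v))⁻¹ := by
  rw [gaussianPDFReal_def]
  refine mul_le_of_le_one_right (by positivity) (Real.exp_le_one_iff.2 ?_)
  rw [neg_div]
  exact neg_nonpos.2 (by positivity)

theorem integral_gaussianReal_inv_one_add_mul_sq_le {b : ℝ} (hb : 0 < b) {v : ℝ≥0} (hv : v ≠ 0) :
    ∫ x, (1 + b * x ^ 2)⁻¹ ∂(gaussianReal 0 v) ≤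
      (Real.sqrt (2 * Real.pi * v))⁻¹ * (Real.pi / Real.sqrt b) := by
  rw [integral_gaussianReal_eq_integral_smul hv, ← integral_inv_one_add_mul_sq hb,
    ← integral_const_mul]
  refine integral_mono_of_nonneg (ae_of_all _ fun x => ?_)
    ((integrable_inv_one_add_mul_sq hb).const_mul _) (ae_of_all _ fun x => ?_)
  · exact mul_nonneg (gaussianPDFReal_nonneg 0 v x) (by positivity)
  · exact mul_le_mul_of_nonneg_right (gaussianPDFReal_le v x) (by positivity)

theorem integral_exp_gaussianReal_prod (v : ℝ≥0) (z : ℂ) :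
    ∫ g : ℝ × ℝ, Complex.exp ((⟪z, (g.1 : ℂ) + g.2 * Complex.I⟫_ℝ : ℂ) * Complex.I)
      ∂((gaussianReal 0 v).prod (gaussianReal 0 v)) =
      ((Real.exp (-(v * ‖z‖ ^ 2 / 2)) : ℝ) : ℂ) := by
  have hsplit : ∀ g : ℝ × ℝ,
      Complex.exp ((⟪z, (g.1 : ℂ) + g.2 * Complex.I⟫_ℝ : ℂ) * Complex.I) =
      Complex.exp (z.re * g.1 * Complex.I) * Complex.exp (z.im * g.2 * Complex.I) := by
    intro g
    have hinner : ⟪z, (g.1 : ℂ) + g.2 * Complex.I⟫_ℝ = z.re * g.1 + z.im * g.2 := by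
      rw [Complex.inner]
      simp
      ring
    rw [hinner, ← Complex.exp_add]
    congr 1
    push_cast
    ring
  simp only [hsplit]
  rw [integral_prod_mul (fun x : ℝ => Complex.exp (z.re * x * Complex.I))
    (fun x : ℝ => Complex.exp (z.im * x * Complex.I)), ← charFun_apply_real, ← charFun_apply_real,
    charFun_gaussianReal, charFun_gaussianReal, ← Complex.exp_add, Complex.ofReal_exp,
    Complex.sq_norm, Complex.normSq_apply]
  congr 1
  push_cast
  ring

theorem integral_exp_neg_mul_norm_sq_eq (μ : Measure ℂ) [IsFiniteMeasure μ] (v : ℝ≥0) :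
    ((∫ z, Real.exp (-(v * ‖z‖ ^ 2 / 2)) ∂μ : ℝ) : ℂ) =
      ∫ g : ℝ × ℝ, charFun μ ((g.1 : ℂ) + g.2 * Complex.I)
        ∂((gaussianReal 0 v).prod (gaussianReal 0 v)) := by
  have hint : Integrable (Function.uncurry fun (z : ℂ) (g : ℝ × ℝ) =>
      Complex.exp ((⟪z, (g.1 : ℂ) + g.2 * Complex.I⟫_ℝ : ℂ) * Complex.I))
      (μ.prod ((gaussianReal 0 v).prod (gaussianReal 0 v))) :=
    Integrable.of_bound (Continuous.aestronglyMeasurable (by fun_prop)) 1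
      (ae_of_all _ fun p => (Complex.norm_exp_ofReal_mul_I _).le)
  simp only [← integral_complex_ofReal, ← integral_exp_gaussianReal_prod, charFun_apply]
  exact integral_integral_swap hint

theorem integral_exp_neg_mul_norm_sq_le {μ : Measure ℂ} [IsFiniteMeasure μ] {b : ℝ} (hb : 0 < b)
    (hμ : ∀ ξ, ‖charFun μ ξ‖ ≤ ((1 + b * ‖ξ‖ ^ 2) ^ 2)⁻¹) {v : ℝ≥0} (hv : 0 < v) :
    ∫ z, Real.exp (-(v * ‖z‖ ^ 2 / 2)) ∂μ ≤ Real.pi / (2 * b * v) := by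
  set f : ℝ → ℝ := fun x => (1 + b * x ^ 2)⁻¹
  have hf0 : ∀ x, 0 ≤ f x := fun x => by positivity
  have hprod : ∀ g : ℝ × ℝ, ‖charFun μ ((g.1 : ℂ) + g.2 * Complex.I)‖ ≤ f g.1 * f g.2 := by
    intro g
    refine (hμ _).trans ?_
    rw [Complex.sq_norm, Complex.normSq_add_mul_I, ← mul_inv]
    refine inv_anti₀ (by positivity) ?_
    nlinarith [mul_nonneg hb.le (sq_nonneg g.1), mul_nonneg hb.le (sq_nonneg g.2)]
  have hint : Integrable f (gaussianReal 0 v) :=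
    Integrable.of_bound (by fun_prop) 1 (ae_of_all _ fun x => by
      rw [Real.norm_of_nonneg (hf0 x)]
      exact inv_le_one_of_one_le₀ (le_add_of_nonneg_right (by positivity)))
  calc ∫ z, Real.exp (-(v * ‖z‖ ^ 2 / 2)) ∂μ
      ≤ ‖((∫ z, Real.exp (-(v * ‖z‖ ^ 2 / 2)) ∂μ : ℝ) : ℂ)‖ := by
        rw [Complex.norm_real]
        exact Real.le_norm_self _
    _ ≤ ∫ g : ℝ × ℝ, f g.1 * f g.2 ∂((gaussianReal 0 v).prod (gaussianReal 0 v)) := by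
        rw [integral_exp_neg_mul_norm_sq_eq]
        exact norm_integral_le_of_norm_le (hint.mul_prod hint) (ae_of_all _ hprod)
    _ = (∫ x, f x ∂(gaussianReal 0 v)) ^ 2 := by
        rw [integral_prod_mul f f, sq]
    _ ≤ ((Real.sqrt (2 * Real.pi * v))⁻¹ * (Real.pi / Real.sqrt b)) ^ 2 := by
        have := integral_nonneg (μ := gaussianReal 0 v) (f := f) hf0
        gcongr
        exact integral_gaussianReal_inv_one_add_mul_sq_le hb hv.ne'
    _ = Real.pi / (2 * b * v) := by
        rw [mul_pow, inv_pow, div_pow, Real.sq_sqrt (by positivity), Real.sq_sqrt hb.le]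
        field_simp

theorem measure_closedBall_le_of_norm_charFun_le {μ : Measure ℂ} [IsFiniteMeasure μ] {b : ℝ}
    (hb : 0 < b) (hμ : ∀ ξ, ‖charFun μ ξ‖ ≤ ((1 + b * ‖ξ‖ ^ 2) ^ 2)⁻¹) {r : ℝ} (hr : 0 < r) :
    μ (Metric.closedBall 0 r) ≤
      ENNReal.ofReal (Real.exp (1 / 2) * (Real.pi / (2 * b)) * r ^ 2) := by
  obtain ⟨v, hv⟩ : ∃ v : ℝ≥0, (v : ℝ) = (r ^ 2)⁻¹ := ⟨⟨(r ^ 2)⁻¹, by positivity⟩, rfl⟩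
  have hv0 : 0 < v := NNReal.coe_pos.1 (by rw [hv]; positivity)
  have hsub : Metric.closedBall 0 r ⊆
      {z : ℂ | Real.exp (-(1 / 2)) ≤ Real.exp (-(v * ‖z‖ ^ 2 / 2))} := by
    intro z hz
    rw [mem_closedBall_zero_iff] at hz
    have hle : (r ^ 2)⁻¹ * ‖z‖ ^ 2 ≤ (r ^ 2)⁻¹ * r ^ 2 := by gcongr
    rw [inv_mul_cancel₀ (by positivity), ← hv] at hle
    exact Real.exp_le_exp.2 (by linarith)
  have hint : Integrable (fun z : ℂ => Real.exp (-(v * ‖z‖ ^ 2 / 2))) μ :=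
    Integrable.of_bound (by fun_prop) 1 (ae_of_all _ fun z => by
      rw [Real.norm_of_nonneg (Real.exp_pos _).le, Real.exp_le_one_iff]
      exact neg_nonpos.2 (by positivity))
  have hmarkov := (mul_meas_ge_le_integral_of_nonneg
    (ae_of_all _ fun z => (Real.exp_pos _).le) hint (Real.exp (-(1 / 2)))).trans
      (integral_exp_neg_mul_norm_sq_le hb hμ hv0)
  rw [← le_div_iff₀' (Real.exp_pos _)] at hmarkov
  rw [← ofReal_measureReal]
  refine ENNReal.ofReal_le_ofReal (((measureReal_mono hsub).trans hmarkov).trans_eq ?_)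
  rw [Real.exp_neg, hv]
  field_simp

end CharFunSmallBall

/-! ### Small ball estimate for increments -/

section SmallBall

theorem exists_finset_half_le_sum {ι : Type*} {f : ι → ℝ} (hf : Summable f)
    (h : 0 < ∑' i, f i) : ∃ s : Finset ι, (∑' i, f i) / 2 ≤ ∑ i ∈ s, f i :=
  (hf.hasSum.eventually (eventually_ge_nhds (half_lt_self h))).exists

variable {a : ℕ → ℂ} {lam : ℕ → ℝ} {φ : ℕ → ℝ → ℂ} {q : ℝ}

theorem exists_finset_block_half_le_sum (ha : Summable fun n => ‖a n‖) {k : ℕ}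
    (hk : 0 < blockNorm a lam q k) :
    ∃ F : Finset ℕ, (∀ n ∈ F, q ^ k ≤ lam n ∧ lam n < q ^ (k + 1)) ∧
      blockNorm a lam q k ^ 2 / 2 ≤ ∑ n ∈ F, ‖a n‖ ^ 2 := by
  have hsq : 0 < blockNorm a lam q k ^ 2 := by positivity
  rw [blockNorm_sq] at hsq ⊢
  obtain ⟨T, hT⟩ := exists_finset_half_le_sum ((summable_norm_sq ha).subtype _) hsq
  refine ⟨T.map (Function.Embedding.subtype _), fun n hn => ?_, hT.trans_eq ?_⟩
  · obtain ⟨n', -, rfl⟩ := Finset.mem_map.1 hn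
    exact n'.2
  · rw [Finset.sum_map]
    rfl

theorem disjoint_of_mem_blocks (hq : 1 < q) {j k : ℕ} (hjk : j ≠ k) {F G : Finset ℕ}
    (hF : ∀ n ∈ F, q ^ j ≤ lam n ∧ lam n < q ^ (j + 1))
    (hG : ∀ n ∈ G, q ^ k ≤ lam n ∧ lam n < q ^ (k + 1)) : Disjoint F G := by
  refine Finset.disjoint_left.2 fun n hnF hnG => hjk ?_
  have h1 := (pow_lt_pow_iff_right₀ hq).1 ((hF n hnF).1.trans_lt (hG n hnG).2)
  have h2 := (pow_lt_pow_iff_right₀ hq).1 ((hG n hnG).1.trans_lt (hF n hnF).2)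
  omega

theorem exists_finset_le_sum_norm_increment_sq (ha : Summable fun n => ‖a n‖) {L δ : ℝ}
    (hL : 0 < L) (hφ : ∀ n x y, |x - y| ≤ δ → L⁻¹ * |x - y| ≤ ‖φ n x - φ n y‖) (hq : 0 < q)
    {k : ℕ} (hk : 0 < blockNorm a lam q k) {x y : ℝ} (hxy : q ^ (k + 1) * |x - y| ≤ δ) :
    ∃ F : Finset ℕ, (∀ n ∈ F, q ^ k ≤ lam n ∧ lam n < q ^ (k + 1)) ∧
      (L⁻¹ * (q ^ k * |x - y|) * blockNorm a lam q k) ^ 2 / 2 ≤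
        ∑ n ∈ F, ‖a n * (φ n (lam n * x) - φ n (lam n * y))‖ ^ 2 := by
  obtain ⟨F, hF, hsum⟩ := exists_finset_block_half_le_sum ha hk
  refine ⟨F, hF, ?_⟩
  have hterm : ∀ n ∈ F, L⁻¹ * (q ^ k * |x - y|) * ‖a n‖ ≤
      ‖a n * (φ n (lam n * x) - φ n (lam n * y))‖ := by
    intro n hn
    obtain ⟨hlow, hup⟩ := hF n hn
    have hlam : |lam n * x - lam n * y| = lam n * |x - y| := by
      rw [← mul_sub, abs_mul, abs_of_pos ((pow_pos hq k).trans_le hlow)]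
    have hbi := hφ n (lam n * x) (lam n * y) (by rw [hlam]; exact le_trans (by gcongr) hxy)
    rw [hlam] at hbi
    rw [norm_mul, mul_comm]
    gcongr
    exact le_trans (by gcongr) hbi
  calc (L⁻¹ * (q ^ k * |x - y|) * blockNorm a lam q k) ^ 2 / 2
      = (L⁻¹ * (q ^ k * |x - y|)) ^ 2 * (blockNorm a lam q k ^ 2 / 2) := by ring
    _ ≤ (L⁻¹ * (q ^ k * |x - y|)) ^ 2 * ∑ n ∈ F, ‖a n‖ ^ 2 := by gcongr
    _ = ∑ n ∈ F, (L⁻¹ * (q ^ k * |x - y|) * ‖a n‖) ^ 2 := by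
        simp only [Finset.mul_sum, mul_pow]
    _ ≤ ∑ n ∈ F, ‖a n * (φ n (lam n * x) - φ n (lam n * y))‖ ^ 2 :=
        Finset.sum_le_sum fun n hn => by
          have := hterm n hn
          gcongr

theorem div_rpow_le_rpow_neg {δ h τ : ℝ} (hq : 0 < q) (hδ : 0 < δ) (hh : 0 < h) (hτ : 0 ≤ τ)
    {k : ℕ} (hk : q ^ k ≤ δ / h) : (h / δ) ^ τ ≤ q ^ (-(τ * k)) := by
  rw [← neg_mul, mul_comm, Real.rpow_mul hq.le, Real.rpow_natCast,
    Real.rpow_neg (by positivity), ← Real.inv_rpow (by positivity), ← inv_div]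
  gcongr

theorem exists_pow_le_div_lt_pow_succ {δ h : ℝ} (hq : 1 < q) (hh : 0 < h) {k : ℕ}
    (hle : h ≤ δ / q ^ k) : ∃ m ≥ k, q ^ m ≤ δ / h ∧ δ / h < q ^ (m + 1) := by
  have hratio : q ^ k ≤ δ / h := by
    rwa [le_div_iff₀ hh, mul_comm, ← le_div_iff₀ (by positivity)]
  obtain ⟨m, hm, hm'⟩ := exists_nat_pow_near ((one_le_pow₀ hq.le).trans hratio) hq
  exact ⟨m, Nat.lt_succ_iff.1 ((pow_lt_pow_iff_right₀ hq).1 (hratio.trans_lt hm')), hm, hm'⟩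

theorem exists_disjoint_finsets_le_sum_norm_increment_sq {τ : ℝ}
    (hφ : LocallyUniformlyBiLipschitz φ) (ha : Summable fun n => ‖a n‖) (hq : 1 < q)
    (hτ0 : 0 ≤ τ) (hτ : upperRate a lam q < τ) (N : ℕ) :
    ∃ D h₀ : ℝ, 0 < D ∧ 0 < h₀ ∧ ∀ x y : ℝ, x ≠ y → |x - y| ≤ h₀ →
      ∃ F : Fin N → Finset ℕ, Pairwise (Function.onFun Disjoint F) ∧ ∀ i,
        (D * |x - y| ^ τ) ^ 2 ≤ ∑ n ∈ F i, ‖a n * (φ n (lam n * x) - φ n (lam n * y))‖ ^ 2 := by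
  obtain ⟨L, δ, hL, hδ, hφL⟩ := hφ
  obtain ⟨k₀, hk₀⟩ := eventually_atTop.1 (eventually_le_blockNorm hq hτ)
  have hq0 : 0 < q := by linarith
  refine ⟨L⁻¹ * (δ / q ^ (N + 1)) * (δ⁻¹) ^ τ / 2, δ / q ^ (k₀ + N + 1), by positivity,
    by positivity, fun x y hxy hle => ?_⟩
  set h := |x - y|
  have hh : 0 < h := abs_pos.2 (sub_ne_zero.2 hxy)
  obtain ⟨m, hkm, hm, hm'⟩ := exists_pow_le_div_lt_pow_succ hq hh hle
  rw [div_lt_iff₀ hh] at hm'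
  have hnorm : ∀ i : Fin N, (h / δ) ^ τ ≤ blockNorm a lam q (m - 1 - i) := by
    intro i
    refine le_trans (div_rpow_le_rpow_neg hq0 hδ hh hτ0 ?_) (hk₀ _ (by omega))
    exact (pow_le_pow_right₀ hq.le (by omega)).trans hm
  have hscale : ∀ i : Fin N, δ / q ^ (N + 1) ≤ q ^ (m - 1 - i) * h := by
    intro i
    rw [div_le_iff₀ (by positivity)]
    calc δ ≤ q ^ (m + 1) * h := hm'.le
      _ ≤ q ^ (m - 1 - i + (N + 1)) * h := by
          have : m + 1 ≤ m - 1 - i + (N + 1) := by omega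
          exact mul_le_mul_of_nonneg_right (pow_le_pow_right₀ hq.le this) hh.le
      _ = q ^ (m - 1 - i) * h * q ^ (N + 1) := by ring
  choose F hF hsum using fun i : Fin N => exists_finset_le_sum_norm_increment_sq (x := x) (y := y)
    ha (by positivity) (fun n x y hxy => (hφL n x y hxy).1) hq0
    (lt_of_lt_of_le (by positivity) (hnorm i)) (by
      rw [← le_div_iff₀ hh]
      exact (pow_le_pow_right₀ hq.le (by omega)).trans hm)
  refine ⟨F, fun i j hij => disjoint_of_mem_blocks hq (by omega) (hF i) (hF j), fun i => ?_⟩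
  refine le_trans ?_ (hsum i)
  calc _ = (L⁻¹ * (δ / q ^ (N + 1)) * (h / δ) ^ τ) ^ 2 / 4 := by
        rw [div_eq_mul_inv h, Real.mul_rpow hh.le (by positivity)]
        ring
    _ ≤ (L⁻¹ * (q ^ (m - 1 - i) * h) * blockNorm a lam q (m - 1 - i)) ^ 2 / 2 := by
        gcongr
        · exact hscale i
        · exact hnorm i
        · norm_num

variable {Ω : Type*} [MeasurableSpace Ω] {P : Measure Ω} [IsProbabilityMeasure P]
  {θ : ℕ → Ω → ℝ}

theorem measure_norm_steinhausSum_le (hθ : IsIIDUniform P θ) {b : ℝ} (hb : 0 < b)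
    (hJ : ∀ u, 0 ≤ u → besselJ u ^ 6 * (1 + b * u ^ 2) ≤ 1) {c : ℕ → ℂ}
    (hc : Summable fun n => ‖c n‖) {F : Fin 12 → Finset ℕ}
    (hF : Pairwise (Function.onFun Disjoint F)) {R : ℝ} (hR : 0 < R)
    (hFR : ∀ i, R ^ 2 ≤ ∑ n ∈ F i, ‖c n‖ ^ 2) {r : ℝ} (hr : 0 < r) :
    P {ω | ‖steinhausSum c θ ω‖ ≤ r} ≤
      ENNReal.ofReal (Real.exp (1 / 2) * (Real.pi / (2 * b)) * (r / R) ^ 2) := by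
  have hmeas := measurable_steinhausSum hc hθ.1
  have hball := measure_closedBall_le_of_norm_charFun_le (μ := P.map (steinhausSum c θ))
    (b := b * R ^ 2) (by positivity) (norm_charFun_map_steinhausSum_le hθ hb hJ hc hF hFR) hr
  rw [Measure.map_apply hmeas measurableSet_closedBall] at hball
  convert hball using 2
  · ext ω
    simp
  · field_simp

theorem exists_measure_norm_increment_le {τ : ℝ} (hθ : IsIIDUniform P θ)
    (hφb : UniformlyBounded φ) (hφ : LocallyUniformlyBiLipschitz φ)
    (ha : Summable fun n => ‖a n‖) (hq : 1 < q) (hτ0 : 0 ≤ τ) (hτ : upperRate a lam q < τ) :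
    ∃ C h₀ : ℝ, 0 < C ∧ 0 < h₀ ∧ ∀ x y : ℝ, x ≠ y → |x - y| ≤ h₀ → ∀ r : ℝ, 0 < r →
      P {ω | ‖phaseSeries a lam φ (fun n => θ n ω) x - phaseSeries a lam φ (fun n => θ n ω) y‖ ≤ r}
        ≤ ENNReal.ofReal (C * (r / |x - y| ^ τ) ^ 2) := by
  obtain ⟨b, hb, hJ⟩ := exists_besselJ_pow_six_mul_le
  obtain ⟨D, h₀, hD, hh₀, hblocks⟩ :=
    exists_disjoint_finsets_le_sum_norm_increment_sq hφ ha hq hτ0 hτ 12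
  refine ⟨Real.exp (1 / 2) * (Real.pi / (2 * b)) / D ^ 2, h₀, by positivity, hh₀,
    fun x y hxy hle r hr => ?_⟩
  obtain ⟨F, hF, hsum⟩ := hblocks x y hxy hle
  have : 0 < |x - y| := abs_pos.2 (sub_ne_zero.2 hxy)
  simp only [phaseSeries_sub hφb ha]
  refine (measure_norm_steinhausSum_le hθ hb hJ (summable_norm_increment hφb ha x y) hF
    (by positivity) hsum hr).trans_eq ?_
  congr 1
  field_simp

end SmallBall

/-! ### Mass distribution and Riesz potentials -/

section MassDistribution

theorem two_pow_rpow_mul_two_inv_pow_rpow (k : ℕ) (s t : ℝ) :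
    ((2 : ℝ≥0∞) ^ k) ^ s * (2⁻¹ ^ k) ^ t = (2 ^ (s - t)) ^ k := by
  rw [← ENNReal.rpow_natCast, ← ENNReal.rpow_natCast, ← ENNReal.rpow_natCast,
    ENNReal.inv_rpow, ← ENNReal.rpow_neg, ← ENNReal.rpow_mul, ← ENNReal.rpow_mul,
    ← ENNReal.rpow_mul, ← ENNReal.rpow_add _ _ two_ne_zero ENNReal.ofNat_ne_top]
  congr 1
  ring

theorem tsum_two_rpow_pow_ne_top {r : ℝ} (hr : r < 0) :
    ∑' k : ℕ, ((2 : ℝ≥0∞) ^ r) ^ k ≠ ∞ := by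
  rw [ENNReal.tsum_geometric]
  refine ENNReal.inv_ne_top.2 (tsub_pos_of_lt ?_).ne'
  exact ENNReal.rpow_lt_one_of_one_lt_of_neg ENNReal.one_lt_two hr

theorem le_mul_rpow_of_forall_two_inv_pow {m M : ℝ≥0∞} (hM : M ≠ ∞) {d t : ℝ} (ht : 0 < t)
    (hd0 : 0 ≤ d) (hd1 : d ≤ 1) (h : ∀ k : ℕ, d ≤ 2⁻¹ ^ k → m ≤ M * (2⁻¹ ^ k) ^ t) :
    m ≤ M * ENNReal.ofReal (2 * d) ^ t := by
  rcases hd0.eq_or_lt with rfl | hpos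
  · have hlim : Tendsto (fun k : ℕ => M * ((2 : ℝ≥0∞)⁻¹ ^ k) ^ t) atTop (𝓝 (M * 0 ^ t)) :=
      ENNReal.Tendsto.const_mul (((ENNReal.continuous_rpow_const).tendsto 0).comp
        (ENNReal.tendsto_pow_atTop_nhds_zero_of_lt_one (by simp))) (Or.inr hM)
    simpa using ge_of_tendsto' hlim fun k => h k (by positivity)
  · obtain ⟨k, hk, hk'⟩ := exists_nat_pow_near_of_lt_one hpos hd1
      (by norm_num : (0 : ℝ) < 2⁻¹) (by norm_num)
    refine (h k hk').trans ?_
    rw [← ofReal_two_inv_pow]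
    gcongr
    rw [pow_succ] at hk
    linarith

theorem le_dimH_of_forall_le_ediam_rpow {X : Type*} [MetricSpace X] {ν : OuterMeasure X}
    {E : Set X} {t : ℝ≥0} {K : ℝ≥0∞} (hK : K ≠ ∞)
    (hν : ∀ s, Metric.ediam s ≤ 1 → ν s ≤ K * Metric.ediam s ^ (t : ℝ)) (hE : ν E ≠ 0) :
    t ≤ dimH E := by
  borelize X
  have hle : (K + 1)⁻¹ • ν ≤ OuterMeasure.mkMetric fun r => r ^ (t : ℝ) := by
    refine OuterMeasure.le_mkMetric _ _ 1 one_pos fun s hs => ?_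
    rw [smul_apply, smul_eq_mul, ← ENNReal.div_eq_inv_mul]
    refine ENNReal.div_le_of_le_mul' ((hν s hs).trans ?_)
    gcongr
    exact le_self_add
  refine le_dimH_of_hausdorffMeasure_ne_zero fun h0 => hE ?_
  have hνE : (K + 1)⁻¹ * ν E ≤ μH[(t : ℝ)] E := by
    rw [Measure.hausdorffMeasure, ← Measure.coe_toOuterMeasure, Measure.mkMetric_toOuterMeasure]
    exact hle E
  rw [h0, nonpos_iff_eq_zero, mul_eq_zero] at hνE
  exact hνE.resolve_left (ENNReal.inv_ne_zero.2 (by finiteness))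

theorem le_dimH_of_forall_closedBall_le {X : Type*} [MetricSpace X] {ν : OuterMeasure X}
    {E : Set X} {t : ℝ≥0} {M : ℝ≥0∞} (hM : M ≠ ∞)
    (h : ∀ x ∈ E, ∀ k : ℕ, ν (Metric.closedBall x (2⁻¹ ^ k)) ≤ M * (2⁻¹ ^ k) ^ (t : ℝ))
    (hE : ν E ≠ 0) : t ≤ dimH E := by
  rcases eq_or_ne t 0 with rfl | ht
  · exact zero_le
  have ht0 : 0 < (t : ℝ) := NNReal.coe_pos.2 (pos_iff_ne_zero.2 ht)
  refine le_dimH_of_forall_le_ediam_rpow (ν := OuterMeasure.restrict E ν)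
    (K := M * 2 ^ (t : ℝ)) (by finiteness) (fun s hs => ?_) (by simpa using hE)
  rw [OuterMeasure.restrict_apply]
  rcases (s ∩ E).eq_empty_or_nonempty with hs0 | ⟨x, hxs, hxE⟩
  · simp [hs0]
  have htop : Metric.ediam s ≠ ∞ := ne_top_of_le_ne_top ENNReal.one_ne_top hs
  have hdiam : Metric.diam s ≤ 1 := ENNReal.toReal_le_of_le_ofReal zero_le_one (by simpa using hs)
  refine (le_mul_rpow_of_forall_two_inv_pow hM ht0 Metric.diam_nonneg hdiam fun k hk =>
    (measure_mono fun y hy => ?_).trans (h x hxE k)).trans_eq ?_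
  · exact (Metric.dist_le_diam_of_mem' htop hy.1 hxs).trans hk
  · rw [ENNReal.ofReal_mul zero_le_two, ENNReal.ofReal_ofNat, Metric.diam,
      ENNReal.ofReal_toReal htop, ENNReal.mul_rpow_of_nonneg _ _ ht0.le, mul_assoc]

theorem le_dimH_image_of_ae_measure_le {X Y : Type*} [MetricSpace X] [MeasurableSpace Y]
    {μ : Measure Y} (hμ : μ ≠ 0) {A : Set Y} (hA : μ Aᶜ = 0) {g : Y → X} {t : ℝ≥0}
    (h : ∀ᵐ x ∂μ, ∃ N : ℕ, ∀ k : ℕ,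
      μ {y | dist (g x) (g y) ≤ 2⁻¹ ^ k} ≤ N * (2⁻¹ ^ k) ^ (t : ℝ)) :
    t ≤ dimH (g '' A) := by
  set E : ℕ → Set Y := fun N =>
    {x | x ∈ A ∧ ∀ k : ℕ, μ {y | dist (g x) (g y) ≤ 2⁻¹ ^ k} ≤ N * (2⁻¹ ^ k) ^ (t : ℝ)}
  obtain ⟨N, hN⟩ : ∃ N, μ (E N) ≠ 0 := by
    by_contra! hnull
    have hfalse : ∀ᵐ _ ∂μ, False := by
      have hAae : ∀ᵐ x ∂μ, x ∈ A := hA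
      filter_upwards [h, hAae, ae_all_iff.2 fun N => measure_eq_zero_iff_ae_notMem.1 (hnull N)]
        with x ⟨N, hN⟩ hxA hx using hx N ⟨hxA, hN⟩
    exact hμ (by simpa using hfalse)
  refine (le_dimH_of_forall_closedBall_le (ν := OuterMeasure.map g μ.toOuterMeasure)
    (E := g '' E N) (ENNReal.natCast_ne_top N) ?_ ?_).trans
    (dimH_mono (Set.image_mono fun _ hx => hx.1))
  · rintro _ ⟨x, hx, rfl⟩ k
    refine (OuterMeasure.map_apply _ _ _).trans_le ((measure_mono fun y hy => ?_).trans (hx.2 k))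
    rwa [Set.mem_preimage, Metric.mem_closedBall'] at hy
  · exact fun h0 => hN (measure_mono_null (Set.subset_preimage_image g _) h0)

/-- The parameters of the graph points of `f` within distance `ρ` of the graph point over `x`,
distances being measured separately in the domain and in the range. -/
def graphBall (f : ℝ → ℂ) (x ρ : ℝ) : Set ℝ := {y | |x - y| ≤ ρ ∧ ‖f x - f y‖ ≤ ρ}

theorem abs_sub_le_dist_graph (f : ℝ → ℂ) (x y : ℝ) :
    |x - y| ≤ dist (!₂[x, (f x).re, (f x).im] : EuclideanSpace ℝ (Fin 3))
      !₂[y, (f y).re, (f y).im] := by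
  simpa [dist_eq_norm] using PiLp.norm_apply_le
    (!₂[x, (f x).re, (f x).im] - !₂[y, (f y).re, (f y).im] : EuclideanSpace ℝ (Fin 3)) 0

theorem norm_sub_le_dist_graph (f : ℝ → ℂ) (x y : ℝ) :
    ‖f x - f y‖ ≤ dist (!₂[x, (f x).re, (f x).im] : EuclideanSpace ℝ (Fin 3))
      !₂[y, (f y).re, (f y).im] := by
  rw [EuclideanSpace.dist_eq, Fin.sum_univ_three, Complex.norm_eq_sqrt_sq_add_sq]
  refine Real.sqrt_le_sqrt ?_
  simp only [Real.dist_eq, sq_abs, Matrix.cons_val_zero, Matrix.cons_val_one, Matrix.cons_val,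
    Complex.sub_re, Complex.sub_im]
  linarith [sq_nonneg (x - y)]

theorem le_dimH_graphOver_of_ae_measure_le {f : ℝ → ℂ} {A : Set ℝ} {μ : Measure ℝ}
    (hμ : μ ≠ 0) (hA : μ Aᶜ = 0) {t : ℝ≥0}
    (h : ∀ᵐ x ∂μ, ∃ N : ℕ, ∀ k : ℕ, μ (graphBall f x (2⁻¹ ^ k)) ≤ N * (2⁻¹ ^ k) ^ (t : ℝ)) :
    t ≤ dimH (graphOver f A) := by
  refine le_dimH_image_of_ae_measure_le hμ hA (g := fun x => !₂[x, (f x).re, (f x).im]) ?_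
  filter_upwards [h] with x ⟨N, hN⟩
  refine ⟨N, fun k => (measure_mono fun y hy => ?_).trans (hN k)⟩
  exact ⟨(abs_sub_le_dist_graph f x y).trans hy, (norm_sub_le_dist_graph f x y).trans hy⟩

section Riesz

variable {X : Type*} [PseudoMetricSpace X] {γ : ℝ}

theorem edist_rpow_neg_le_tsum (hγ : 0 ≤ γ) (x y : X) :
    edist x y ^ (-γ) ≤ 1 + ∑' k : ℕ,
      (Metric.closedBall x (2⁻¹ ^ k)).indicator (fun _ => ((2 : ℝ≥0∞) ^ (k + 1)) ^ γ) y := by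
  have hone {z : ℝ≥0∞} (hz : 1 ≤ z) : 1 ≤ z ^ γ := by
    simpa using ENNReal.rpow_le_rpow hz hγ
  rcases eq_or_ne (dist x y) 0 with h0 | h0
  · have hmem (k : ℕ) : y ∈ Metric.closedBall x (2⁻¹ ^ k) := by
      rw [Metric.mem_closedBall', h0]
      positivity
    have htop : ∞ ≤ ∑' k : ℕ, ((2 : ℝ≥0∞) ^ (k + 1)) ^ γ :=
      (ENNReal.tsum_const_eq_top_of_ne_zero one_ne_zero).ge.trans
        (ENNReal.tsum_le_tsum fun k => hone (one_le_pow₀ ENNReal.one_lt_two.le))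
    simp only [Set.indicator_of_mem (hmem _), top_le_iff.1 htop, add_top, le_top]
  have hpos : 0 < dist x y := dist_nonneg.lt_of_ne' h0
  rw [edist_dist]
  rcases le_or_gt (dist x y) 1 with hle | hgt
  · obtain ⟨k, hk, hk'⟩ := exists_nat_pow_near_of_lt_one hpos hle
      (by norm_num : (0 : ℝ) < 2⁻¹) (by norm_num)
    refine le_trans ?_ ((ENNReal.le_tsum k).trans le_add_self)
    rw [Set.indicator_of_mem (Metric.mem_closedBall'.2 hk'), ENNReal.rpow_neg, ← ENNReal.inv_rpow]
    refine ENNReal.rpow_le_rpow ?_ hγ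
    rw [← ENNReal.inv_le_inv, inv_inv, ENNReal.inv_pow, ← ofReal_two_inv_pow]
    exact ENNReal.ofReal_le_ofReal hk.le
  · rw [ENNReal.rpow_neg]
    exact le_add_right (ENNReal.inv_le_one.2 (hone (ENNReal.one_le_ofReal.2 hgt.le)))

theorem exists_lintegral_edist_rpow_neg_le [MeasurableSpace X] [OpensMeasurableSpace X]
    {μ : Measure X} [IsFiniteMeasure μ] {C : ℝ≥0} {s : ℝ}
    (hμ : ∀ x r, 0 < r → μ (Metric.closedBall x r) ≤ C * ENNReal.ofReal r ^ s)
    (hγ0 : 0 ≤ γ) (hγ : γ < s) :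
    ∃ M : ℝ≥0∞, M ≠ ∞ ∧ ∀ x, ∫⁻ y, edist x y ^ (-γ) ∂μ ≤ M := by
  have hgeom := tsum_two_rpow_pow_ne_top (sub_neg.2 hγ)
  refine ⟨μ Set.univ + C * 2 ^ γ * ∑' k : ℕ, (2 ^ (γ - s)) ^ k, by finiteness, fun x => ?_⟩
  refine (lintegral_mono (edist_rpow_neg_le_tsum hγ0 x)).trans ?_
  rw [lintegral_add_left measurable_const, lintegral_one, lintegral_tsum fun k =>
    (measurable_const.indicator measurableSet_closedBall).aemeasurable, ← ENNReal.tsum_mul_left]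
  gcongr with k
  rw [lintegral_indicator_const measurableSet_closedBall]
  calc ((2 : ℝ≥0∞) ^ (k + 1)) ^ γ * μ (Metric.closedBall x (2⁻¹ ^ k))
      ≤ ((2 : ℝ≥0∞) ^ (k + 1)) ^ γ * (C * (2⁻¹ ^ k) ^ s) := by
        gcongr
        exact (hμ x _ (by positivity)).trans_eq (by rw [ofReal_two_inv_pow])
    _ = C * 2 ^ γ * (((2 : ℝ≥0∞) ^ k) ^ γ * (2⁻¹ ^ k) ^ s) := by
        rw [pow_succ, ENNReal.mul_rpow_of_nonneg _ _ hγ0]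
        ring
    _ = C * 2 ^ γ * (2 ^ (γ - s)) ^ k := by rw [two_pow_rpow_mul_two_inv_pow_rpow]

end Riesz

end MassDistribution

/-! ### Lower bounds from small ball estimates -/

section Energy

/-- If increments over distance `h` lie in a ball of radius `ρ` with probability of order
`(ρ / h ^ τ) ^ 2`, then the `t`-energy of a random graph is controlled by the Riesz energy of this
order on its domain. -/
noncomputable def rieszOrder (τ t : ℝ) : ℝ := min t 2 * τ + max (t - 2) 0

theorem rieszOrder_nonneg {τ t : ℝ} (hτ : 0 ≤ τ) (ht : 0 ≤ t) : 0 ≤ rieszOrder τ t := by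
  have : 0 ≤ min t 2 := le_min ht zero_le_two
  unfold rieszOrder
  positivity

theorem min_one_mul_sq_le {C v s : ℝ} (hv : 0 < v) (hs0 : 0 ≤ s) (hs2 : s ≤ 2) :
    min 1 (C * v ^ 2) ≤ max 1 C * v ^ s := by
  have hmax : 1 ≤ max 1 C := le_max_left 1 C
  rcases le_total v 1 with hv1 | hv1
  · calc min 1 (C * v ^ 2) ≤ C * v ^ 2 := min_le_right _ _
      _ ≤ max 1 C * v ^ 2 := by
          gcongr
          exact le_max_right _ _
      _ ≤ max 1 C * v ^ s := by
          rw [← Real.rpow_two]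
          exact mul_le_mul_of_nonneg_left (Real.rpow_le_rpow_of_exponent_ge hv hv1 hs2)
            (by positivity)
  · exact (min_le_left _ _).trans (one_le_mul_of_one_le_of_one_le hmax (Real.one_le_rpow hv1 hs0))

theorem min_one_mul_div_rpow_sq_le {C h ρ τ t : ℝ} (hh : 0 < h) (hhρ : h ≤ ρ) (ht : 0 ≤ t) :
    min 1 (C * (ρ / h ^ τ) ^ 2) ≤ max 1 C * ρ ^ t * h ^ (-rieszOrder τ t) := by
  have hρ : 0 < ρ := hh.trans_le hhρ
  have hsplit : min t 2 + max (t - 2) 0 = t := by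
    rcases le_total t 2 with h2 | h2 <;> simp [h2]
  calc min 1 (C * (ρ / h ^ τ) ^ 2) ≤ max 1 C * (ρ / h ^ τ) ^ min t 2 :=
        min_one_mul_sq_le (by positivity) (le_min ht zero_le_two) (min_le_right _ _)
    _ ≤ max 1 C * ((ρ / h ^ τ) ^ min t 2 * (ρ / h) ^ max (t - 2) 0) := by
        refine mul_le_mul_of_nonneg_left (le_mul_of_one_le_right (by positivity) ?_) (by positivity)
        exact Real.one_le_rpow ((one_le_div hh).2 hhρ) (le_max_right _ _)
    _ = max 1 C * (ρ ^ (min t 2 + max (t - 2) 0) * h ^ (-rieszOrder τ t)) := by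
        rw [Real.div_rpow hρ.le (by positivity), Real.div_rpow hρ.le hh.le, rieszOrder,
          Real.rpow_neg hh.le, Real.rpow_add hρ, Real.rpow_add hh, ← Real.rpow_mul hh.le,
          mul_comm τ]
        field_simp
    _ = max 1 C * ρ ^ t * h ^ (-rieszOrder τ t) := by rw [hsplit, mul_assoc]

theorem measure_singleton_eq_zero_of_closedBall_le {X : Type*} [PseudoMetricSpace X]
    [MeasurableSpace X] {μ : Measure X} {C : ℝ≥0} {s : ℝ} (hs : 0 < s)
    (hμ : ∀ x r, 0 < r → μ (Metric.closedBall x r) ≤ C * ENNReal.ofReal r ^ s) (x : X) :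
    μ {x} = 0 := by
  have hle := le_mul_rpow_of_forall_two_inv_pow (m := μ {x}) ENNReal.coe_ne_top hs le_rfl
    zero_le_one fun k _ => by
      rw [← ofReal_two_inv_pow]
      exact (measure_mono (Set.singleton_subset_iff.2
        (Metric.mem_closedBall_self (by positivity)))).trans (hμ x (2⁻¹ ^ k) (by positivity))
  simpa [ENNReal.zero_rpow_of_pos hs] using hle

theorem ae_exists_forall_le_of_lintegral_le {α : Type*} [MeasurableSpace α] {ν : Measure α}
    {V : ℕ → α → ℝ≥0∞} (hV : ∀ k, Measurable (V k)) {K : ℝ≥0∞} (hK : K ≠ ∞) {t t' : ℝ}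
    (ht : t' < t) (h : ∀ k, ∫⁻ x, V k x ∂ν ≤ K * (2⁻¹ ^ k) ^ t) :
    ∀ᵐ x ∂ν, ∃ N : ℕ, ∀ k, V k x ≤ N * (2⁻¹ ^ k) ^ t' := by
  have hfin : ∫⁻ x, ∑' k : ℕ, ((2 : ℝ≥0∞) ^ k) ^ t' * V k x ∂ν ≠ ∞ := by
    rw [lintegral_tsum fun k => ((hV k).const_mul _).aemeasurable]
    refine ne_top_of_le_ne_top (ENNReal.mul_ne_top hK (tsum_two_rpow_pow_ne_top (sub_neg.2 ht))) ?_
    rw [← ENNReal.tsum_mul_left]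
    refine ENNReal.tsum_le_tsum fun k => ?_
    rw [lintegral_const_mul _ (hV k), ← two_pow_rpow_mul_two_inv_pow_rpow, mul_left_comm]
    gcongr
    exact h k
  filter_upwards [ae_lt_top (.tsum fun k => (hV k).const_mul _) hfin] with x hx
  obtain ⟨N, hN⟩ := ENNReal.exists_nat_gt hx.ne
  refine ⟨N, fun k => ?_⟩
  calc V k x = ((2 : ℝ≥0∞) ^ k) ^ t' * V k x * (2⁻¹ ^ k) ^ t' := by
        rw [mul_right_comm, two_pow_rpow_mul_two_inv_pow_rpow, sub_self, ENNReal.rpow_zero,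
          one_pow, one_mul]
    _ ≤ N * (2⁻¹ ^ k) ^ t' := by
        gcongr
        exact (ENNReal.le_tsum k).trans hN.le

variable {Ω : Type*} [MeasurableSpace Ω] {P : Measure Ω} {F : Ω → ℝ → ℂ} {μ : Measure ℝ}

theorem measurableSet_mem_graphBall (hFc : ∀ ω, Continuous (F ω))
    (hFm : ∀ x, Measurable fun ω => F ω x) (ρ : ℝ) :
    MeasurableSet {p : (Ω × ℝ) × ℝ | p.2 ∈ graphBall (F p.1.1) p.1.2 ρ} := by
  have hF : Measurable fun p : ℝ × Ω => F p.2 p.1 :=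
    measurable_uncurry_of_continuous_of_measurable (u := fun x ω => F ω x) hFc hFm
  have h1 : Measurable fun p : (Ω × ℝ) × ℝ => F p.1.1 p.1.2 :=
    hF.comp (measurable_fst.snd.prodMk measurable_fst.fst)
  have h2 : Measurable fun p : (Ω × ℝ) × ℝ => F p.1.1 p.2 :=
    hF.comp (measurable_snd.prodMk measurable_fst.fst)
  have h3 : Measurable fun p : (Ω × ℝ) × ℝ => |p.1.2 - p.2| := by fun_prop
  exact (measurableSet_le h3 measurable_const).inter
    (measurableSet_le (h1.sub h2).norm measurable_const)

theorem measurable_measure_graphBall [SFinite μ] (hFc : ∀ ω, Continuous (F ω))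
    (hFm : ∀ x, Measurable fun ω => F ω x) (ρ : ℝ) :
    Measurable fun p : Ω × ℝ => μ (graphBall (F p.1) p.2 ρ) :=
  measurable_measure_prodMk_left (measurableSet_mem_graphBall hFc hFm ρ)

theorem lintegral_measure_graphBall_le [SFinite P] [IsFiniteMeasure μ]
    (hFc : ∀ ω, Continuous (F ω)) (hFm : ∀ x, Measurable fun ω => F ω x) {γ ρ : ℝ}
    {κ M : ℝ≥0∞} (hκ : κ ≠ ∞) (hM : ∀ x, ∫⁻ y, edist x y ^ (-γ) ∂μ ≤ M)
    (h : ∀ᵐ x ∂μ, ∀ᵐ y ∂μ, P {ω | y ∈ graphBall (F ω) x ρ} ≤ κ * edist x y ^ (-γ)) :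
    ∫⁻ p, μ (graphBall (F p.1) p.2 ρ) ∂P.prod μ ≤ κ * M * μ Set.univ := by
  have hmeas := measurableSet_mem_graphBall hFc hFm ρ
  rw [lintegral_prod_symm _ (measurable_measure_graphBall hFc hFm ρ).aemeasurable,
    ← lintegral_const]
  refine lintegral_mono_ae ?_
  filter_upwards [h] with x hx
  have hmeasx : MeasurableSet {p : Ω × ℝ | p.2 ∈ graphBall (F p.1) x ρ} :=
    hmeas.preimage ((measurable_fst.prodMk measurable_const).prodMk measurable_snd)
  calc ∫⁻ ω, μ (graphBall (F ω) x ρ) ∂P = ∫⁻ y, P {ω | y ∈ graphBall (F ω) x ρ} ∂μ :=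
        (Measure.prod_apply hmeasx).symm.trans (Measure.prod_apply_symm hmeasx)
    _ ≤ ∫⁻ y, κ * edist x y ^ (-γ) ∂μ := lintegral_mono_ae hx
    _ ≤ κ * M := by
        rw [lintegral_const_mul' _ _ hκ]
        gcongr
        exact hM x

theorem measure_mem_graphBall_le [IsProbabilityMeasure P] {C τ t x y ρ : ℝ} (ht : 0 ≤ t)
    (hxy : x ≠ y)
    (h : P {ω | ‖F ω x - F ω y‖ ≤ ρ} ≤ ENNReal.ofReal (C * (ρ / |x - y| ^ τ) ^ 2)) :
    P {ω | y ∈ graphBall (F ω) x ρ} ≤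
      ENNReal.ofReal (max 1 C * ρ ^ t) * edist x y ^ (-rieszOrder τ t) := by
  have hpos : 0 < |x - y| := abs_pos.2 (sub_ne_zero.2 hxy)
  rcases le_or_gt |x - y| ρ with hle | hgt
  · have : 0 < ρ := hpos.trans_le hle
    rw [edist_dist, Real.dist_eq, ENNReal.ofReal_rpow_of_pos hpos,
      ← ENNReal.ofReal_mul (by positivity)]
    refine le_trans ?_ (ENNReal.ofReal_le_ofReal (min_one_mul_div_rpow_sq_le (τ := τ) hpos hle ht))
    rw [ENNReal.ofReal_min, ENNReal.ofReal_one]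
    exact le_min prob_le_one ((measure_mono fun ω hω => hω.2).trans h)
  · simp [graphBall, hgt.not_ge]

theorem exists_int_lt_dimH_inter_Ico {A : Set ℝ} {s : ℝ≥0∞} (hs : s < dimH A) {h : ℝ}
    (hh : 0 < h) : ∃ j : ℤ, s < dimH (A ∩ Set.Ico (j • h) ((j + 1) • h)) := by
  rw [← Set.inter_univ A, ← iUnion_Ico_zsmul hh, Set.inter_iUnion, dimH_iUnion] at hs
  exact lt_iSup_iff.1 hs

theorem ae_ae_exists_measure_graphBall_le [IsProbabilityMeasure P] [IsFiniteMeasure μ]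
    (hFc : ∀ ω, Continuous (F ω)) (hFm : ∀ x, Measurable fun ω => F ω x) {K : ℝ≥0}
    {C s t t' τ : ℝ} (hμ : ∀ x r, 0 < r → μ (Metric.closedBall x r) ≤ K * ENNReal.ofReal r ^ s)
    (hτ : 0 ≤ τ) (ht0 : 0 ≤ t) (ht : t' < t) (hts : rieszOrder τ t < s)
    (hsmall : ∀ᵐ x ∂μ, ∀ᵐ y ∂μ, x ≠ y → ∀ r : ℝ, 0 < r →
      P {ω | ‖F ω x - F ω y‖ ≤ r} ≤ ENNReal.ofReal (C * (r / |x - y| ^ τ) ^ 2)) :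
    ∀ᵐ ω ∂P, ∀ᵐ x ∂μ, ∃ N : ℕ, ∀ k : ℕ,
      μ (graphBall (F ω) x (2⁻¹ ^ k)) ≤ N * (2⁻¹ ^ k) ^ t' := by
  have hγ0 : 0 ≤ rieszOrder τ t := rieszOrder_nonneg hτ ht0
  obtain ⟨M, hM, hMle⟩ := exists_lintegral_edist_rpow_neg_le hμ hγ0 hts
  have hball (k : ℕ) : ∀ᵐ x ∂μ, ∀ᵐ y ∂μ, P {ω | y ∈ graphBall (F ω) x (2⁻¹ ^ k)} ≤
      ENNReal.ofReal (max 1 C * (2⁻¹ ^ k) ^ t) * edist x y ^ (-rieszOrder τ t) := by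
    filter_upwards [hsmall] with x hx
    filter_upwards [hx, measure_eq_zero_iff_ae_notMem.1
      (measure_singleton_eq_zero_of_closedBall_le (hγ0.trans_lt hts) hμ x)] with y hy hyx
    have hxy : x ≠ y := fun h => hyx h.symm
    exact measure_mem_graphBall_le ht0 hxy (hy hxy _ (by positivity))
  have henergy (k : ℕ) : ∫⁻ p, μ (graphBall (F p.1) p.2 (2⁻¹ ^ k)) ∂P.prod μ ≤
      ENNReal.ofReal (max 1 C) * M * μ Set.univ * (2⁻¹ ^ k) ^ t := by
    refine (lintegral_measure_graphBall_le hFc hFm ENNReal.ofReal_ne_top hMle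
      (hball k)).trans_eq ?_
    rw [ENNReal.ofReal_mul (by positivity), ← ENNReal.ofReal_rpow_of_pos (by positivity),
      ofReal_two_inv_pow]
    ring
  exact Measure.ae_ae_of_ae_prod <| ae_exists_forall_le_of_lintegral_le
    (fun k => measurable_measure_graphBall hFc hFm (2⁻¹ ^ k))
    (by finiteness) ht henergy

theorem ae_le_dimH_graphOver [IsProbabilityMeasure P] (hFc : ∀ ω, Continuous (F ω))
    (hFm : ∀ x, Measurable fun ω => F ω x) {C h₀ τ : ℝ} (hh₀ : 0 < h₀) (hτ : 0 ≤ τ)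
    (hsmall : ∀ x y : ℝ, x ≠ y → |x - y| ≤ h₀ → ∀ r : ℝ, 0 < r →
      P {ω | ‖F ω x - F ω y‖ ≤ r} ≤ ENNReal.ofReal (C * (r / |x - y| ^ τ) ^ 2))
    {A : Set ℝ} (hA : MeasurableSet A) {s t' : ℝ≥0} {t : ℝ} (hs : s < dimH A) (ht : t' < t)
    (hts : rieszOrder τ t < s) : ∀ᵐ ω ∂P, (t' : ℝ≥0∞) ≤ dimH (graphOver (F ω) A) := by
  have ht0 : 0 ≤ t := t'.coe_nonneg.trans ht.le
  have hs0 : (0 : ℝ) < s := (rieszOrder_nonneg hτ ht0).trans_lt hts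
  obtain ⟨j, hj⟩ := exists_int_lt_dimH_inter_Ico hs hh₀
  set B := A ∩ Set.Ico (j • h₀) ((j + 1) • h₀)
  obtain ⟨μ, _, hμ, hμB, K, hK⟩ :=
    exists_frostman_measure (NNReal.coe_pos.1 hs0) (hA.inter measurableSet_Ico) hj
  have hdiam : ∀ x ∈ B, ∀ y ∈ B, |x - y| ≤ h₀ := by
    rintro x ⟨-, hx, hx'⟩ y ⟨-, hy, hy'⟩
    rw [add_smul, one_smul] at hx' hy'
    exact abs_le.2 ⟨by linarith, by linarith⟩
  have hBae : ∀ᵐ x ∂μ, x ∈ B := hμB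
  have hsmallB : ∀ᵐ x ∂μ, ∀ᵐ y ∂μ, x ≠ y → ∀ r : ℝ, 0 < r →
      P {ω | ‖F ω x - F ω y‖ ≤ r} ≤ ENNReal.ofReal (C * (r / |x - y| ^ τ) ^ 2) := by
    filter_upwards [hBae] with x hx
    filter_upwards [hBae] with y hy hxy using hsmall x y hxy (hdiam x hx y hy)
  filter_upwards [ae_ae_exists_measure_graphBall_le hFc hFm hK hτ ht0 ht hts hsmallB] with ω hω
  exact (le_dimH_graphOver_of_ae_measure_le hμ hμB hω).trans
    (dimH_mono (Set.image_mono Set.inter_subset_left))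

end Energy

/-! ### Dimension of the graph of a Steinhaus series -/

section DimensionBounds

/-- The dimension of the graph of a typical planar function with Hölder exponent `x` over a set
of dimension `d`. -/
noncomputable def holderGraphDim (d x : ℝ) : ℝ := min (d / x) (d + 2 - 2 * x)

theorem holderGraphDim_nonneg {d x : ℝ} (hd : 0 ≤ d) (hx0 : 0 ≤ x) (hx1 : x ≤ 1) :
    0 ≤ holderGraphDim d x :=
  le_min (by positivity) (by linarith)

theorem coe_holderGraphDim_dimH (A : Set ℝ) (x : ℝ) :
    (holderGraphDim (dimH A).toReal x : EReal) =
      min ((dimH A : EReal) / x) ((dimH A : EReal) + 2 - 2 * x) := by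
  lift dimH A to ℝ≥0 using Real.dimH_ne_top A with d
  rw [holderGraphDim, EReal.coe_strictMono.monotone.map_min, ENNReal.coe_toReal]
  norm_cast

theorem dimH_graphOver_le_holderGraphDim {f : ℝ → ℂ} {β : ℝ} (hβ0 : 0 < β) (hβ1 : β ≤ 1)
    (hf : LocallyHolder β f) (A : Set ℝ) :
    dimH (graphOver f A) ≤ ENNReal.ofReal (holderGraphDim (dimH A).toReal β) := by
  have hdA := (ENNReal.ofReal_toReal (Real.dimH_ne_top A)).symm
  rw [holderGraphDim, ENNReal.ofReal_min, ENNReal.ofReal_div_of_pos hβ0, add_sub_assoc,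
    ENNReal.ofReal_add ENNReal.toReal_nonneg (by linarith), ← hdA]
  refine le_min ?_ (dimH_graphOver_le_add hβ0.le hβ1 hf A)
  lift β to ℝ≥0 using hβ0.le
  rw [ENNReal.ofReal_coe_nnreal]
  exact dimH_graphOver_le_div (by exact_mod_cast hβ0) (by exact_mod_cast hβ1) hf A

theorem rieszOrder_lt_of_lt_holderGraphDim {d τ u : ℝ} (hτ : 0 < τ)
    (hu : u < holderGraphDim d τ) : rieszOrder τ u < d := by
  obtain ⟨h1, h2⟩ := lt_min_iff.1 hu
  rw [lt_div_iff₀ hτ] at h1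
  rcases le_total u 2 with h | h
  · rwa [rieszOrder, min_eq_left h, max_eq_right (by linarith), add_zero]
  · rw [rieszOrder, min_eq_right h, max_eq_left (by linarith)]
    linarith

variable {Ω : Type*} [MeasurableSpace Ω] {P : Measure Ω} [IsProbabilityMeasure P]
  {a : ℕ → ℂ} {lam : ℕ → ℝ} {φ : ℕ → ℝ → ℂ} {q : ℝ} {θ : ℕ → Ω → ℝ}

theorem ae_dimH_graphOver_le_holderGraphDim {σ : ℝ} (hθ : IsIIDUniform P θ)
    (hφb : UniformlyBounded φ) (hφ : LocallyUniformlyBiLipschitz φ)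
    (ha : Summable fun n => ‖a n‖) (hlam : ∀ n, 1 ≤ lam n) (hq : 1 < q) (hσ0 : 0 < σ)
    (hσ1 : σ ≤ 1) (hσ : σ ≤ lowerRate a lam q) :
    ∀ᵐ ω ∂P, ∀ A : Set ℝ, dimH (graphOver (phaseSeries a lam φ fun n => θ n ω) A) ≤
      ENNReal.ofReal (holderGraphDim (dimH A).toReal σ) := by
  obtain ⟨β, -, hβσ, hβ⟩ := exists_seq_strictMono_tendsto' hσ0
  have hholder : ∀ᵐ ω ∂P, ∀ n, LocallyHolder (β n) (phaseSeries a lam φ fun n => θ n ω) :=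
    ae_all_iff.2 fun n => ae_locallyHolder_phaseSeries hθ hφb hφ ha hlam hq (hβσ n).1
      ((hβσ n).2.trans_le hσ1) ((EReal.coe_lt_coe_iff.2 (hβσ n).2).trans_le hσ)
  filter_upwards [hholder] with ω hω A
  have hcont : ContinuousAt (holderGraphDim (dimH A).toReal) σ := by
    unfold holderGraphDim
    fun_prop (disch := exact hσ0.ne')
  exact ge_of_tendsto' (ENNReal.tendsto_ofReal (hcont.tendsto.comp hβ)) fun n =>
    dimH_graphOver_le_holderGraphDim (hβσ n).1 ((hβσ n).2.le.trans hσ1) (hω n) A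

theorem measurable_phaseSeries (hθ : ∀ n, Measurable (θ n)) (hφb : UniformlyBounded φ)
    (ha : Summable fun n => ‖a n‖) (x : ℝ) :
    Measurable fun ω => phaseSeries a lam φ (fun n => θ n ω) x := by
  simp only [phaseSeries_eq_steinhausSum]
  exact measurable_steinhausSum (summable_norm_coeff hφb ha x) hθ

theorem ae_ofReal_le_dimH_graphOver_of_rieszOrder_lt {τ : ℝ} (hθ : IsIIDUniform P θ)
    (hφb : UniformlyBounded φ) (hφ : LocallyUniformlyBiLipschitz φ)
    (ha : Summable fun n => ‖a n‖) (hq : 1 < q) (hτ0 : 0 ≤ τ) (hτ : upperRate a lam q ≤ τ)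
    {A : Set ℝ} (hA : MeasurableSet A) {u : ℝ} (hu : 0 ≤ u)
    (huA : rieszOrder τ u < (dimH A).toReal) :
    ∀ᵐ ω ∂P, ENNReal.ofReal u ≤ dimH (graphOver (phaseSeries a lam φ fun n => θ n ω) A) := by
  have hcont : Continuous fun ε : ℝ => rieszOrder (τ + ε) (u + ε) := by
    unfold rieszOrder
    fun_prop
  have hev : ∀ᶠ ε in 𝓝[>] (0 : ℝ), rieszOrder (τ + ε) (u + ε) < (dimH A).toReal :=
    (hcont.continuousAt.eventually_lt_const (by simpa using huA)).filter_mono nhdsWithin_le_nhds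
  obtain ⟨ε, hε, hε0⟩ := (hev.and self_mem_nhdsWithin).exists
  obtain ⟨s, hs, hsA⟩ := exists_between hε
  lift s to ℝ≥0 using (rieszOrder_nonneg (by positivity) (by positivity)).trans hs.le
  obtain ⟨C, h₀, -, hh₀, hsmall⟩ := exists_measure_norm_increment_le hθ hφb hφ ha hq
    (add_nonneg hτ0 hε0.le) (hτ.trans_lt (EReal.coe_lt_coe_iff.2 (lt_add_of_pos_right τ hε0)))
  exact ae_le_dimH_graphOver (fun ω => continuous_phaseSeries hφb hφ ha fun n => θ n ω)
    (measurable_phaseSeries hθ.1 hφb ha) hh₀ (by positivity) hsmall hA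
    ((ENNReal.lt_ofReal_iff_toReal_lt ENNReal.coe_ne_top).2 hsA |>.trans_le
      ENNReal.ofReal_toReal_le) (by rw [Real.coe_toNNReal _ hu]; linarith) hs

theorem ae_ofReal_le_dimH_graphOver_of_forall_lt {τ : ℝ} (hθ : IsIIDUniform P θ)
    (hφb : UniformlyBounded φ) (hφ : LocallyUniformlyBiLipschitz φ)
    (ha : Summable fun n => ‖a n‖) (hq : 1 < q) (hτ0 : 0 ≤ τ) (hτ : upperRate a lam q ≤ τ)
    {A : Set ℝ} (hA : MeasurableSet A) {m : ℝ}
    (hm : ∀ u < m, rieszOrder τ u < (dimH A).toReal) :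
    ∀ᵐ ω ∂P, ENNReal.ofReal m ≤ dimH (graphOver (phaseSeries a lam φ fun n => θ n ω) A) := by
  rcases le_or_gt m 0 with hm0 | hm0
  · simp [ENNReal.ofReal_of_nonpos hm0]
  obtain ⟨u, -, hum, hu⟩ := exists_seq_strictMono_tendsto' hm0
  filter_upwards [ae_all_iff.2 fun n => ae_ofReal_le_dimH_graphOver_of_rieszOrder_lt hθ hφb hφ ha
    hq hτ0 hτ hA (hum n).1.le (hm _ (hum n).2)] with ω hω
  exact le_of_tendsto' (ENNReal.tendsto_ofReal hu) hω

theorem ae_dimH_graphOver_le {σ : EReal} (hθ : IsIIDUniform P θ)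
    (hφb : UniformlyBounded φ) (hφ : LocallyUniformlyBiLipschitz φ)
    (ha : Summable fun n => ‖a n‖) (hlam : ∀ n, 1 ≤ lam n) (hq : 1 < q) (hσ0 : 0 < σ)
    (hσ1 : σ ≤ 1) (hσ : σ ≤ lowerRate a lam q) :
    ∀ᵐ ω ∂P, ∀ A : Set ℝ,
      (dimH (graphOver (phaseSeries a lam φ fun n => θ n ω) A) : EReal) ≤
        min ((dimH A : EReal) / σ) ((dimH A : EReal) + 2 - 2 * σ) := by
  lift σ to ℝ using ⟨(hσ1.trans_lt (EReal.coe_lt_top 1)).ne, hσ0.ne_bot⟩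
  have hσ0' : 0 < σ := EReal.coe_pos.1 hσ0
  have hσ1' : σ ≤ 1 := EReal.coe_le_coe_iff.1 hσ1
  filter_upwards [ae_dimH_graphOver_le_holderGraphDim hθ hφb hφ ha hlam hq hσ0' hσ1' hσ]
    with ω hω A
  refine (EReal.coe_ennreal_le_coe_ennreal_iff.2 (hω A)).trans_eq ?_
  rw [EReal.coe_ennreal_ofReal,
    max_eq_left (holderGraphDim_nonneg ENNReal.toReal_nonneg hσ0'.le hσ1'),
    coe_holderGraphDim_dimH]

theorem ae_min_le_dimH_graphOver {τ : EReal} (hθ : IsIIDUniform P θ)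
    (hφb : UniformlyBounded φ) (hφ : LocallyUniformlyBiLipschitz φ)
    (ha : Summable fun n => ‖a n‖) (hq : 1 < q) (hτ0 : 0 < τ) (hτ : upperRate a lam q ≤ τ)
    {A : Set ℝ} (hA : MeasurableSet A) :
    ∀ᵐ ω ∂P, min ((dimH A : EReal) / τ) ((dimH A : EReal) + 2 - 2 * τ) ≤
      (dimH (graphOver (phaseSeries a lam φ fun n => θ n ω) A) : EReal) := by
  rcases eq_or_ne τ ⊤ with rfl | hτtop
  · simp [EReal.mul_top_of_pos]
  lift τ to ℝ using ⟨hτtop, hτ0.ne_bot⟩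
  have hτ0' : 0 < τ := EReal.coe_pos.1 hτ0
  filter_upwards [ae_ofReal_le_dimH_graphOver_of_forall_lt hθ hφb hφ ha hq hτ0'.le hτ hA
    fun u hu => rieszOrder_lt_of_lt_holderGraphDim hτ0' hu] with ω hω
  rw [← coe_holderGraphDim_dimH]
  refine le_trans ?_ (EReal.coe_ennreal_le_coe_ennreal_iff.2 hω)
  rw [EReal.coe_ennreal_ofReal]
  exact EReal.coe_le_coe_iff.2 (le_max_left _ _)

theorem ae_dimH_graphOver_eq_two_add (hθ : IsIIDUniform P θ)
    (hφb : UniformlyBounded φ) (hφ : LocallyUniformlyBiLipschitz φ)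
    (ha : Summable fun n => ‖a n‖) (hq : 1 < q) (hτ : upperRate a lam q ≤ 0)
    {A : Set ℝ} (hA : MeasurableSet A) (hA0 : 0 < dimH A) :
    ∀ᵐ ω ∂P, dimH (graphOver (phaseSeries a lam φ fun n => θ n ω) A) = 2 + dimH A := by
  have hd0 : 0 < (dimH A).toReal := ENNReal.toReal_pos hA0.ne' (Real.dimH_ne_top A)
  have hsum : ENNReal.ofReal (2 + (dimH A).toReal) = 2 + dimH A := by
    rw [ENNReal.ofReal_add zero_le_two hd0.le, ENNReal.ofReal_toReal (Real.dimH_ne_top A),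
      ENNReal.ofReal_ofNat]
  have horder : ∀ u < 2 + (dimH A).toReal, rieszOrder 0 u < (dimH A).toReal := fun u hu => by
    rw [rieszOrder, mul_zero, zero_add]
    exact max_lt (by linarith) hd0
  filter_upwards [ae_ofReal_le_dimH_graphOver_of_forall_lt hθ hφb hφ ha hq le_rfl hτ hA horder]
    with ω hω
  refine le_antisymm ?_ (hsum.symm.trans_le hω)
  have hadd := dimH_graphOver_le_add le_rfl zero_le_one (locallyHolder_zero_of_continuous
    (continuous_phaseSeries (lam := lam) hφb hφ ha fun n => θ n ω)) A
  rwa [mul_zero, sub_zero, ENNReal.ofReal_ofNat, add_comm] at hadd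

end DimensionBounds

end SteinhausSeries

open SteinhausSeries in
theorem theorem1p2_general {Ω : Type*} [MeasurableSpace Ω] {P : Measure Ω}
    [IsProbabilityMeasure P] {θ : ℕ → Ω → ℝ} (hθ : IsIIDUniform P θ)
    {φ : ℕ → ℝ → ℂ} (hφb : UniformlyBounded φ) (hφ : LocallyUniformlyBiLipschitz φ)
    {a : ℕ → ℂ} (ha : Summable fun n => ‖a n‖) {lam : ℕ → ℝ} (hlam : ∀ n, 1 ≤ lam n)
    {q : ℝ} (hq : 1 < q) {σ τ : EReal} (hσ : σ ≤ lowerRate a lam q)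
    (hτ : upperRate a lam q ≤ τ) :
    (0 < σ → σ ≤ 1 → ∀ᵐ ω ∂P, ∀ A : Set ℝ,
      (dimH (graphOver (phaseSeries a lam φ fun n => θ n ω) A) : EReal) ≤
        min ((dimH A : EReal) / σ) ((dimH A : EReal) + 2 - 2 * σ)) ∧
    (0 < τ → ∀ A : Set ℝ, MeasurableSet A → ∀ᵐ ω ∂P,
      min ((dimH A : EReal) / τ) ((dimH A : EReal) + 2 - 2 * τ) ≤
        (dimH (graphOver (phaseSeries a lam φ fun n => θ n ω) A) : EReal)) ∧
    (τ = 0 → ∀ A : Set ℝ, MeasurableSet A → 0 < dimH A → ∀ᵐ ω ∂P,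
      dimH (graphOver (phaseSeries a lam φ fun n => θ n ω) A) = 2 + dimH A) :=
  ⟨fun hσ0 hσ1 => ae_dimH_graphOver_le hθ hφb hφ ha hlam hq hσ0 hσ1 hσ,
    fun hτ0 _ hA => ae_min_le_dimH_graphOver hθ hφb hφ ha hq hτ0 hτ hA,
    fun hτ0 _ hA hA0 => ae_dimH_graphOver_eq_two_add hθ hφb hφ ha hq (hτ.trans_eq hτ0) hA hA0⟩

theorem theorem1p2 {Ω : Type*} [MeasurableSpace Ω] (P : Measure Ω) [IsProbabilityMeasure P]
    (θ : ℕ → Ω → ℝ) (hθ : SteinhausSeries.IsIIDUniform P θ)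
    (φ : ℕ → ℝ → ℂ) (hφb : SteinhausSeries.UniformlyBounded φ)
    (hφ : SteinhausSeries.LocallyUniformlyBiLipschitz φ)
    (a : ℕ → ℂ) (ha0 : ∀ n, a n ≠ 0) (ha : Summable fun n => ‖a n‖)
    (lam : ℕ → ℝ) (hlam0 : lam 0 = 1) (hlam : Monotone lam)
    (q : ℝ) (hq : IsLUB (Set.range fun n => lam (n + 1) / lam n) q) (hq1 : 1 < q)
    (σ τ : EReal) (hσ : σ = SteinhausSeries.lowerRate a lam q)
    (hτ : τ = SteinhausSeries.upperRate a lam q) :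
    (0 < σ → σ ≤ τ → τ ≤ 1 → ∀ A : Set ℝ, MeasurableSet A → ∀ᵐ ω ∂P,
      min ((dimH A : EReal) / τ) ((dimH A : EReal) + 2 - 2 * τ) ≤
          (dimH (SteinhausSeries.graphOver
            (SteinhausSeries.phaseSeries a lam φ fun n => θ n ω) A) : EReal) ∧
        (dimH (SteinhausSeries.graphOver
            (SteinhausSeries.phaseSeries a lam φ fun n => θ n ω) A) : EReal) ≤
          min ((dimH A : EReal) / σ) ((dimH A : EReal) + 2 - 2 * σ)) ∧
    (τ = 0 → ∀ A : Set ℝ, MeasurableSet A → 0 < dimH A → ∀ᵐ ω ∂P,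
      dimH (SteinhausSeries.graphOver
        (SteinhausSeries.phaseSeries a lam φ fun n => θ n ω) A) = 2 + dimH A) := by
  obtain ⟨hupper, hlower, hzero⟩ := theorem1p2_general hθ hφb hφ ha
    (fun n => hlam0.symm.trans_le (hlam n.zero_le)) hq1 hσ.le hτ.ge
  exact ⟨fun hσ0 hστ hτ1 A hA => (hlower (hσ0.trans_le hστ) A hA).and
    ((hupper hσ0 (hστ.trans hτ1)).mono fun _ h => h A), hzero⟩
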